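/- **Setting.** For $z\in\mathbb C^\times$, $p\in\mathbb Z$ put $l_p(z)=\log|z|+i\arg z+2\pi ip$ with $0\le\arg z<2\pi$, and $\log z=l_0(z)$. For a vector space $U$, $U\{x\}[\log x]$ is the space of series $\sum_{k=0}^K\sum_{n\in\mathbb C}a_{n,k}x^n(\log x)^k$, $a_{n,k}\in U$; the value of such a series at $z$ is obtained by substituting $x^n=e^{n\log z}$, $\log x=\log z$. Let $V$ be a vertex operator algebra. A $g$-twisted $V$-module ($g$ an automorphism of $V$) is a lower-bounded generalized $g$-twisted $V$-module $W=\coprod_{n\in\mathbb C}W_{[n]}$: the twisted vertex operator map $Y_W:V\otimes W\to W\{x\}[\log x]$ is compatible with the weight gradings and satisfies the equivariance, identity, duality, $L(0)$-grading and $L(-1)$-derivative properties. Write $W'=\coprod_n W_{[n]}^*$ for its contragredient, a graded vector space with vertex operator map $\langle Y_{W'}(v,x)w',w\rangle=\langle w',Y_W(e^{xL(1)}(-x^{-2})^{L(0)}v,x^{-1})w\rangle$, $\overline W=\prod_nW_{[n]}$ for the algebraic completion, and $\pi_n$ for the projection to weight $n$. A *twisted intertwining operator* of type $\binom{W_3}{W_1W_2}$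 is a linear map $\mathcal Y:W_1\otimes W_2\to W_3\{x\}[\log x]$, whose values $\mathcal Y(w_1,z)w_2$ are well-defined elements of $\overline{W_3}$ (each $\pi_n\mathcal Y(w_1,x)w_2$ has finitely many nonzero terms), satisfying: (1) lower truncation: the coefficients of $x^{-n-l-1}(\log x)^k$, $l\in\mathbb N$, in $\mathcal Y(w_1,x)w_2$ vanish for large $l$; (2) duality: for $u\in V$, $w_1$, $w_2$ and $w_3'\in W_3'$ there is a maximally extended multivalued analytic function on $M^2=\{z_1,z_2\neq0,\ z_1\ne z_2\}$ with a preferred branch $f^e$ on $M^2$ cut along the positive real lines in the $z_1$-, $z_2$- and $(z_1-z_2)$-planes (the cuts being attached to the upper half planes), such that the series (sums over the $\pi_n$ between the two operators) $\langle w_3',Y_{W_3}(u,z_1)\mathcal Y(w_1,z_2)w_2\rangle$, $\langle w_3',\mathcal Y(w_1,z_2)Y_{W_2}(u,z_1)w_2\rangle$, $\langle w_3',\mathcal Y(Y_{W_1}(u,z_1-z_2)w_1,z_2)w_2\rangle$ converge absolutely for $|z_1|>|z_2|>0$, $|z_2|>|z_1|>0$, $|z_2|>|z_1-z_2|>0$,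 respectively, and equal $f^e$ when in addition $|\arg(z_1-z_2)-\arg z_1|<\frac\pi2$, $-\frac{3\pi}2<\arg(z_1-z_2)-\arg z_2<-\frac\pi2$, $|\arg z_1-\arg z_2|<\frac\pi2$, respectively; (3) for $k\ge3$ the series $\langle w_3',Y_{W_3}(u_1,z_1)\cdots Y_{W_3}(u_{k-1},z_{k-1})\mathcal Y(w_1,z_k)w_2\rangle$ converges absolutely for $|z_1|>\cdots>|z_k|>0$ and extends to a multivalued analytic function on $M^k=\{z_i\ne0,\ z_i\ne z_j\ (i\neq j)\}$ all of whose component-isolated singularities are regular; (4) $\frac{d}{dx}\mathcal Y(w_1,x)=\mathcal Y(L(-1)w_1,x)$. Here, for a multivalued analytic function on $\Omega\subset\mathbb C^k$ and new variables $\zeta=(z_1,\dots,z_k)A-\beta$ ($A\in GL(k,\mathbb C)$, $\beta\in\mathbb C^k$), $\zeta=\delta\in\{0,\infty\}^k$ is a *component-isolated singularity* if for some $r_i>0$ the set where $0<|\zeta_i|<r_i$ when $\delta_i=0$ and $|\zeta_i|>r_i$ when $\delta_i=\infty$ lies in $\Omega$; it is *regular* if there are $K\in\mathbb N$ and finite sets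 $R_i\subset\mathbb C$ such that on such a set every branch has an absolutely convergent expansion in the monomials $\prod_i\zeta_i^{a_i}(\log\zeta_i)^{j_i}$, $0\le j_i\le K$, with $a_i\in R_i+\mathbb N$ if $\delta_i=0$ and $a_i\in R_i-\mathbb N$ if $\delta_i=\infty$. Let $G$ be a group of automorphisms of $V$, and let $\mathcal C$ be either a category of $g$-twisted $V$-modules without $g$-actions, $g\in G$, or a category of $g$-twisted $V$-modules, $g\in G$, with actions of $G$ (in the latter case $g$ acts on a $g$-twisted module compatibly with $Y_W$ and with a grading by $\mathbb C/\mathbb Z$ into generalized eigenspaces with bounded nilpotency). Fix $z\in\mathbb C^\times$ and let $W_1,W_2$ be $g_1$-, $g_2$-twisted modules in $\mathcal C$, $g_1,g_2\in G$. Let $W_1\tilde\boxtimes_{P(z)}W_2\subset(W_1\otimes W_2)^*$ be the span of the functionals $\lambda_{I,w_3'}(w_1\otimes w_2)=\langle w_3',I(w_1\otimes w_2)\rangle$ for all $g_1g_2$-twisted $W_3$ in $\mathcal C$, all maps $I=\mathcal Y(\cdot,z)\cdot$ with $\mathcal Y$ a twisted intertwining operator of type $\binom{W_3}{W_1W_2}$,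 and all $w_3'\in W_3'$, graded by the weights of $w_3'$ and with vertex operator map $Y(v,x)\lambda_{I,w_3'}=\lambda_{I,Y_{W_3'}(v,x)w_3'}$. Assume: (i) for all objects $U_1,U_2$ of $\mathcal C$ ($h_1$- and $h_2$-twisted), $U_1\tilde\boxtimes_{P(z)}U_2$ is (for a suitable action of $G$, if objects of $\mathcal C$ carry actions) an $(h_1h_2)^{-1}$-twisted module in $\mathcal C$; (ii) contragredients of $h$-twisted objects of $\mathcal C$ are (in the same sense) $h^{-1}$-twisted modules in $\mathcal C$; (iii) every object of $\mathcal C$ is equivalent, as a twisted module, to its double contragredient. **Proposition.** Let $W$ be a $(g_1g_2)^{-1}$-twisted $V$-module in $\mathcal C$ and $f:W\to W_1\tilde\boxtimes_{P(z)}W_2$ a $V$-module map. Define $\mathcal Y_f(w_1,z)w_2\in\overline{W'}$ by $$\langle w,\mathcal Y_f(w_1,z)w_2\rangle=(f(w))(w_1\otimes w_2)\qquad(w\in W,\ w_1\in W_1,\ w_2\in W_2)$$ and the formal series $$\mathcal Y_f(w_1,x)w_2=x^{L_{W'}(0)}e^{-(\log z)L_{W'}(0)}\,\mathcal Y_f\bigl(x^{-L_{W_1}(0)}e^{(\log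 z)L_{W_1}(0)}w_1,z\bigr)\,x^{-L_{W_2}(0)}e^{(\log z)L_{W_2}(0)}w_2 ,$$ in which each power of $x$ is multiplied by a polynomial in $\log x$. Then: (a) the value at $z$ of the series $\mathcal Y_f(w_1,x)w_2$ is the given $\mathcal Y_f(w_1,z)w_2$; (b) $\mathcal Y_f$ is linear, its values are well-defined elements of $\overline{W'}$, and it satisfies (1)–(4) with $W_3=W'$; (c) if $W$ is finitely generated as a module, then $\mathcal Y_f(w_1,x)w_2\in W'\{x\}[\log x]$ for all $w_1,w_2$; (d) whenever $\mathcal Y_f$ is a map to $W'\{x\}[\log x]$, that is, for all $w_1,w_2$ the powers of $\log x$ in $\mathcal Y_f(w_1,x)w_2$ are bounded, $\mathcal Y_f$ is a twisted intertwining operator of type $\binom{W'}{W_1W_2}$. In particular, (a)–(d) hold for $W=W_1\tilde\boxtimes_{P(z)}W_2$ and $f=1_W$, which gives the canonical twisted intertwining operator $\mathcal Y_{1}$ of type $\binom{W_1\boxtimes_{P(z)}W_2}{W_1W_2}$, where $W_1\boxtimes_{P(z)}W_2=(W_1\tilde\boxtimes_{P(z)}W_2)'$. -/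

import Mathlib

open scoped TensorProduct Topology

universe u v

/-! ### Complex logarithms and formal series -/

/-- The argument of a complex number, normalized by `0 ≤ arg z < 2π`. -/
noncomputable def argZ (z : ℂ) : ℝ :=
  if 0 ≤ Complex.arg z then Complex.arg z else Complex.arg z + 2 * Real.pi

/-- `l_p(z) = log |z| + i arg z + 2π p i` with `0 ≤ arg z < 2π`. -/
noncomputable def logBranch (p : ℤ) (z : ℂ) : ℂ :=
  (Real.log ‖z‖ : ℂ) + Complex.I * ((argZ z : ℂ) + 2 * (Real.pi : ℂ) * (p : ℂ))

/-- A formal series `∑ s a k • x ^ a (log x) ^ k` with coefficients in `U`, where `a` runs through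
`ℂ` and `k` through `ℕ`.  The space `U{x}[log x]` is singled out by `LogBounded`. -/
abbrev LogSeries (U : Type u) : Type u := ℂ → ℕ → U

/-- The series belongs to `U{x}[log x]`: the powers of `log x` are bounded. -/
def LogBounded {U : Type u} [Zero U] (s : LogSeries U) : Prop :=
  ∃ K : ℕ, ∀ (a : ℂ) (k : ℕ), K < k → s a k = 0

/-- The formal derivative `d/dx`. -/
noncomputable def derivSeries {U : Type u} [AddCommGroup U] [Module ℂ U] (s : LogSeries U) :
    LogSeries U :=
  fun a k => (a + 1) • s (a + 1) k + ((k : ℂ) + 1) • s (a + 1) (k + 1)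

/-- The projection `π_n` of a graded space `⨁ gr n` onto its homogeneous subspace of degree `n` (and
zero if the space is not the direct sum of the `gr n`). -/
noncomputable def gradedProj {ι : Type v} [DecidableEq ι] {M : Type u} [AddCommGroup M]
    [Module ℂ M] (gr : ι → Submodule ℂ M) (n : ι) : M →ₗ[ℂ] M := by
  classical
  exact if h : Function.Bijective (DirectSum.coeLinearMap gr) then
    (gr n).subtype ∘ₗ DirectSum.component ℂ ι (fun i => gr i) n ∘ₗ
      (LinearEquiv.ofBijective (DirectSum.coeLinearMap gr) h).symm.toLinearMap
  else 0

theorem gradedProj_of_mem_ne {ι : Type v} [DecidableEq ι] {M : Type u} [AddCommGroup M]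
    [Module ℂ M] (gr : ι → Submodule ℂ M) {n m : ι} (hnm : m ≠ n) {w : M} (hw : w ∈ gr m) :
    gradedProj gr n w = 0 := by
  unfold gradedProj
  split_ifs with h
  · have key : (LinearEquiv.ofBijective (DirectSum.coeLinearMap gr) h).symm w
        = DirectSum.lof ℂ ι (fun i => gr i) m ⟨w, hw⟩ := by
      rw [LinearEquiv.symm_apply_eq]
      simp [LinearEquiv.ofBijective_apply]
    simp only [LinearMap.comp_apply, LinearEquiv.coe_coe, key]
    rw [DirectSum.component.of]
    simp [hnm]
  · rfl

/-- `π_n` of the value at `z` of the `p`-th analytic branch of a series with coefficients in a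
graded space; the family over all `n` is an element of the algebraic completion. -/
noncomputable def evalComp {M : Type u} [AddCommGroup M] [Module ℂ M] (gr : ℂ → Submodule ℂ M)
    (s : LogSeries M) (p : ℤ) (z : ℂ) (n : ℂ) : M :=
  ∑ᶠ c : ℂ × ℕ, (Complex.exp (c.1 * logBranch p z) * logBranch p z ^ c.2) •
    gradedProj gr n (s c.1 c.2)

/-- The graded dual `W' = ⨁ (W_[n])^*`, as a subspace of the dual of `W = ⨁ W_[n]`. -/
def gradedDual {M : Type u} [AddCommGroup M] [Module ℂ M] (gr : ℂ → Submodule ℂ M) :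
    Submodule ℂ (Module.Dual ℂ M) where
  carrier := {φ | ∃ S : Finset ℂ, ∀ n, n ∉ S → ∀ w ∈ gr n, φ w = 0}
  zero_mem' := ⟨∅, fun _ _ _ _ => rfl⟩
  add_mem' := by
    classical
    rintro φ ψ ⟨S, hS⟩ ⟨T, hT⟩
    refine ⟨S ∪ T, fun n hn w hw => ?_⟩
    rw [Finset.mem_union, not_or] at hn
    simp [hS n hn.1 w hw, hT n hn.2 w hw]
  smul_mem' := by
    rintro c φ ⟨S, hS⟩
    exact ⟨S, fun n hn w hw => by simp [hS n hn w hw]⟩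

/-- The homogeneous subspace `(W')_[n] = (W_[n])^*` of the graded dual. -/
def gradedDualGr {M : Type u} [AddCommGroup M] [Module ℂ M] (gr : ℂ → Submodule ℂ M) (n : ℂ) :
    Submodule ℂ (gradedDual gr) where
  carrier := {φ | ∀ m, m ≠ n → ∀ w ∈ gr m, φ.1 w = 0}
  zero_mem' := fun _ _ _ _ => rfl
  add_mem' := by
    intro φ ψ hφ hψ m hm w hw
    simp [hφ m hm w hw, hψ m hm w hw]
  smul_mem' := by
    intro c φ hφ m hm w hw
    simp [hφ m hm w hw]

/-- The pairing `⟨w', s^p(z)⟩` of an element of the graded dual with the value at `z` of the `p`-th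
branch of a series. -/
noncomputable def pairEval {M : Type u} [AddCommGroup M] [Module ℂ M] {gr : ℂ → Submodule ℂ M}
    (φ : gradedDual gr) (s : LogSeries M) (p : ℤ) (z : ℂ) : ℂ :=
  ∑ᶠ n : ℂ, φ.1 (evalComp gr s p z n)

/-! ### Vertex operator algebras and their automorphisms -/

/-- Vertex operator algebras; `Y n u v` is `u_n v`, where `Y(u, x) v = ∑ u_n v x ^ (-n-1)`. -/
structure VOA (V : Type v) [AddCommGroup V] [Module ℂ V] where
  gr : ℤ → Submodule ℂ V
  Y : ℤ → V →ₗ[ℂ] V →ₗ[ℂ] V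
  vac : V
  conf : V
  c : ℂ
  internal : DirectSum.IsInternal gr
  finiteDimensional : ∀ n, FiniteDimensional ℂ (gr n)
  bounded_below : ∃ N : ℤ, ∀ n, n < N → gr n = ⊥
  vac_mem : vac ∈ gr 0
  conf_mem : conf ∈ gr 2
  lower_truncation : ∀ u v, ∃ N : ℤ, ∀ n, N ≤ n → Y n u v = 0
  vacuum : ∀ n v, Y n vac v = if n = -1 then v else 0
  creation : ∀ v, Y (-1) v vac = v ∧ ∀ n : ℤ, 0 ≤ n → Y n v vac = 0
  /-- the Jacobi identity, in components -/
  borcherds : ∀ (u v w : V) (l m n : ℤ),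
    ∑ᶠ i : ℕ, (Ring.choose m i : ℤ) • Y (m + n - i) (Y (l + i) u v) w =
      ∑ᶠ i : ℕ, ((-1) ^ i * (Ring.choose l i : ℤ)) •
        (Y (m + l - i) u (Y (n + i) v w) -
          (((-1 : ℤˣ) ^ l : ℤˣ) : ℤ) • Y (n + l - i) v (Y (m + i) u w))
  virasoro : ∀ (m n : ℤ) (v : V),
    Y (m + 1) conf (Y (n + 1) conf v) - Y (n + 1) conf (Y (m + 1) conf v) =
      ((m : ℂ) - n) • Y (m + n + 1) conf v +
        (if m + n = 0 then (c * ((m : ℂ) ^ 3 - m) / 12) • v else 0)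
  L0_grading : ∀ n, ∀ v ∈ gr n, Y 1 conf v = (n : ℂ) • v
  Lneg1_derivative : ∀ (n : ℤ) (u v : V), Y n (Y 0 conf u) v = -(n : ℂ) • Y (n - 1) u v

namespace VOA

variable {V : Type v} [AddCommGroup V] [Module ℂ V]

/-- The operator `L_V(n) = ω_{n+1}`. -/
def L (𝒱 : VOA V) (n : ℤ) : V →ₗ[ℂ] V := 𝒱.Y (n + 1) 𝒱.conf

/-- The group of automorphisms of a vertex operator algebra. -/
def Aut (𝒱 : VOA V) : Subgroup (V ≃ₗ[ℂ] V) where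
  carrier := {g | (∀ n u v, g (𝒱.Y n u v) = 𝒱.Y n (g u) (g v)) ∧
    g 𝒱.vac = 𝒱.vac ∧ g 𝒱.conf = 𝒱.conf}
  one_mem' := ⟨fun _ _ _ => rfl, rfl, rfl⟩
  mul_mem' := by
    rintro g h ⟨hg, hg', hg''⟩ ⟨hh, hh', hh''⟩
    refine ⟨fun n u v => ?_, ?_, ?_⟩
    · simp [LinearEquiv.mul_apply, hg, hh]
    · simp [LinearEquiv.mul_apply, hg', hh']
    · simp [LinearEquiv.mul_apply, hg'', hh'']
  inv_mem' := by
    rintro g ⟨hg, hg', hg''⟩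
    have inv_app : ∀ x, g⁻¹ (g x) = x := fun x => g.symm_apply_apply x
    have app_inv : ∀ x, g (g⁻¹ x) = x := fun x => g.apply_symm_apply x
    refine ⟨fun n u v => ?_, ?_, ?_⟩
    · apply g.injective
      rw [app_inv, hg, app_inv, app_inv]
    · conv_lhs => rw [← hg']
      exact inv_app _
    · conv_lhs => rw [← hg'']
      exact inv_app _

end VOA

/-! ### Twisted modules -/

/-- The data underlying a twisted module: a vector space with subspaces `W_[n]` and a linear map
`V ⊗ W → W{x}[log x]`; `Y v w a k` is the coefficient of `x ^ a (log x) ^ k` in `Y(v, x) w`.  The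
axioms are in `IsTwistedModule`. -/
structure ModuleData (V : Type v) [AddCommGroup V] [Module ℂ V] where
  carrier : Type u
  [addCommGroup : AddCommGroup carrier]
  [module : Module ℂ carrier]
  gr : ℂ → Submodule ℂ carrier
  Y : V →ₗ[ℂ] carrier →ₗ[ℂ] LogSeries carrier

namespace ModuleData

attribute [instance] ModuleData.addCommGroup ModuleData.module

variable {V : Type v} [AddCommGroup V] [Module ℂ V]

/-- The projection `π_n : W → W_[n]`. -/
noncomputable def π (M : ModuleData.{u} V) (n : ℂ) : M.carrier →ₗ[ℂ] M.carrier :=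
  gradedProj M.gr n

/-- `L_W(n)`, the coefficient of `x ^ (-n-2)` in `Y_W(ω, x)`. -/
def L (M : ModuleData.{u} V) (𝒱 : VOA V) (n : ℤ) : M.carrier →ₗ[ℂ] M.carrier :=
  LinearMap.proj (R := ℂ) (φ := fun _ : ℕ => M.carrier) 0 ∘ₗ
    LinearMap.proj (R := ℂ) (φ := fun _ : ℂ => ℕ → M.carrier) (-(n : ℂ) - 2) ∘ₗ M.Y 𝒱.conf

/-- The space underlying `W'`. -/
abbrev Dual (M : ModuleData.{u} V) : Type u := gradedDual M.gr

/-- Maps of twisted modules. -/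
def IsModuleMap {M N : ModuleData.{u} V} (f : M.carrier →ₗ[ℂ] N.carrier) : Prop :=
  ∀ v w a k, f (M.Y v w a k) = N.Y v (f w) a k

/-- The module is generated by finitely many elements. -/
def FinitelyGenerated (M : ModuleData.{u} V) : Prop :=
  ∃ S : Finset M.carrier, ∀ N : Submodule ℂ M.carrier, (∀ s ∈ S, s ∈ N) →
    (∀ v, ∀ w ∈ N, ∀ a k, M.Y v w a k ∈ N) → N = ⊤

/-- The formula
`⟨Y'(v, x) w', w⟩ = ⟨w', Y(e ^ (x L(1)) (-x ^ (-2)) ^ L(0) v, x⁻¹) w⟩`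
for homogeneous `v`, in components. -/
def IsContragredientMap (M : ModuleData.{u} V) (𝒱 : VOA V)
    (Y' : V →ₗ[ℂ] M.Dual →ₗ[ℂ] LogSeries M.Dual) : Prop :=
  ∀ (n : ℤ), ∀ v ∈ 𝒱.gr n, ∀ (φ : M.Dual) (w : M.carrier) (a : ℂ) (k : ℕ),
    (Y' v φ a k).1 w = ∑ᶠ j : ℕ, ((-1 : ℂ) ^ n * (-1) ^ k / (j.factorial : ℂ)) *
      φ.1 (M.Y ((𝒱.L 1 ^ j) v) w ((j : ℂ) - 2 * n - a) k)

open Classical in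
/-- The contragredient `W'`.  The vertex operator map is the unique one given by the formula of
`IsContragredientMap`, which exists when `W` is a twisted module. -/
noncomputable def contragredient (M : ModuleData.{u} V) (𝒱 : VOA V) : ModuleData.{u} V where
  carrier := M.Dual
  gr := gradedDualGr M.gr
  Y := if h : ∃ Y', M.IsContragredientMap 𝒱 Y' then h.choose else 0

end ModuleData

section TwistedModules

variable {V : Type v} [AddCommGroup V] [Module ℂ V]

/-- Lower-bounded generalized `g`-twisted `V`-modules without a `g`-action. -/
structure IsTwistedModule (𝒱 : VOA V) (g : 𝒱.Aut) (M : ModuleData.{u} V) : Prop where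
  internal : DirectSum.IsInternal M.gr
  logBounded : ∀ v w, LogBounded (M.Y v w)
  /-- The vertex operator map is homogeneous, `x` having weight `-1`; so `π_n Y(v, z) w` is given by
  a finite sum and `Y(v, z) w` is an element of the algebraic completion of `W`. -/
  homogeneous : ∀ (m : ℤ) (n : ℂ), ∀ v ∈ 𝒱.gr m, ∀ w ∈ M.gr n, ∀ (a : ℂ) (k : ℕ),
    M.Y v w a k ∈ M.gr (n + m + a)
  equivariance : ∀ (p : ℤ) (z : ℂ), z ≠ 0 → ∀ v w n,
    evalComp M.gr (M.Y (g.1 v) w) (p + 1) z n = evalComp M.gr (M.Y v w) p z n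
  identity : ∀ w a k, M.Y 𝒱.vac w a k = if a = 0 ∧ k = 0 then w else 0
  duality : ∀ (u v : V) (w : M.carrier) (φ : M.Dual),
    ∃ (N : ℕ) (A : Fin (N + 1) → Fin (N + 1) → Fin (N + 1) → Fin (N + 1) → ℂ)
      (m n : Fin (N + 1) → ℂ) (t : ℕ), ∀ (p : ℤ) (z₁ z₂ : ℂ),
      let f : ℂ := ∑ i, ∑ j, ∑ k, ∑ l, A i j k l * Complex.exp (m i * logBranch p z₁) *
        Complex.exp (n j * logBranch p z₂) * logBranch p z₁ ^ (k : ℕ) *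
        logBranch p z₂ ^ (l : ℕ) * ((z₁ - z₂) ^ t)⁻¹
      (‖z₂‖ < ‖z₁‖ → z₂ ≠ 0 →
        HasSum (fun r : ℂ => pairEval φ (M.Y u (evalComp M.gr (M.Y v w) p z₂ r)) p z₁) f) ∧
      (‖z₁‖ < ‖z₂‖ → z₁ ≠ 0 →
        HasSum (fun r : ℂ => pairEval φ (M.Y v (evalComp M.gr (M.Y u w) p z₁ r)) p z₂) f) ∧
      (‖z₁ - z₂‖ < ‖z₂‖ → z₁ ≠ z₂ →
        Summable (fun r : ℤ => pairEval φ
          (M.Y (∑ᶠ j : ℤ, (z₁ - z₂) ^ (-j - 1) • gradedProj 𝒱.gr r (𝒱.Y j u v)) w) p z₂) ∧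
        (|argZ z₁ - argZ z₂| < Real.pi / 2 →
          HasSum (fun r : ℤ => pairEval φ
            (M.Y (∑ᶠ j : ℤ, (z₁ - z₂) ^ (-j - 1) • gradedProj 𝒱.gr r (𝒱.Y j u v)) w) p z₂) f))
  L0_grading : ∀ n, ∀ w ∈ M.gr n, ∃ K : ℕ, 0 < K ∧ ((M.L 𝒱 0 - n • 1) ^ K) w = 0
  Lneg1_derivative : ∀ v w, derivSeries (M.Y v w) = M.Y (𝒱.L (-1) v) w
  lower_bounded : ∀ n : ℂ, ∃ r : ℝ, ∀ l : ℝ, l < r → M.gr (n + l) = ⊥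

open Classical in
/-- Lower-bounded generalized `g`-twisted `V`-modules with an action of a group `G` of automorphisms
of `V`, such that the action of `g ∈ G` is a `g`-action, that is, `g` is compatible with the vertex
operators and `W` is doubly graded by weights and `g`-weights in `ℂ/ℤ`. -/
structure IsTwistedModuleWithAction (𝒱 : VOA V) (G : Subgroup 𝒱.Aut) (g : G)
    (M : ModuleData.{u} V) (ρ : G →* Module.End ℂ M.carrier) : Prop where
  twisted : IsTwistedModule 𝒱 g.1 M
  g_grading : ∃ gr₂ : ℂ → (ℂ ⧸ AddSubgroup.zmultiples (1 : ℂ)) → Submodule ℂ M.carrier,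
    DirectSum.IsInternal
      (fun c : ℂ × (ℂ ⧸ AddSubgroup.zmultiples (1 : ℂ)) => gr₂ c.1 c.2) ∧
    (∀ n, M.gr n = ⨆ α, gr₂ n α) ∧
    ∃ Λ : ℕ, 0 < Λ ∧ ∀ (n α : ℂ), ∀ w ∈ gr₂ n (QuotientAddGroup.mk α),
      ((ρ g - Complex.exp (2 * Real.pi * α * Complex.I) • 1) ^ Λ) w = 0
  g_compatible : ∀ v w a k, ρ g (M.Y v w a k) = M.Y (g.1.1 v) (ρ g w) a k

end TwistedModules

/-! ### Multivalued analytic functions -/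

/-- The region `M^k` of all `(z_1, …, z_k)` with `z_i ≠ 0` and `z_i ≠ z_j` for `i ≠ j`. -/
def confRegion (k : ℕ) : Set (Fin k → ℂ) :=
  {z | (∀ i, z i ≠ 0) ∧ ∀ i j, i ≠ j → z i ≠ z j}

/-- The germ of `ψ` at `q` is obtained from the germ of `φ` at `p` by analytic continuation along
the path `γ`. -/
def ContinuesAlong {k : ℕ} {p q : Fin k → ℂ} (γ : Path p q) (φ ψ : (Fin k → ℂ) → ℂ) : Prop :=
  ∃ Φ : unitInterval → (Fin k → ℂ) → ℂ,
    (∀ t, AnalyticAt ℂ (Φ t) (γ t)) ∧ Φ 0 =ᶠ[𝓝 p] φ ∧ Φ 1 =ᶠ[𝓝 q] ψ ∧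
    ∀ t, ∀ᶠ s in 𝓝 t, Φ s =ᶠ[𝓝 (γ s)] Φ t

/-- The germ of `φ` at `p` extends to a multivalued analytic function on `Ω`: it can be continued
along all paths in `Ω`. -/
def ExtendsOn {k : ℕ} (Ω : Set (Fin k → ℂ)) (p : Fin k → ℂ) (φ : (Fin k → ℂ) → ℂ) : Prop :=
  ∀ (q : Fin k → ℂ) (γ : Path p q), (∀ t, γ t ∈ Ω) → ∃ ψ, ContinuesAlong γ φ ψ

/-- Inside a small neighborhood of `p`: `q` is on the same side of the cuts along the positive real
lines in the `z_i`-planes as `p`, where the cuts are attached to the upper half planes. -/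
def SameSheet {k : ℕ} (p q : Fin k → ℂ) : Prop :=
  ∀ i, |argZ (q i) - argZ (p i)| < Real.pi

/-- `f` is a single-valued branch, on the region obtained from `M^2` by cutting along the positive
real lines in the `z_1`-, `z_2`- and `(z_1 - z_2)`-planes (the cuts being attached to the upper half
planes), of a maximally extended multivalued analytic function on `M^2`. -/
def IsPreferredBranch (f : (Fin 2 → ℂ) → ℂ) : Prop :=
  ∀ p ∈ confRegion 2, ∃ φ : (Fin 2 → ℂ) → ℂ, AnalyticAt ℂ φ p ∧
    (∀ᶠ q in 𝓝 p, SameSheet p q → |argZ (q 0 - q 1) - argZ (p 0 - p 1)| < Real.pi → f q = φ q) ∧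
    ExtendsOn (confRegion 2) p φ

/-- The polycircular domain `Δ^×(δ, r)` around `δ ∈ {0, ∞}^k`; `δ i = true` stands for `∞`. -/
def polyPunctured {k : ℕ} (δ : Fin k → Bool) (r : Fin k → ℝ) : Set (Fin k → ℂ) :=
  {ζ | ∀ i, if δ i then r i < ‖ζ i‖ else 0 < ‖ζ i‖ ∧ ‖ζ i‖ < r i}

/-- The monomial `∏ ζ_i ^ (a_i) (log ζ_i) ^ (j_i)`. -/
noncomputable def logMonomial {k : ℕ} (a : Fin k → ℂ) (j : Fin k → ℕ) (ζ : Fin k → ℂ) : ℂ :=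
  ∏ i, Complex.exp (a i * logBranch 0 (ζ i)) * logBranch 0 (ζ i) ^ j i

/-- All component-isolated singularities of the multivalued analytic function on `Ω` generated by the
germ of `φ` at `p` are regular.  The independent variables are `ζ = z A - β`; `ζ = δ` is a
component-isolated singularity if some `Δ^×(δ, r)` lies in `Ω` (in terms of `ζ`), and it is regular
if all branches near `δ` have absolutely convergent expansions in powers of `ζ_i` and `log ζ_i`, with
bounded powers of the logarithms and with exponents in finitely many sets `R + ℕ` (for `δ_i = 0`) or
`R - ℕ` (for `δ_i = ∞`). -/
def HasRegularSingularities {k : ℕ} (Ω : Set (Fin k → ℂ)) (p : Fin k → ℂ)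
    (φ : (Fin k → ℂ) → ℂ) : Prop :=
  ∀ (A : GL (Fin k) ℂ) (β : Fin k → ℂ) (δ : Fin k → Bool),
    let zOf : (Fin k → ℂ) → (Fin k → ℂ) :=
      fun ζ => Matrix.vecMul (ζ + β) (A⁻¹ : GL (Fin k) ℂ).1
    (∃ r : Fin k → ℝ, (∀ i, 0 < r i) ∧ ∀ ζ ∈ polyPunctured δ r, zOf ζ ∈ Ω) →
    ∃ r : Fin k → ℝ, (∀ i, 0 < r i) ∧ (∀ ζ ∈ polyPunctured δ r, zOf ζ ∈ Ω) ∧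
    ∃ (K : ℕ) (R : Fin k → Finset ℂ),
      ∀ ζ₀ ∈ polyPunctured δ r, ∀ (γ : Path p (zOf ζ₀)) (ψ : (Fin k → ℂ) → ℂ),
        (∀ t, γ t ∈ Ω) → ContinuesAlong γ φ ψ →
        ∃ α : (Fin k → ℂ) → (Fin k → ℕ) → ℂ,
          (∀ a j, α a j ≠ 0 → ∀ i, j i ≤ K ∧
            ∃ b ∈ R i, ∃ m : ℕ, a i = if δ i then b - m else b + m) ∧
          (∀ ζ ∈ polyPunctured δ r,
            Summable fun c : (Fin k → ℂ) × (Fin k → ℕ) => α c.1 c.2 * logMonomial c.1 c.2 ζ) ∧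
          ∀ᶠ ζ in 𝓝 ζ₀, SameSheet ζ₀ ζ → ψ (zOf ζ) =
            ∑' c : (Fin k → ℂ) × (Fin k → ℕ), α c.1 c.2 * logMonomial c.1 c.2 ζ

/-! ### Twisted intertwining operators -/

section Intertwining

variable {V : Type v} [AddCommGroup V] [Module ℂ V]

/-- `π_{n_1} Y(u_1, z_1) π_{n_2} Y(u_2, z_2) ⋯ π_{n_s} Y(u_s, z_s) w`. -/
noncomputable def chainComp (M : ModuleData.{u} V) : (s : ℕ) → (Fin s → V) → (Fin s → ℂ) →
    (Fin s → ℂ) → M.carrier → M.carrier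
  | 0, _, _, _, w => w
  | s + 1, u, z, n, w =>
      evalComp M.gr (M.Y (u 0) (chainComp M s (Fin.tail u) (Fin.tail z) (Fin.tail n) w)) 0 (z 0)
        (n 0)

/-- The term
`⟨φ, Y(u_1, z_1) π_{n_1} Y(u_2, z_2) ⋯ π_{n_{s+1}} 𝒴(w₁, z_{s+2}) w₂⟩`
for `s + 1` twisted vertex operators and one twisted intertwining operator. -/
noncomputable def productTerm {W₁ W₂ W₃ : ModuleData.{u} V}
    (𝒴 : W₁.carrier → W₂.carrier → LogSeries W₃.carrier) (s : ℕ) (u : Fin (s + 1) → V)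
    (w₁ : W₁.carrier) (w₂ : W₂.carrier) (φ : W₃.Dual) (z : Fin (s + 2) → ℂ)
    (n : Fin (s + 1) → ℂ) : ℂ :=
  pairEval φ (W₃.Y (u 0) (chainComp W₃ s (Fin.tail u) (fun i => z i.succ.castSucc)
    (fun i => n i.castSucc) (evalComp W₃.gr (𝒴 w₁ w₂) 0 (z (Fin.last _)) (n (Fin.last _)))))
    0 (z 0)

/-- The axioms for twisted intertwining operators of type `W₃` over `W₁ W₂`, apart from the
requirement that the series `𝒴(w₁, x) w₂` belong to `W₃{x}[log x]`. -/
structure IntertwiningAxioms (𝒱 : VOA V) {W₁ W₂ W₃ : ModuleData.{u} V}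
    (𝒴 : W₁.carrier → W₂.carrier → LogSeries W₃.carrier) : Prop where
  linear : ∃ B : W₁.carrier →ₗ[ℂ] W₂.carrier →ₗ[ℂ] LogSeries W₃.carrier,
    ∀ w₁ w₂, 𝒴 w₁ w₂ = B w₁ w₂
  /-- `π_n 𝒴(w₁, z) w₂` is given by a finite sum, so that `𝒴(w₁, z) w₂` is an element of the algebraic
  completion of `W₃`. -/
  evaluable : ∀ w₁ w₂ n, {c : ℂ × ℕ | W₃.π n (𝒴 w₁ w₂ c.1 c.2) ≠ 0}.Finite
  lower_truncation : ∀ w₁ w₂ (n : ℂ) (k : ℕ), ∃ N : ℕ, ∀ l : ℕ, N ≤ l →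
    𝒴 w₁ w₂ (-(n + l) - 1) k = 0
  duality : ∀ (u : V) (w₁ : W₁.carrier) (w₂ : W₂.carrier) (φ : W₃.Dual),
    ∃ f : (Fin 2 → ℂ) → ℂ, IsPreferredBranch f ∧ ∀ z₁ z₂ : ℂ,
      (‖z₂‖ < ‖z₁‖ → z₂ ≠ 0 →
        Summable (fun n : ℂ =>
          pairEval φ (W₃.Y u (evalComp W₃.gr (𝒴 w₁ w₂) 0 z₂ n)) 0 z₁) ∧
        (|argZ (z₁ - z₂) - argZ z₁| < Real.pi / 2 →
          HasSum (fun n : ℂ =>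
            pairEval φ (W₃.Y u (evalComp W₃.gr (𝒴 w₁ w₂) 0 z₂ n)) 0 z₁) (f ![z₁, z₂]))) ∧
      (‖z₁‖ < ‖z₂‖ → z₁ ≠ 0 →
        Summable (fun n : ℂ =>
          pairEval φ (𝒴 w₁ (evalComp W₂.gr (W₂.Y u w₂) 0 z₁ n)) 0 z₂) ∧
        (-(3 * Real.pi / 2) < argZ (z₁ - z₂) - argZ z₂ →
          argZ (z₁ - z₂) - argZ z₂ < -(Real.pi / 2) →
          HasSum (fun n : ℂ =>
            pairEval φ (𝒴 w₁ (evalComp W₂.gr (W₂.Y u w₂) 0 z₁ n)) 0 z₂) (f ![z₁, z₂]))) ∧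
      (‖z₁ - z₂‖ < ‖z₂‖ → z₁ ≠ z₂ →
        Summable (fun n : ℂ =>
          pairEval φ (𝒴 (evalComp W₁.gr (W₁.Y u w₁) 0 (z₁ - z₂) n) w₂) 0 z₂) ∧
        (|argZ z₁ - argZ z₂| < Real.pi / 2 →
          HasSum (fun n : ℂ =>
            pairEval φ (𝒴 (evalComp W₁.gr (W₁.Y u w₁) 0 (z₁ - z₂) n) w₂) 0 z₂)
            (f ![z₁, z₂])))
  /-- products with at least two twisted vertex operators -/
  convergence : ∀ (s : ℕ), 1 ≤ s → ∀ (u : Fin (s + 1) → V) (w₁ : W₁.carrier) (w₂ : W₂.carrier)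
    (φ : W₃.Dual) (p : Fin (s + 2) → ℂ), StrictAnti (fun i => ‖p i‖) → (∀ i, p i ≠ 0) →
    Summable (productTerm 𝒴 s u w₁ w₂ φ p) ∧
    ∃ F : (Fin (s + 2) → ℂ) → ℂ, AnalyticAt ℂ F p ∧
      (∀ᶠ q in 𝓝 p, SameSheet p q → ∑' n, productTerm 𝒴 s u w₁ w₂ φ q n = F q) ∧
      ExtendsOn (confRegion (s + 2)) p F ∧
      HasRegularSingularities (confRegion (s + 2)) p F
  Lneg1_derivative : ∀ w₁ w₂, derivSeries (𝒴 w₁ w₂) = 𝒴 (W₁.L 𝒱 (-1) w₁) w₂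

/-- Twisted intertwining operators of type `W₃` over `W₁ W₂`. -/
structure IsTwistedIntertwiningOperator (𝒱 : VOA V) {W₁ W₂ W₃ : ModuleData.{u} V}
    (𝒴 : W₁.carrier → W₂.carrier → LogSeries W₃.carrier) : Prop where
  logBounded : ∀ w₁ w₂, LogBounded (𝒴 w₁ w₂)
  axioms : IntertwiningAxioms 𝒱 𝒴

/-! ### The space spanned by the functionals coming from `P(z)`-products -/

/-- `μ = λ_{I, φ}`, where `I` is the `P(z)`-intertwining map `w₁ ⊗ w₂ ↦ 𝒴(w₁, z) w₂` and `φ ∈ W₃'`: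
`λ_{I, φ}(w₁ ⊗ w₂) = ⟨φ, I(w₁ ⊗ w₂)⟩`. -/
def IsProductFunctional (z : ℂ) {W₁ W₂ W₃ : ModuleData.{u} V}
    (𝒴 : W₁.carrier → W₂.carrier → LogSeries W₃.carrier) (φ : W₃.Dual)
    (μ : Module.Dual ℂ (W₁.carrier ⊗[ℂ] W₂.carrier)) : Prop :=
  ∀ w₁ w₂, μ (w₁ ⊗ₜ[ℂ] w₂) = pairEval φ (𝒴 w₁ w₂) 0 z

/-- The span of all `λ_{I, φ}` for `P(z)`-products `(W₃, I)` of `W₁` and `W₂` with `W₃` in the given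
class of modules and `φ ∈ W₃'`. -/
def boxSpace (𝒱 : VOA V) (Obj : ModuleData.{u} V → Prop) (z : ℂ) (W₁ W₂ : ModuleData.{u} V) :
    Submodule ℂ (Module.Dual ℂ (W₁.carrier ⊗[ℂ] W₂.carrier)) :=
  Submodule.span ℂ {μ | ∃ W₃ : ModuleData.{u} V, Obj W₃ ∧
    ∃ 𝒴 : W₁.carrier → W₂.carrier → LogSeries W₃.carrier, IsTwistedIntertwiningOperator 𝒱 𝒴 ∧
    ∃ φ : W₃.Dual, IsProductFunctional z 𝒴 φ μ}

/-- The subspace spanned by the `λ_{I, φ}` with `φ` homogeneous of weight `n`. -/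
def boxGr (𝒱 : VOA V) (Obj : ModuleData.{u} V → Prop) (z : ℂ) (W₁ W₂ : ModuleData.{u} V) (n : ℂ) :
    Submodule ℂ (boxSpace 𝒱 Obj z W₁ W₂) :=
  (Submodule.span ℂ {μ | ∃ W₃ : ModuleData.{u} V, Obj W₃ ∧
    ∃ 𝒴 : W₁.carrier → W₂.carrier → LogSeries W₃.carrier, IsTwistedIntertwiningOperator 𝒱 𝒴 ∧
    ∃ φ ∈ gradedDualGr W₃.gr n, IsProductFunctional z 𝒴 φ μ}).comap
      (boxSpace 𝒱 Obj z W₁ W₂).subtype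

/-- The formula `Y(v, x) λ_{I, φ} = λ_{I, Y'(v, x) φ}`. -/
def IsBoxMap (𝒱 : VOA V) (Obj : ModuleData.{u} V → Prop) (z : ℂ) (W₁ W₂ : ModuleData.{u} V)
    (Y : V →ₗ[ℂ] boxSpace 𝒱 Obj z W₁ W₂ →ₗ[ℂ] LogSeries (boxSpace 𝒱 Obj z W₁ W₂)) : Prop :=
  ∀ W₃ : ModuleData.{u} V, Obj W₃ →
    ∀ 𝒴 : W₁.carrier → W₂.carrier → LogSeries W₃.carrier, IsTwistedIntertwiningOperator 𝒱 𝒴 →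
    ∀ (φ : W₃.Dual) (μ : boxSpace 𝒱 Obj z W₁ W₂), IsProductFunctional z 𝒴 φ μ.1 →
    ∀ v a k, IsProductFunctional z 𝒴 ((W₃.contragredient 𝒱).Y v φ a k) (Y v μ a k).1

open Classical in
/-- The space spanned by the `λ_{I, φ}`, with the vertex operator map determined by
`Y(v, x) λ_{I, φ} = λ_{I, Y'(v, x) φ}`. -/
noncomputable def boxModule (𝒱 : VOA V) (Obj : ModuleData.{u} V → Prop) (z : ℂ)
    (W₁ W₂ : ModuleData.{u} V) : ModuleData.{u} V where
  carrier := boxSpace 𝒱 Obj z W₁ W₂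
  gr := boxGr 𝒱 Obj z W₁ W₂
  Y := if h : ∃ Y, IsBoxMap 𝒱 Obj z W₁ W₂ Y then h.choose else 0

/-! ### Categories of twisted modules -/

/-- A category of `g`-twisted modules for `g ∈ G`, given by its objects: either modules without
actions, or modules with actions of `G`. -/
inductive ModuleCategory (𝒱 : VOA V) (G : Subgroup 𝒱.Aut) : Type (max (u + 1) v)
  | withoutActions (P : G → ModuleData.{u} V → Prop)
      (hP : ∀ g M, P g M → IsTwistedModule 𝒱 g.1 M)
  | withActions (P : G → (M : ModuleData.{u} V) → (G →* Module.End ℂ M.carrier) → Prop)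
      (hP : ∀ g M ρ, P g M ρ → IsTwistedModuleWithAction 𝒱 G g M ρ)

/-- `M` is (with a suitable action of `G`, if the objects of the category carry actions) a
`g`-twisted module in the category. -/
def ModuleCategory.Mem {𝒱 : VOA V} {G : Subgroup 𝒱.Aut} (C : ModuleCategory.{u} 𝒱 G) (g : G)
    (M : ModuleData.{u} V) : Prop :=
  match C with
  | .withoutActions P _ => P g M
  | .withActions P _ => ∃ ρ, P g M ρ

/-- `W₁ ⊠̃_{P(z)} W₂`, for a `g₁`-twisted module `W₁` and a `g₂`-twisted module `W₂`. -/
noncomputable def ModuleCategory.box {𝒱 : VOA V} {G : Subgroup 𝒱.Aut}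
    (C : ModuleCategory.{u} 𝒱 G) (z : ℂ) (g₁ g₂ : G) (W₁ W₂ : ModuleData.{u} V) :
    ModuleData.{u} V :=
  boxModule 𝒱 (C.Mem (g₁ * g₂)) z W₁ W₂

/-- The standing assumption on the category: it contains `W₁ ⊠̃_{P(z)} W₂` for all objects `W₁`, `W₂`
and the contragredients of its objects, and the double contragredient of an object is equivalent to
the object. -/
structure ModuleCategory.StandingAssumption {𝒱 : VOA V} {G : Subgroup 𝒱.Aut}
    (C : ModuleCategory.{u} 𝒱 G) (z : ℂ) : Prop where
  box_mem : ∀ g₁ g₂ W₁ W₂, C.Mem g₁ W₁ → C.Mem g₂ W₂ → C.Mem (g₁ * g₂)⁻¹ (C.box z g₁ g₂ W₁ W₂)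
  contragredient_mem : ∀ g W, C.Mem g W → C.Mem g⁻¹ (W.contragredient 𝒱)
  double_contragredient : ∀ g W, C.Mem g W →
    ∃ e : W.carrier ≃ₗ[ℂ] ((W.contragredient 𝒱).contragredient 𝒱).carrier,
      ModuleData.IsModuleMap e.toLinearMap

/-! ### The operator attached to a module map -/

/-- For a linear map `f` from `W` to functionals on `W₁ ⊗ W₂`, the component in `(W')_[n] = (W_[n])^*`
of the element `𝒴_f(w₁, z) w₂` of the algebraic completion of `W'` given by
`⟨w, 𝒴_f(w₁, z) w₂⟩ = f(w)(w₁ ⊗ w₂)`. -/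
noncomputable def mapComp {W W₁ W₂ : ModuleData.{u} V}
    (f : W.carrier →ₗ[ℂ] Module.Dual ℂ (W₁.carrier ⊗[ℂ] W₂.carrier)) (n : ℂ)
    (w₁ : W₁.carrier) (w₂ : W₂.carrier) : W.Dual :=
  ⟨LinearMap.applyₗ (w₁ ⊗ₜ[ℂ] w₂) ∘ₗ f ∘ₗ W.π n, {n}, fun m hm w hw => by
    have h : W.π n w = 0 := gradedProj_of_mem_ne W.gr (by simpa using hm) hw
    simp [h]⟩

/-- The coefficient of `x ^ a (log x) ^ k` in
`𝒴_f(w₁, x) w₂ = x ^ L(0) e ^ (-(log z) L(0)) 𝒴_f(x ^ (-L(0)) e ^ ((log z) L(0)) w₁, z)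
  x ^ (-L(0)) e ^ ((log z) L(0)) w₂`.
Here `x ^ (±L(0)) e ^ (∓(log z) L(0))` acts on a vector of generalized weight `n` as
`x ^ (±n) e ^ (∓n log z) ∑_j (±(log x - log z)) ^ j (L(0) - n) ^ j / j!`, and `n₁`, `n₂` and
`a + n₁ + n₂` are the weights of the components in `W₁`, `W₂` and `W'`. -/
noncomputable def intOpOfMap (𝒱 : VOA V) (z : ℂ) {W W₁ W₂ : ModuleData.{u} V}
    (f : W.carrier →ₗ[ℂ] Module.Dual ℂ (W₁.carrier ⊗[ℂ] W₂.carrier))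
    (w₁ : W₁.carrier) (w₂ : W₂.carrier) : LogSeries (W.contragredient 𝒱).carrier :=
  fun a k => ∑ᶠ n : ℂ × ℂ, ∑ᶠ j : ℕ × ℕ × ℕ,
    (Complex.exp (-a * logBranch 0 z) * (-1) ^ (j.2.1 + j.2.2) /
        ((j.1.factorial : ℂ) * j.2.1.factorial * j.2.2.factorial) *
      ((Polynomial.X - Polynomial.C (logBranch 0 z)) ^ (j.1 + j.2.1 + j.2.2)).coeff k) •
    (((W.contragredient 𝒱).L 𝒱 0 - (a + n.1 + n.2) • 1) ^ j.1)
      (mapComp f (a + n.1 + n.2) (((W₁.L 𝒱 0 - n.1 • 1) ^ j.2.1) (W₁.π n.1 w₁))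
        (((W₂.L 𝒱 0 - n.2 • 1) ^ j.2.2) (W₂.π n.2 w₂)) : W.Dual)

/-- The assertions about `𝒴_f` for a map `f` from `W` to functionals on `W₁ ⊗ W₂`. -/
structure DefinesIntertwiningOperator (𝒱 : VOA V) (z : ℂ) {W W₁ W₂ : ModuleData.{u} V}
    (f : W.carrier →ₗ[ℂ] Module.Dual ℂ (W₁.carrier ⊗[ℂ] W₂.carrier)) : Prop where
  /-- the value of the series at `z` is given by `⟨w, 𝒴_f(w₁, z) w₂⟩ = f(w)(w₁ ⊗ w₂)` -/
  value : ∀ w w₁ w₂, ∑ᶠ n : ℂ, (evalComp (W.contragredient 𝒱).gr (intOpOfMap 𝒱 z f w₁ w₂) 0 z n :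
    W.Dual).1 w = f w (w₁ ⊗ₜ[ℂ] w₂)
  axioms : IntertwiningAxioms 𝒱 (W₃ := W.contragredient 𝒱) (intOpOfMap 𝒱 z f)
  logBounded_of_finitelyGenerated : W.FinitelyGenerated →
    ∀ w₁ w₂, LogBounded (intOpOfMap 𝒱 z f w₁ w₂)
  intertwining : (∀ w₁ w₂, LogBounded (intOpOfMap 𝒱 z f w₁ w₂)) →
    IsTwistedIntertwiningOperator 𝒱 (W₃ := W.contragredient 𝒱) (intOpOfMap 𝒱 z f)

end Intertwining

/-!
The axioms for `𝒴_f` are statements about the pairings `⟨w, 𝒴_f(w₁, x) w₂⟩` with `w ∈ W`.  For fixed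
`w`, the functional `f w ∈ W₁ ⊠̃ W₂` is by definition of `W₁ ⊠̃ W₂` a finite sum of functionals
`λ_{I, φ}`, so there are intertwining operators `𝒴_i` to modules `M_i` in the category and `φ_i ∈ M_i'`
with `f(w)(w₁ ⊗ w₂) = ∑ ⟨φ_i, 𝒴_i(w₁, z) w₂⟩` (`ProductFamily.exists_represents`).  The claim is that
then `⟨w, 𝒴_f(w₁, x) w₂⟩ = ∑ ⟨φ_i, 𝒴_i(w₁, x) w₂⟩` as series in `x`, and that the same relation
persists when vertex operators and projections are applied.  All axioms for `𝒴_f` follow from those for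
the `𝒴_i`.

* A twisted intertwining operator is determined by its value at `z` through conjugation with powers of
  `x`, by the same formula that defines `𝒴_f` (`intertwining_coeff_eq`).  This rests on the commutator
  formula `[L(0), 𝒴(w₁, x)] = 𝒴(L(0) w₁, x) + x 𝒴(L(-1) w₁, x)` (`commutator_series`), obtained from
  duality for the conformal vector: since the automorphisms fix it, its vertex operators have integral
  powers of `z₁` (`IsTwistedModule.Y_conf_eq_zero`), so that, for `z₂` slightly below the positive real
  axis, the three expansions of the correlation function are Laurent series of one function that is
  single-valued in `z₁`.  The residue theorem compares their coefficients
  (`LaurentGluing.coeff_relation`).  Together with the `L(-1)`-derivative property the commutator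
  formula becomes a recursion for the coefficients of the powers of `log x` (`log_recursion`), whose
  solution is given by Taylor's formula (`taylor_of_family_recursion`).

* The relation `ProductFamily.Compatible` between vectors of `W'` and families of vectors of the `M_i`
  is preserved by vertex operators: the contragredient formula moves them to `W`, the module map `f` and
  the definition of the vertex operators on `W₁ ⊠̃ W₂` move them to the `M_i'`, and the contragredient
  formula, being an involution, moves them back to the `M_i` (`ProductFamily.Compatible.coeffY`).  It
  holds for the coefficients of `𝒴_f` and of the `𝒴_i` (`ProductFamily.compatible_intOpOfMap`).

* The functionals that occur in the axioms for `𝒴_f` are elements of `W''`.  A space equivalent to its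
  graded double dual has finite-dimensional weight spaces, so these are the pairings with the elements
  of `W` (`IsTwistedModule.finiteDimensional_gr`, `IsTwistedModule.exists_eq_ev`).

* Sums of preferred branches are preferred branches, and sums of multivalued functions with regular
  singularities have regular singularities, by uniqueness of analytic continuation
  (`ContinuesAlong.unique`, `HasRegularSingularities.add`).

* If `W` is generated by finitely many vectors, the finitely many families representing their images
  under `f` represent the images of all vectors, so the powers of `log x` are bounded uniformly in `w`
  (`intOpOfMap_logBounded`).
-/

/-! ### Projections of graded spaces -/

section Graded

variable {ι : Type v} [DecidableEq ι] {M : Type u} [AddCommGroup M] [Module ℂ M]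
  {gr : ι → Submodule ℂ M}

theorem gradedProj_mem (gr : ι → Submodule ℂ M) (n : ι) (w : M) : gradedProj gr n w ∈ gr n := by
  unfold gradedProj
  split_ifs with h
  · simp
  · simp

theorem gradedProj_of_mem (h : DirectSum.IsInternal gr) {n : ι} {w : M} (hw : w ∈ gr n) :
    gradedProj gr n w = w := by
  have h' : Function.Bijective (DirectSum.coeLinearMap gr) := h
  have key : (LinearEquiv.ofBijective (DirectSum.coeLinearMap gr) h').symm w
      = DirectSum.lof ℂ ι (fun i => gr i) n ⟨w, hw⟩ := by
    rw [LinearEquiv.symm_apply_eq]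
    simp [LinearEquiv.ofBijective_apply]
  unfold gradedProj
  rw [dif_pos h']
  simp only [LinearMap.comp_apply, LinearEquiv.coe_coe, key]
  rw [DirectSum.component.lof_self]
  rfl

theorem gradedProj_gradedProj (h : DirectSum.IsInternal gr) (n : ι) (w : M) :
    gradedProj gr n (gradedProj gr n w) = gradedProj gr n w :=
  gradedProj_of_mem h (gradedProj_mem gr n w)

theorem exists_finset_gradedProj (h : DirectSum.IsInternal gr) (w : M) :
    ∃ S : Finset ι, (∀ n, n ∉ S → gradedProj gr n w = 0) ∧ ∑ n ∈ S, gradedProj gr n w = w := by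
  classical
  obtain ⟨x, rfl⟩ := h.2 w
  induction x using DirectSum.induction_on with
  | zero => exact ⟨∅, by simp, by simp⟩
  | of i x =>
    refine ⟨{i}, fun n hn => ?_, ?_⟩
    · simp only [DirectSum.coeAddMonoidHom_of]
      exact gradedProj_of_mem_ne gr (by simpa [eq_comm] using hn) x.2
    · simp only [DirectSum.coeAddMonoidHom_of, Finset.sum_singleton]
      exact gradedProj_of_mem h x.2
  | add x y hx hy =>
    obtain ⟨S, hS, hS'⟩ := hx
    obtain ⟨T, hT, hT'⟩ := hy
    refine ⟨S ∪ T, fun n hn => ?_, ?_⟩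
    · rw [Finset.mem_union, not_or] at hn
      rw [map_add, map_add, hS n hn.1, hT n hn.2, add_zero]
    · simp only [map_add, Finset.sum_add_distrib]
      rw [← Finset.sum_subset Finset.subset_union_left (fun n _ hn => hS n hn),
        ← Finset.sum_subset Finset.subset_union_right (fun n _ hn => hT n hn), hS', hT']

theorem finite_gradedProj_ne_zero (h : DirectSum.IsInternal gr) (w : M) :
    {n | gradedProj gr n w ≠ 0}.Finite := by
  obtain ⟨S, hS, -⟩ := exists_finset_gradedProj h w
  exact S.finite_toSet.subset fun n hn => by
    by_contra hc
    exact hn (hS n hc)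

theorem sum_gradedProj_of_subset (h : DirectSum.IsInternal gr) (w : M) (S : Finset ι)
    (hS : ∀ n, n ∉ S → gradedProj gr n w = 0) : ∑ n ∈ S, gradedProj gr n w = w := by
  classical
  obtain ⟨T, hT, hT'⟩ := exists_finset_gradedProj h w
  calc ∑ n ∈ S, gradedProj gr n w = ∑ n ∈ S ∪ T, gradedProj gr n w :=
        Finset.sum_subset Finset.subset_union_left fun n _ hn => hS n hn
    _ = ∑ n ∈ T, gradedProj gr n w :=
        (Finset.sum_subset Finset.subset_union_right fun n _ hn => hT n hn).symm
    _ = w := hT'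

theorem eq_of_gradedProj_eq (h : DirectSum.IsInternal gr) {x y : M}
    (hxy : ∀ n, gradedProj gr n x = gradedProj gr n y) : x = y := by
  obtain ⟨S, hS, hS'⟩ := exists_finset_gradedProj h x
  rw [← hS', ← sum_gradedProj_of_subset h y S fun n hn => by rw [← hxy, hS n hn]]
  exact Finset.sum_congr rfl fun n _ => hxy n

theorem graded_induction (h : DirectSum.IsInternal gr) {p : M → Prop}
    (hadd : ∀ x y, p x → p y → p (x + y)) (hom : ∀ n, ∀ x ∈ gr n, p x) (h0 : p 0) (w : M) :
    p w := by
  obtain ⟨S, -, hS⟩ := exists_finset_gradedProj h w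
  rw [← hS]
  exact Finset.sum_induction _ p hadd h0 fun n _ => hom n _ (gradedProj_mem gr n w)

/-- A linear map of degree zero commutes with the projections. -/
theorem gradedProj_map {N : Type*} [AddCommGroup N] [Module ℂ N] {gr' : ι → Submodule ℂ N}
    (h : DirectSum.IsInternal gr) (h' : DirectSum.IsInternal gr') (T : M →ₗ[ℂ] N)
    (hT : ∀ n, ∀ x ∈ gr n, T x ∈ gr' n) (n : ι) (w : M) :
    gradedProj gr' n (T w) = T (gradedProj gr n w) := by
  refine graded_induction h (p := fun w => gradedProj gr' n (T w) = T (gradedProj gr n w))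
    (fun x y hx hy => by simp only [map_add, hx, hy]) (fun m x hx => ?_) (by simp) w
  by_cases hmn : m = n
  · subst hmn
    rw [gradedProj_of_mem h hx, gradedProj_of_mem h' (hT _ _ hx)]
  · rw [gradedProj_of_mem_ne _ hmn hx, gradedProj_of_mem_ne _ hmn (hT _ _ hx), map_zero]

theorem mem_gr_of_gradedProj (h : DirectSum.IsInternal gr) {n : ι} {w : M}
    (hw : ∀ m, m ≠ n → gradedProj gr m w = 0) : w ∈ gr n := by
  classical
  rw [← sum_gradedProj_of_subset h w {n} fun m hm => hw m (by simpa using hm)]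
  simpa using gradedProj_mem gr n w

end Graded

/-! ### Values of formal series -/

section Evaluation

variable {M : Type u} [AddCommGroup M] [Module ℂ M] {gr : ℂ → Submodule ℂ M}

/-- The series whose values are well-defined elements of the algebraic completion: every homogeneous
component has only finitely many nonzero terms. -/
def evaluableSeries (gr : ℂ → Submodule ℂ M) : Submodule ℂ (LogSeries M) where
  carrier := {s | ∀ n, {c : ℂ × ℕ | gradedProj gr n (s c.1 c.2) ≠ 0}.Finite}
  zero_mem' := fun n => by simp
  add_mem' := by
    intro s t hs ht n
    refine ((hs n).union (ht n)).subset fun c hc => ?_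
    by_contra hcon
    simp only [Set.mem_union, Set.mem_ofPred_eq, not_or, not_not] at hcon
    exact hc (by simp [hcon.1, hcon.2])
  smul_mem' := by
    intro r s hs n
    refine (hs n).subset fun c hc => ?_
    intro hcon
    exact hc (by simp [hcon])

theorem evaluableSeries.support_finite {s : LogSeries M} (hs : s ∈ evaluableSeries gr) (p : ℤ)
    (z n : ℂ) : (Function.support fun c : ℂ × ℕ =>
      (Complex.exp (c.1 * logBranch p z) * logBranch p z ^ c.2) •
        gradedProj gr n (s c.1 c.2)).Finite :=
  (hs n).subset fun c hc h => hc (by simp [h])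

theorem evalComp_add {s t : LogSeries M} (hs : s ∈ evaluableSeries gr)
    (ht : t ∈ evaluableSeries gr) (p : ℤ) (z n : ℂ) :
    evalComp gr (s + t) p z n = evalComp gr s p z n + evalComp gr t p z n := by
  unfold evalComp
  rw [← finsum_add_distrib (evaluableSeries.support_finite hs p z n)
    (evaluableSeries.support_finite ht p z n)]
  simp

theorem evalComp_smul (r : ℂ) (s : LogSeries M) (p : ℤ) (z n : ℂ) :
    evalComp gr (r • s) p z n = r • evalComp gr s p z n := by
  unfold evalComp
  rw [smul_finsum]
  refine finsum_congr fun c => ?_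
  simp only [Pi.smul_apply, map_smul]
  rw [smul_comm]

theorem evalComp_zero (p : ℤ) (z n : ℂ) : evalComp gr (0 : LogSeries M) p z n = 0 := by
  simp [evalComp]

theorem evalComp_mem (s : LogSeries M) (p : ℤ) (z n : ℂ) : evalComp gr s p z n ∈ gr n :=
  finsum_induction (· ∈ gr n) (zero_mem _) (fun _ _ => add_mem)
    fun _ => (gr n).smul_mem _ (gradedProj_mem _ _ _)

/-- A linear functional applied to the value of a series. -/
theorem map_evalComp {N : Type*} [AddCommGroup N] [Module ℂ N] (T : M →ₗ[ℂ] N) {s : LogSeries M}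
    (hs : s ∈ evaluableSeries gr) (p : ℤ) (z n : ℂ) :
    T (evalComp gr s p z n) = ∑ᶠ c : ℂ × ℕ,
      (Complex.exp (c.1 * logBranch p z) * logBranch p z ^ c.2) • T (gradedProj gr n (s c.1 c.2)) := by
  unfold evalComp
  rw [map_finsum T (evaluableSeries.support_finite hs p z n)]
  simp

theorem evalComp_map {T : M →ₗ[ℂ] M} (h : DirectSum.IsInternal gr)
    (hT : ∀ n, ∀ x ∈ gr n, T x ∈ gr n) {s : LogSeries M} (hs : s ∈ evaluableSeries gr) (p : ℤ)
    (z n : ℂ) : evalComp gr (fun a k => T (s a k)) p z n = T (evalComp gr s p z n) := by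
  rw [map_evalComp T hs]
  unfold evalComp
  exact finsum_congr fun c => by rw [gradedProj_map h h T hT]

theorem evalComp_of_single {s : LogSeries M} {n a : ℂ}
    (hs : ∀ b k, b ≠ a → gradedProj gr n (s b k) = 0) (p : ℤ) (z : ℂ) :
    evalComp gr s p z n = Complex.exp (a * logBranch p z) •
      ∑ᶠ k : ℕ, logBranch p z ^ k • gradedProj gr n (s a k) := by
  unfold evalComp
  rw [smul_finsum]
  have hinj : Function.Injective (fun k : ℕ => (a, k)) := fun k l h => (Prod.ext_iff.1 h).2
  rw [← finsum_mem_univ, finsum_mem_inter_support_eq (t := Set.range fun k : ℕ => (a, k)),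
    finsum_mem_range hinj]
  · simp [smul_smul]
  · ext ⟨b, k⟩
    simp only [Set.univ_inter, Set.mem_inter_iff, Set.mem_range, Prod.mk.injEq]
    constructor
    · intro hb
      refine ⟨⟨k, ?_, rfl⟩, hb⟩
      by_contra hne
      exact hb (by simp [hs b k (Ne.symm hne)])
    · exact fun hb => hb.2

theorem pairEval_support_finite (φ : gradedDual gr) (s : LogSeries M) (p : ℤ) (z : ℂ) :
    (Function.support fun n : ℂ => φ.1 (evalComp gr s p z n)).Finite := by
  obtain ⟨S, hS⟩ := φ.2
  refine S.finite_toSet.subset fun n hn => ?_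
  by_contra hc
  exact hn (hS n hc _ (evalComp_mem s p z n))

theorem pairEval_add_right (φ : gradedDual gr) {s t : LogSeries M} (hs : s ∈ evaluableSeries gr)
    (ht : t ∈ evaluableSeries gr) (p : ℤ) (z : ℂ) :
    pairEval φ (s + t) p z = pairEval φ s p z + pairEval φ t p z := by
  unfold pairEval
  rw [← finsum_add_distrib (pairEval_support_finite φ s p z) (pairEval_support_finite φ t p z)]
  exact finsum_congr fun n => by rw [evalComp_add hs ht, map_add]

theorem pairEval_smul_right (φ : gradedDual gr) (r : ℂ) (s : LogSeries M) (p : ℤ) (z : ℂ) :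
    pairEval φ (r • s) p z = r * pairEval φ s p z := by
  unfold pairEval
  rw [← smul_eq_mul, smul_finsum]
  exact finsum_congr fun n => by rw [evalComp_smul, map_smul]

theorem pairEval_zero_right (φ : gradedDual gr) (p : ℤ) (z : ℂ) :
    pairEval φ (0 : LogSeries M) p z = 0 := by
  simp [pairEval, evalComp_zero]

theorem pairEval_add_left (φ ψ : gradedDual gr) (s : LogSeries M) (p : ℤ) (z : ℂ) :
    pairEval (φ + ψ) s p z = pairEval φ s p z + pairEval ψ s p z := by
  unfold pairEval
  rw [← finsum_add_distrib (pairEval_support_finite φ s p z) (pairEval_support_finite ψ s p z)]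
  rfl

theorem pairEval_smul_left (r : ℂ) (φ : gradedDual gr) (s : LogSeries M) (p : ℤ) (z : ℂ) :
    pairEval (r • φ) s p z = r * pairEval φ s p z := by
  unfold pairEval
  rw [← smul_eq_mul, smul_finsum]
  rfl

/-- The pairing with the value of a fixed series, as a functional on the graded dual. -/
noncomputable def pairEvalₗ (s : LogSeries M) (p : ℤ) (z : ℂ) : gradedDual gr →ₗ[ℂ] ℂ where
  toFun φ := pairEval φ s p z
  map_add' φ ψ := pairEval_add_left φ ψ s p z
  map_smul' r φ := pairEval_smul_left r φ s p z

theorem pairEval_of_mem {φ : gradedDual gr} {m : ℂ} (hφ : φ ∈ gradedDualGr gr m)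
    (s : LogSeries M) (p : ℤ) (z : ℂ) : pairEval φ s p z = φ.1 (evalComp gr s p z m) :=
  finsum_eq_single _ _ fun n hn => hφ n hn _ (evalComp_mem s p z n)

/-- The functional `φ ∘ π_n`. -/
noncomputable def dualProj (gr : ℂ → Submodule ℂ M) (n : ℂ) (φ : Module.Dual ℂ M) :
    gradedDual gr :=
  ⟨φ ∘ₗ gradedProj gr n, {n}, fun m hm w hw => by
    simp [gradedProj_of_mem_ne gr (show m ≠ n by simpa using hm) hw]⟩

theorem dualProj_apply (n : ℂ) (φ : Module.Dual ℂ M) (w : M) :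
    (dualProj gr n φ).1 w = φ (gradedProj gr n w) := rfl

theorem dualProj_mem (n : ℂ) (φ : Module.Dual ℂ M) : dualProj gr n φ ∈ gradedDualGr gr n := by
  intro m hm w hw
  rw [dualProj_apply, gradedProj_of_mem_ne gr hm hw, map_zero]

theorem pairEval_dualProj (h : DirectSum.IsInternal gr) (n : ℂ) (φ : Module.Dual ℂ M)
    (s : LogSeries M) (p : ℤ) (z : ℂ) :
    pairEval (dualProj gr n φ) s p z = φ (evalComp gr s p z n) := by
  rw [pairEval_of_mem (dualProj_mem n φ), dualProj_apply, gradedProj_of_mem h (evalComp_mem s p z n)]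

/-- An element of the graded dual is the sum of its homogeneous components. -/
theorem exists_sum_dualProj (h : DirectSum.IsInternal gr) (φ : gradedDual gr) :
    ∃ S : Finset ℂ, (∀ n, n ∉ S → dualProj gr n φ.1 = 0) ∧ ∑ n ∈ S, dualProj gr n φ.1 = φ := by
  obtain ⟨S, hS⟩ := φ.2
  refine ⟨S, fun n hn => Subtype.ext (LinearMap.ext fun w => ?_),
    Subtype.ext (LinearMap.ext fun w => ?_)⟩
  · exact hS n hn _ (gradedProj_mem gr n w)
  · rw [AddSubmonoidClass.coe_finsetSum, LinearMap.sum_apply]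
    simp only [dualProj_apply]
    obtain ⟨T, hT, hT'⟩ := exists_finset_gradedProj h w
    classical
    conv_rhs => rw [← hT', map_sum]
    rw [Finset.sum_subset (Finset.subset_union_left : S ⊆ S ∪ T)
        fun n _ hn => hS n hn _ (gradedProj_mem gr n w),
      Finset.sum_subset (Finset.subset_union_right : T ⊆ S ∪ T) fun n _ hn => by simp [hT n hn]]

theorem dualProj_of_mem (h : DirectSum.IsInternal gr) {n : ℂ} {φ : gradedDual gr}
    (hφ : φ ∈ gradedDualGr gr n) : dualProj gr n φ.1 = φ := by
  refine Subtype.ext (LinearMap.ext fun w => ?_)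
  rw [dualProj_apply]
  refine graded_induction h (p := fun w => φ.1 (gradedProj gr n w) = φ.1 w)
    (fun x y hx hy => by simp only [map_add, hx, hy]) (fun m x hx => ?_) (by simp) w
  by_cases hmn : m = n
  · subst hmn; rw [gradedProj_of_mem h hx]
  · rw [gradedProj_of_mem_ne _ hmn hx, map_zero, hφ m hmn x hx]

end Evaluation

/-! ### Logarithms -/

theorem exp_logBranch (p : ℤ) {z : ℂ} (hz : z ≠ 0) : Complex.exp (logBranch p z) = z := by
  have h1 : Complex.exp (logBranch 0 z) = z := by
    have hlog : (Real.log ‖z‖ : ℂ) + Complex.arg z * Complex.I = Complex.log z := by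
      rw [Complex.log]
    unfold logBranch argZ
    split_ifs with h
    · rw [Int.cast_zero, mul_zero, add_zero, mul_comm, hlog, Complex.exp_log hz]
    · rw [Int.cast_zero, mul_zero, add_zero]
      push_cast
      rw [mul_add, ← add_assoc, mul_comm Complex.I (Complex.arg z : ℂ), hlog,
        mul_comm Complex.I, Complex.exp_add, Complex.exp_two_pi_mul_I, mul_one, Complex.exp_log hz]
  have h2 : logBranch p z = logBranch 0 z + p * (2 * Real.pi * Complex.I) := by
    unfold logBranch; push_cast; ring
  rw [h2, Complex.exp_add, h1, Complex.exp_int_mul_two_pi_mul_I, mul_one]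

theorem exp_int_mul_logBranch (p m : ℤ) {z : ℂ} (hz : z ≠ 0) :
    Complex.exp (m * logBranch p z) = z ^ m := by
  rw [Complex.exp_int_mul, exp_logBranch p hz]

theorem logBranch_one (p : ℤ) : logBranch p 1 = 2 * Real.pi * Complex.I * p := by
  simp only [logBranch, argZ, norm_one, Real.log_one, Complex.arg_one, le_refl, if_true]
  push_cast; ring

/-! ### Weights in a vertex operator algebra -/

namespace VOA

variable {V : Type v} [AddCommGroup V] [Module ℂ V]

theorem L_zero_L_one (𝒱 : VOA V) (v : V) : 𝒱.L 0 (𝒱.L 1 v) = 𝒱.L 1 (𝒱.L 0 v) - 𝒱.L 1 v := by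
  have h := 𝒱.virasoro 0 1 v
  norm_num at h
  unfold L
  norm_num
  rw [sub_eq_iff_eq_add] at h
  rw [h]; abel

theorem L_one_mem (𝒱 : VOA V) {n : ℤ} {v : V} (hv : v ∈ 𝒱.gr n) : 𝒱.L 1 v ∈ 𝒱.gr (n - 1) := by
  have h0 : ∀ m, ∀ w ∈ 𝒱.gr m, 𝒱.L 0 w = (m : ℂ) • w := by
    intro m w hw
    have := 𝒱.L0_grading m w hw
    simpa [L] using this
  have key : 𝒱.L 0 (𝒱.L 1 v) = ((n : ℂ) - 1) • 𝒱.L 1 v := by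
    rw [L_zero_L_one, h0 n v hv, map_smul, sub_smul, one_smul]
  refine mem_gr_of_gradedProj 𝒱.internal fun m hm => ?_
  have h1 := gradedProj_map 𝒱.internal 𝒱.internal (𝒱.L 0)
    (fun k x hx => by rw [h0 k x hx]; exact (𝒱.gr k).smul_mem _ hx) m (𝒱.L 1 v)
  rw [key, map_smul, h0 m _ (gradedProj_mem _ _ _), ← sub_eq_zero, ← sub_smul] at h1
  refine (smul_eq_zero.1 h1).resolve_left fun h => hm ?_
  have : ((m : ℤ) : ℂ) = ((n - 1 : ℤ) : ℂ) := by push_cast; linear_combination -h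
  exact_mod_cast this

theorem L_one_pow_mem (𝒱 : VOA V) {n : ℤ} {v : V} (hv : v ∈ 𝒱.gr n) (j : ℕ) :
    (𝒱.L 1 ^ j) v ∈ 𝒱.gr (n - j) := by
  induction j with
  | zero => simpa using hv
  | succ j ih =>
    rw [pow_succ', Module.End.mul_apply]
    have := 𝒱.L_one_mem ih
    rwa [sub_sub, ← Nat.cast_one, ← Nat.cast_add] at this

theorem exists_L_one_pow_eq_zero (𝒱 : VOA V) (v : V) :
    ∃ J : ℕ, ∀ j, J ≤ j → (𝒱.L 1 ^ j) v = 0 := by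
  refine graded_induction 𝒱.internal (p := fun v => ∃ J : ℕ, ∀ j, J ≤ j → (𝒱.L 1 ^ j) v = 0)
    ?_ ?_ ⟨0, by simp⟩ v
  · rintro x y ⟨J, hJ⟩ ⟨K, hK⟩
    refine ⟨max J K, fun j hj => ?_⟩
    rw [map_add, hJ j (le_trans (le_max_left _ _) hj), hK j (le_trans (le_max_right _ _) hj),
      add_zero]
  · intro n x hx
    obtain ⟨N, hN⟩ := 𝒱.bounded_below
    refine ⟨(n - N + 1).toNat, fun j hj => ?_⟩
    have h := 𝒱.L_one_pow_mem hx j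
    rwa [hN _ (by omega), Submodule.mem_bot] at h

end VOA

/-! ### Twisted modules -/

/-- A polynomial `Q` for which `l ^ p * Q (c * p)` does not depend on `p` is constant, and zero
unless `l = 1`. -/
theorem polynomial_quasiperiodic {Q : Polynomial ℂ} {c l : ℂ} (hc : c ≠ 0)
    (h : ∀ p : ℕ, l * Q.eval (c * (p + 1)) = Q.eval (c * p)) :
    (∀ k, k ≠ 0 → Q.coeff k = 0) ∧ (l ≠ 1 → Q = 0) := by
  have hinj : Function.Injective fun p : ℕ => c * (p : ℂ) := fun p q hpq => by
    simpa [hc] using hpq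
  have key : Polynomial.C l * Polynomial.taylor c Q = Q := by
    refine Polynomial.eq_of_infinite_eval_eq _ _
      ((Set.infinite_range_of_injective hinj).mono ?_)
    rintro _ ⟨p, rfl⟩
    rw [Set.mem_ofPred_eq, Polynomial.eval_mul, Polynomial.eval_C, Polynomial.taylor_eval, ← h p]
    ring_nf
  have hl : Q ≠ 0 → l = 1 := by
    intro hQ
    have h2 := congrArg (fun P => Polynomial.coeff P Q.natDegree) key
    simp only [Polynomial.coeff_C_mul] at h2
    have h3 : (Polynomial.taylor c Q).coeff Q.natDegree = Q.leadingCoeff := by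
      rw [← Polynomial.leadingCoeff_taylor (r := c), Polynomial.leadingCoeff,
        Polynomial.natDegree_taylor]
    rw [h3] at h2
    exact mul_right_cancel₀ (Polynomial.leadingCoeff_ne_zero.2 hQ) (by rw [h2, one_mul]; rfl)
  refine ⟨?_, fun h1 => by_contra fun hQ => h1 (hl hQ)⟩
  by_cases hQ : Q = 0
  · simp [hQ]
  have h1 := hl hQ
  subst h1
  have hconst : ∀ p : ℕ, Q.eval (c * p) = Q.eval 0 := by
    intro p
    induction p with
    | zero => simp
    | succ p ih => rw [← ih, ← h p]; simp
  have : Q = Polynomial.C (Q.eval 0) := by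
    refine Polynomial.eq_of_infinite_eval_eq _ _
      ((Set.infinite_range_of_injective hinj).mono ?_)
    rintro _ ⟨p, rfl⟩
    simpa using hconst p
  intro k hk
  rw [this, Polynomial.coeff_C, if_neg hk]

section TwistedModules

variable {V : Type v} [AddCommGroup V] [Module ℂ V] {𝒱 : VOA V} {g : 𝒱.Aut}
  {M : ModuleData.{u} V}

theorem ModuleCategory.Mem.isTwistedModule {G : Subgroup 𝒱.Aut} {C : ModuleCategory.{u} 𝒱 G}
    {g : G} (h : C.Mem g M) : IsTwistedModule 𝒱 g.1 M := by
  cases C with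
  | withoutActions P hP => exact hP g M h
  | withActions P hP =>
    obtain ⟨ρ, hρ⟩ := h
    exact (hP g M ρ hρ).twisted

theorem ModuleData.L_apply (M : ModuleData.{u} V) (n : ℤ) (w : M.carrier) :
    M.L 𝒱 n w = M.Y 𝒱.conf w (-(n : ℂ) - 2) 0 := rfl

namespace IsTwistedModule

variable (hM : IsTwistedModule 𝒱 g M)
include hM

theorem L_mem (m : ℤ) {n : ℂ} {w : M.carrier} (hw : w ∈ M.gr n) : M.L 𝒱 m w ∈ M.gr (n - m) := by
  have h := hM.homogeneous 2 n 𝒱.conf 𝒱.conf_mem w hw (-(m : ℂ) - 2) 0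
  rw [M.L_apply]
  convert h using 2
  push_cast; ring

theorem L_zero_mem {n : ℂ} {w : M.carrier} (hw : w ∈ M.gr n) : M.L 𝒱 0 w ∈ M.gr n := by
  simpa using hM.L_mem 0 hw

theorem L_zero_sub_pow_mem (r : ℂ) (j : ℕ) {n : ℂ} {w : M.carrier} (hw : w ∈ M.gr n) :
    ((M.L 𝒱 0 - r • 1) ^ j) w ∈ M.gr n := by
  induction j with
  | zero => simpa using hw
  | succ j ih =>
    rw [pow_succ', Module.End.mul_apply, LinearMap.sub_apply]
    exact sub_mem (hM.L_zero_mem ih) ((M.gr n).smul_mem _ ih)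

/-- The homogeneous subspaces are exactly the generalized eigenspaces of `L(0)`. -/
theorem gr_eq_maxGenEigenspace (n : ℂ) : M.gr n = Module.End.maxGenEigenspace (M.L 𝒱 0) n := by
  have hle : ∀ n, M.gr n ≤ Module.End.maxGenEigenspace (M.L 𝒱 0) n := by
    intro n w hw
    obtain ⟨K, -, hK⟩ := hM.L0_grading n w hw
    exact (Module.End.mem_maxGenEigenspace _ _ _).2 ⟨K, hK⟩
  refine le_antisymm (hle n) fun w hw => ?_
  refine mem_gr_of_gradedProj hM.internal fun m hm => ?_
  obtain ⟨K, hK⟩ := (Module.End.mem_maxGenEigenspace _ _ _).1 hw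
  have h1 : gradedProj M.gr m w ∈ Module.End.maxGenEigenspace (M.L 𝒱 0) n := by
    refine (Module.End.mem_maxGenEigenspace _ _ _).2 ⟨K, ?_⟩
    rw [← gradedProj_map hM.internal hM.internal _ (fun k x hx => hM.L_zero_sub_pow_mem n K hx),
      hK, map_zero]
  have h2 := hle m (gradedProj_mem M.gr m w)
  exact Submodule.disjoint_def.1 (Module.End.disjoint_genEigenspace (M.L 𝒱 0) hm ⊤ ⊤) _ h2 h1

theorem exists_pow_eq_zero (w : M.carrier) :
    ∃ K : ℕ, ∀ (n : ℂ) (j : ℕ), K ≤ j → ((M.L 𝒱 0 - n • 1) ^ j) (M.π n w) = 0 := by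
  have h1 : ∀ n : ℂ, ∃ K : ℕ, ((M.L 𝒱 0 - n • 1) ^ K) (M.π n w) = 0 := fun n => by
    obtain ⟨K, -, hK⟩ := hM.L0_grading n _ (gradedProj_mem M.gr n w)
    exact ⟨K, hK⟩
  choose K hK using h1
  refine ⟨(finite_gradedProj_ne_zero hM.internal w).toFinset.sup K, fun n j hj => ?_⟩
  by_cases hn : M.π n w = 0
  · rw [hn, map_zero]
  · have : K n ≤ j := le_trans (Finset.le_sup (f := K) (by simpa [ModuleData.π] using hn)) hj
    obtain ⟨i, rfl⟩ := Nat.exists_eq_add_of_le this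
    rw [add_comm, pow_add, Module.End.mul_apply, hK, map_zero]

theorem Y_mem_evaluableSeries (v : V) (w : M.carrier) : M.Y v w ∈ evaluableSeries M.gr := by
  refine graded_induction 𝒱.internal (p := fun v => M.Y v w ∈ evaluableSeries M.gr)
    (fun x y hx hy => by rw [map_add]; exact add_mem hx hy) (fun m v hv => ?_) (by simp) v
  refine graded_induction hM.internal (p := fun w => M.Y v w ∈ evaluableSeries M.gr)
    (fun x y hx hy => by rw [map_add]; exact add_mem hx hy) (fun r w hw => ?_) (by simp) w
  obtain ⟨K, hK⟩ := hM.logBounded v w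
  intro n
  refine ((Set.finite_Iic K).image fun k => ((n - r - m : ℂ), k)).subset ?_
  rintro ⟨a, k⟩ h
  refine ⟨k, ?_, ?_⟩
  · by_contra hk
    exact h (by simp only [hK a k (by simpa using hk), map_zero])
  · have : r + m + a = n := by
      by_contra hne
      exact h (gradedProj_of_mem_ne _ hne (hM.homogeneous m r v hv w hw a k))
    rw [← this]; ring_nf

omit hM in
theorem aut_conf (g : 𝒱.Aut) : g.1 𝒱.conf = 𝒱.conf := g.2.2.2

/-- Since the conformal vector is fixed by `g`, its vertex operator has integral powers of `x` and no
logarithms. -/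
theorem Y_conf_eq_zero (w : M.carrier) (a : ℂ) (k : ℕ) (h : k ≠ 0 ∨ ∀ m : ℤ, (m : ℂ) ≠ a) :
    M.Y 𝒱.conf w a k = 0 := by
  refine graded_induction hM.internal (p := fun w => M.Y 𝒱.conf w a k = 0)
    (fun x y hx hy => by rw [map_add]; simp [hx, hy]) (fun r w hw => ?_) (by simp) w
  obtain ⟨K, hK⟩ := hM.logBounded 𝒱.conf w
  rw [← Module.forall_dual_apply_eq_zero_iff ℂ]
  intro ψ
  set Q : Polynomial ℂ :=
    ∑ k ∈ Finset.range (K + 1), Polynomial.monomial k (ψ (M.Y 𝒱.conf w a k)) with hQ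
  have hcoeff : ∀ k, Q.coeff k = ψ (M.Y 𝒱.conf w a k) := by
    intro k
    rw [hQ, Polynomial.finsetSum_coeff]
    simp only [Polynomial.coeff_monomial]
    rw [Finset.sum_ite_eq' (Finset.range (K + 1)) k]
    split_ifs with hk
    · rfl
    · rw [hK a k (by simpa using hk), map_zero]
  have hval : ∀ p : ℤ, ψ (evalComp M.gr (M.Y 𝒱.conf w) p 1 (r + (2 : ℤ) + a)) =
      Complex.exp (a * logBranch p 1) * Q.eval (logBranch p 1) := by
    intro p
    have hhom := hM.homogeneous 2 r 𝒱.conf 𝒱.conf_mem w hw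
    rw [evalComp_of_single (a := a), map_smul, smul_eq_mul]
    · congr 1
      rw [finsum_eq_sum_of_support_subset (s := Finset.range (K + 1)), map_sum, hQ,
        Polynomial.eval_finsetSum]
      · refine Finset.sum_congr rfl fun k _ => ?_
        rw [gradedProj_of_mem hM.internal (hhom a k), map_smul, Polynomial.eval_monomial,
          smul_eq_mul, mul_comm]
      · intro k hk
        by_contra hk'
        exact hk (by simp only [hK a k (by simpa using hk'), map_zero, smul_zero])
    · intro b k hb
      exact gradedProj_of_mem_ne _ (fun h => hb (add_left_cancel h)) (hhom b k)
  have hper : ∀ p : ℕ, Complex.exp (a * (2 * Real.pi * Complex.I)) *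
      Q.eval (2 * Real.pi * Complex.I * (p + 1)) = Q.eval (2 * Real.pi * Complex.I * p) := by
    intro p
    have h1 := hM.equivariance p 1 one_ne_zero 𝒱.conf w (r + (2 : ℤ) + a)
    rw [aut_conf] at h1
    have h2 := congrArg ψ h1
    rw [hval, hval, logBranch_one, logBranch_one] at h2
    push_cast at h2
    rw [show a * (2 * Real.pi * Complex.I * ((p : ℂ) + 1)) =
      a * (2 * Real.pi * Complex.I * p) + a * (2 * Real.pi * Complex.I) by ring, Complex.exp_add,
      mul_assoc] at h2
    exact mul_left_cancel₀ (Complex.exp_ne_zero _) h2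
  have hQ' := polynomial_quasiperiodic Complex.two_pi_I_ne_zero hper
  rw [← hcoeff]
  rcases h with h | h
  · exact hQ'.1 k h
  · rw [hQ'.2 fun he => ?_, Polynomial.coeff_zero]
    obtain ⟨m, hm⟩ := Complex.exp_eq_one_iff.1 he
    exact h m (mul_right_cancel₀ Complex.two_pi_I_ne_zero hm).symm

/-- The weight components of `Y(ω, z) w`, for homogeneous `w`. -/
theorem evalComp_conf {r : ℂ} {w : M.carrier} (hw : w ∈ M.gr r) (n : ℂ) (p : ℤ) {z : ℂ}
    (m : ℤ) (hm : n = r - m) (hz : z ≠ 0) :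
    evalComp M.gr (M.Y 𝒱.conf w) p z n = z ^ (-m - 2) • M.L 𝒱 m w := by
  have hhom := hM.homogeneous 2 r 𝒱.conf 𝒱.conf_mem w hw
  rw [evalComp_of_single (a := -(m : ℂ) - 2), finsum_eq_single _ 0]
  · rw [pow_zero, one_smul, M.L_apply, ← exp_int_mul_logBranch p (-m - 2) hz]
    push_cast
    rw [gradedProj_of_mem hM.internal]
    convert hhom (-(m : ℂ) - 2) 0 using 2
    rw [hm]; push_cast; ring
  · intro k hk
    rw [hM.Y_conf_eq_zero w _ k (Or.inl hk), map_zero, smul_zero]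
  · intro b k hb
    refine gradedProj_of_mem_ne _ (fun h => hb ?_) (hhom b k)
    rw [hm] at h
    push_cast at h
    linear_combination h

theorem evalComp_conf_eq_zero {r : ℂ} {w : M.carrier} (hw : w ∈ M.gr r) (n : ℂ) (p : ℤ) (z : ℂ)
    (h : ∀ m : ℤ, n ≠ r - m) : evalComp M.gr (M.Y 𝒱.conf w) p z n = 0 := by
  have hhom := hM.homogeneous 2 r 𝒱.conf 𝒱.conf_mem w hw
  refine finsum_eq_zero_of_forall_eq_zero fun c => ?_
  by_cases hc : r + (2 : ℤ) + c.1 = n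
  · rw [hM.Y_conf_eq_zero w _ _ (Or.inr fun m hm => h (-2 - m) ?_), map_zero, smul_zero]
    rw [← hc, ← hm]; push_cast; ring
  · rw [gradedProj_of_mem_ne _ hc (hhom _ _), smul_zero]

theorem finite_lower (n : ℂ) (N : ℤ) : {m : ℤ | m ≤ N ∧ M.gr (n + m) ≠ ⊥}.Finite := by
  obtain ⟨r, hr⟩ := hM.lower_bounded n
  refine (Set.finite_Icc ⌊r⌋ N).subset fun m hm => ⟨?_, hm.1⟩
  by_contra hlt
  refine hm.2 ?_
  have h := hr m (lt_of_lt_of_le (Int.cast_lt.2 (not_le.1 hlt)) (Int.floor_le r))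
  simpa using h

end IsTwistedModule

end TwistedModules

/-! ### Contragredient modules -/

/-- The homogeneous subspace `(W')_[n]` is the dual of `W_[n]`. -/
noncomputable def gradedDualGrEquiv {M : Type u} [AddCommGroup M] [Module ℂ M]
    {gr : ℂ → Submodule ℂ M} (h : DirectSum.IsInternal gr) (n : ℂ) :
    gradedDualGr gr n ≃ₗ[ℂ] Module.Dual ℂ (gr n) where
  toFun φ := φ.1.1 ∘ₗ (gr n).subtype
  map_add' _ _ := rfl
  map_smul' _ _ := rfl
  invFun ψ := ⟨dualProj gr n (ψ ∘ₗ (gradedProj gr n).codRestrict (gr n) (gradedProj_mem gr n)),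
    dualProj_mem n _⟩
  left_inv φ := by
    refine Subtype.ext ?_
    rw [← dualProj_of_mem h φ.2]
    refine Subtype.ext (LinearMap.ext fun w => ?_)
    simp only [dualProj_apply, LinearMap.comp_apply]
    exact congrArg _ (gradedProj_gradedProj h n w)
  right_inv ψ := by
    refine LinearMap.ext fun w => ?_
    simp only [LinearMap.comp_apply, dualProj_apply]
    refine congrArg ψ (Subtype.ext ?_)
    simp only [LinearMap.codRestrict_apply, Submodule.subtype_apply]
    rw [gradedProj_gradedProj h, gradedProj_of_mem h w.2]

/-- If the homogeneous subspaces of a graded space are finite-dimensional, every element of its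
graded double dual is the evaluation at a vector. -/
theorem exists_eval_of_gradedDual {M : Type u} [AddCommGroup M] [Module ℂ M]
    {gr : ℂ → Submodule ℂ M} (h : DirectSum.IsInternal gr) [∀ n, FiniteDimensional ℂ (gr n)]
    (φ : gradedDual (gradedDualGr gr)) : ∃ w : M, ∀ x : gradedDual gr, φ.1 x = x.1 w := by
  have h1 : ∀ n, ∃ w ∈ gr n, ∀ x ∈ gradedDualGr gr n, φ.1 x = x.1 w := by
    intro n
    obtain ⟨w, hw⟩ := (Module.evalEquiv ℂ (gr n)).surjective
      (φ.1 ∘ₗ (gradedDualGr gr n).subtype ∘ₗ (gradedDualGrEquiv h n).symm.toLinearMap)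
    refine ⟨w, w.2, fun x hx => ?_⟩
    have h2 := congrArg (fun T => T (gradedDualGrEquiv h n ⟨x, hx⟩)) hw
    simp only [Module.evalEquiv_apply, Module.Dual.eval_apply, LinearMap.comp_apply,
      LinearEquiv.coe_coe, LinearEquiv.symm_apply_apply, Submodule.subtype_apply] at h2
    exact h2.symm
  choose w hw hwx using h1
  obtain ⟨S, hS⟩ := φ.2
  refine ⟨∑ n ∈ S, w n, fun x => ?_⟩
  obtain ⟨T, hT, hT'⟩ := exists_sum_dualProj h x
  classical
  calc φ.1 x = ∑ n ∈ T, φ.1 (dualProj gr n x.1) := by rw [← map_sum, hT']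
    _ = ∑ n ∈ S ∪ T, φ.1 (dualProj gr n x.1) :=
        Finset.sum_subset Finset.subset_union_right fun n _ hn => by rw [hT n hn, map_zero]
    _ = ∑ n ∈ S, φ.1 (dualProj gr n x.1) :=
        (Finset.sum_subset Finset.subset_union_left
          fun n _ hn => hS n hn _ (dualProj_mem n _)).symm
    _ = x.1 (∑ n ∈ S, w n) := by
        rw [map_sum]
        refine Finset.sum_congr rfl fun n _ => ?_
        rw [hwx n _ (dualProj_mem n _), dualProj_apply, gradedProj_of_mem h (hw n)]

section Contragredient

variable {V : Type v} [AddCommGroup V] [Module ℂ V] {𝒱 : VOA V} {g g' g'' : 𝒱.Aut}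
  {M : ModuleData.{u} V}

/-- The coefficient of `x ^ a (log x) ^ k` in `Y(v, x)`. -/
def ModuleData.coeffY (M : ModuleData.{u} V) (v : V) (a : ℂ) (k : ℕ) : M.carrier →ₗ[ℂ] M.carrier :=
  LinearMap.proj (R := ℂ) (φ := fun _ : ℕ => M.carrier) k ∘ₗ
    LinearMap.proj (R := ℂ) (φ := fun _ : ℂ => ℕ → M.carrier) a ∘ₗ M.Y v

/-- The pairing of a vector with the elements of the contragredient. -/
noncomputable def ModuleData.ev (M : ModuleData.{u} V) (𝒱 : VOA V) (w : M.carrier) :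
    (M.contragredient 𝒱).carrier →ₗ[ℂ] ℂ :=
  LinearMap.applyₗ w ∘ₗ (gradedDual M.gr).subtype

theorem ModuleData.ev_apply (w : M.carrier) (x : (M.contragredient 𝒱).carrier) :
    M.ev 𝒱 w x = (x : M.Dual).1 w := rfl

theorem ModuleData.ev_ext {x y : (M.contragredient 𝒱).carrier}
    (h : ∀ w, M.ev 𝒱 w x = M.ev 𝒱 w y) : x = y :=
  Subtype.ext (LinearMap.ext h)

theorem ModuleData.ev_add (w w' : M.carrier) (x : (M.contragredient 𝒱).carrier) :
    M.ev 𝒱 (w + w') x = M.ev 𝒱 w x + M.ev 𝒱 w' x := map_add (x : M.Dual).1 w w'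

theorem ModuleData.ev_zero (x : (M.contragredient 𝒱).carrier) : M.ev 𝒱 0 x = 0 :=
  map_zero (x : M.Dual).1

/-- The vertex operator map of the contragredient satisfies its defining formula.  If no map did, the
contragredient would carry the zero map, and by the identity property it would be zero. -/
theorem IsTwistedModule.isContragredientMap (h' : IsTwistedModule 𝒱 g' (M.contragredient 𝒱)) :
    M.IsContragredientMap 𝒱 (M.contragredient 𝒱).Y := by
  classical
  by_cases h : ∃ Y', M.IsContragredientMap 𝒱 Y'
  · have : (M.contragredient 𝒱).Y = h.choose := by
      unfold ModuleData.contragredient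
      simp only [dif_pos h]
    rw [this]
    exact h.choose_spec
  · have hY : (M.contragredient 𝒱).Y = 0 := by
      unfold ModuleData.contragredient
      simp only [dif_neg h]
    have h0 : ∀ x : (M.contragredient 𝒱).carrier, x = 0 := by
      intro x
      have h1 := h'.identity x 0 0
      rw [hY, if_pos (And.intro rfl rfl)] at h1
      exact h1.symm
    refine absurd ⟨0, fun n v _ φ w a k => ?_⟩ h
    have hφ : φ.1 = 0 := congrArg Subtype.val (h0 φ)
    rw [hφ]
    simp

theorem IsTwistedModule.contragredient_formula (h' : IsTwistedModule 𝒱 g' (M.contragredient 𝒱))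
    {n : ℤ} {v : V} (hv : v ∈ 𝒱.gr n) {J : ℕ} (hJ : ∀ j, J ≤ j → (𝒱.L 1 ^ j) v = 0)
    (x : (M.contragredient 𝒱).carrier) (w : M.carrier) (a : ℂ) (k : ℕ) :
    M.ev 𝒱 w ((M.contragredient 𝒱).Y v x a k) = ∑ j ∈ Finset.range J,
      ((-1 : ℂ) ^ n * (-1) ^ k / (j.factorial : ℂ)) *
        M.ev 𝒱 (M.Y ((𝒱.L 1 ^ j) v) w ((j : ℂ) - 2 * n - a) k) x := by
  refine (h'.isContragredientMap n v hv x w a k).trans ?_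
  refine finsum_eq_sum_of_support_subset _ fun j hj => ?_
  by_contra hj'
  refine hj ?_
  simp only [hJ j (by simpa using hj'), map_zero]
  simp

theorem sum_alternating_factorial (X : ℕ → ℂ) (J : ℕ) (hX : ∀ m, J ≤ m → X m = 0) :
    ∑ j ∈ Finset.range J, ∑ i ∈ Finset.range J,
      (-1 : ℂ) ^ j / (j.factorial * i.factorial) * X (i + j) = X 0 := by
  have h1 : ∀ j ∈ Finset.range J, ∑ i ∈ Finset.range J,
      (-1 : ℂ) ^ j / (j.factorial * i.factorial) * X (i + j) = ∑ i ∈ Finset.range (J - j),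
      (-1 : ℂ) ^ j / (j.factorial * i.factorial) * X (i + j) := by
    intro j _
    refine (Finset.sum_subset (Finset.range_mono (Nat.sub_le J j)) fun i _ hi => ?_).symm
    rw [hX _ (by simp at hi; omega), mul_zero]
  rw [Finset.sum_congr rfl h1, ← Finset.sum_range_diag_flip J
    fun j i => (-1 : ℂ) ^ j / (j.factorial * i.factorial) * X (i + j)]
  have h2 : ∀ m ∈ Finset.range J, ∑ k ∈ Finset.range (m + 1),
      (-1 : ℂ) ^ k / (k.factorial * (m - k).factorial) * X (m - k + k) =
      if m = 0 then X 0 else 0 := by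
    intro m _
    have h3 : ∑ k ∈ Finset.range (m + 1),
        (-1 : ℂ) ^ k / (k.factorial * (m - k).factorial) * X (m - k + k) =
        X m / m.factorial * ∑ k ∈ Finset.range (m + 1), (-1 : ℂ) ^ k * 1 ^ (m - k) * m.choose k := by
      rw [Finset.mul_sum]
      refine Finset.sum_congr rfl fun k hk => ?_
      have hkm : k ≤ m := by simpa [Nat.lt_succ_iff] using hk
      rw [Nat.sub_add_cancel hkm, Nat.cast_choose ℂ hkm]
      have := Nat.factorial_ne_zero m
      field_simp
      simp
    rw [h3, ← add_pow]
    by_cases hm : m = 0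
    · simp [hm]
    · simp [hm]
  rw [Finset.sum_congr rfl h2, Finset.sum_ite_eq']
  split_ifs with h
  · rfl
  · exact (hX 0 (by simpa using h)).symm

/-- The transformation `v ↦ e ^ (x L(1)) (-x ^ (-2)) ^ L(0) v`, `x ↦ x⁻¹` is an involution: applying the
contragredient formula twice gives back the original vertex operators. -/
theorem IsTwistedModule.contragredient_involution
    (h' : IsTwistedModule 𝒱 g' (M.contragredient 𝒱))
    {n : ℤ} {v : V} (hv : v ∈ 𝒱.gr n) {J : ℕ} (hJ : ∀ j, J ≤ j → (𝒱.L 1 ^ j) v = 0)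
    (x : (M.contragredient 𝒱).carrier) (w : M.carrier) (b : ℂ) (l : ℕ) :
    ∑ j ∈ Finset.range J, ((-1 : ℂ) ^ n * (-1) ^ l / (j.factorial : ℂ)) *
      M.ev 𝒱 w ((M.contragredient 𝒱).Y ((𝒱.L 1 ^ j) v) x ((j : ℂ) - 2 * n - b) l) =
    M.ev 𝒱 (M.Y v w b l) x := by
  have h1 := sum_alternating_factorial
    (fun m => M.ev 𝒱 (M.Y ((𝒱.L 1 ^ m) v) w ((m : ℂ) + b) l) x) J fun m hm => by
      simp only [hJ m hm, map_zero]
      exact ModuleData.ev_zero x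
  simp only [pow_zero, Module.End.one_apply, Nat.cast_zero, zero_add] at h1
  rw [← h1]
  refine Finset.sum_congr rfl fun j _ => ?_
  rw [h'.contragredient_formula (𝒱.L_one_pow_mem hv j) (J := J), Finset.mul_sum]
  · refine Finset.sum_congr rfl fun i _ => ?_
    rw [← Module.End.mul_apply, ← pow_add, ← mul_assoc]
    have hsign : (-1 : ℂ) ^ n * (-1) ^ l / (j.factorial : ℂ) *
        ((-1 : ℂ) ^ (n - j) * (-1) ^ l / (i.factorial : ℂ)) =
        (-1 : ℂ) ^ j / (j.factorial * i.factorial) := by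
      have e1 : (-1 : ℂ) ^ l * (-1) ^ l = 1 := by rw [← mul_pow]; simp
      have e2 : (-1 : ℂ) ^ n * (-1) ^ (n - j) = (-1) ^ j := by
        rw [zpow_sub₀ (by norm_num), zpow_natCast, ← mul_div_assoc, ← mul_zpow]
        rcases neg_one_pow_eq_or ℂ j with h | h <;> simp [h]
      rw [div_mul_div_comm]
      congr 1
      linear_combination ((-1 : ℂ) ^ n * (-1) ^ (n - j)) * e1 + e2
    have hexp : (i : ℂ) - 2 * ((n - j : ℤ) : ℂ) - ((j : ℂ) - 2 * n - b) = ((i + j : ℕ) : ℂ) + b := by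
      push_cast; ring
    rw [hsign, hexp]
  · intro i hi
    rw [← Module.End.mul_apply, ← pow_add, hJ _ (by omega)]

/-- The double contragredient of a module is the graded double dual, so an equivalence with the
module forces the weight spaces to be finite-dimensional, an infinite-dimensional space being smaller
than its dual. -/
theorem IsTwistedModule.finiteDimensional_gr (hM : IsTwistedModule 𝒱 g M)
    (h' : IsTwistedModule 𝒱 g' (M.contragredient 𝒱))
    (h'' : IsTwistedModule 𝒱 g'' ((M.contragredient 𝒱).contragredient 𝒱))
    (e : M.carrier ≃ₗ[ℂ] ((M.contragredient 𝒱).contragredient 𝒱).carrier)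
    (he : ModuleData.IsModuleMap e.toLinearMap) (n : ℂ) : FiniteDimensional ℂ (M.gr n) := by
  have hL : ∀ w, e (M.L 𝒱 0 w) = ((M.contragredient 𝒱).contragredient 𝒱).L 𝒱 0 (e w) := fun w =>
    he 𝒱.conf w (-((0 : ℤ) : ℂ) - 2) 0
  have hpow : ∀ (j : ℕ) w, e (((M.L 𝒱 0 - n • 1) ^ j) w) = ((((M.contragredient 𝒱).contragredient 𝒱).L 𝒱 0 - n • 1) ^ j) (e w) := by
    intro j
    induction j with
    | zero => simp
    | succ j ih =>
      intro w
      rw [pow_succ', pow_succ', Module.End.mul_apply, Module.End.mul_apply, ← ih]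
      simp [hL]
  have hmap : (M.gr n).map e.toLinearMap = ((M.contragredient 𝒱).contragredient 𝒱).gr n := by
    rw [hM.gr_eq_maxGenEigenspace, h''.gr_eq_maxGenEigenspace]
    ext y
    rw [Submodule.mem_map_equiv, Module.End.mem_maxGenEigenspace, Module.End.mem_maxGenEigenspace]
    refine exists_congr fun k => ?_
    rw [← e.map_eq_zero_iff, hpow, e.apply_symm_apply]
  have e1 : M.gr n ≃ₗ[ℂ] ((M.contragredient 𝒱).contragredient 𝒱).gr n := (e.submoduleMap (M.gr n)).trans (LinearEquiv.ofEq _ _ hmap)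
  have e2 : ((M.contragredient 𝒱).contragredient 𝒱).gr n ≃ₗ[ℂ] Module.Dual ℂ (Module.Dual ℂ (M.gr n)) :=
    (gradedDualGrEquiv (gr := gradedDualGr M.gr) h'.internal n).trans
      (gradedDualGrEquiv hM.internal n).symm.dualMap
  by_contra hfin
  have hinf : Cardinal.aleph0 ≤ Module.rank ℂ (M.gr n) := by
    rw [← not_lt]
    exact fun h => hfin (Module.rank_lt_aleph0_iff.1 h)
  have h1 := lift_rank_lt_rank_dual hinf
  rw [Cardinal.lift_id'.{0, u}] at h1
  have h2 := lift_rank_lt_rank_dual (hinf.trans h1.le)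
  rw [Cardinal.lift_id'.{0, u}] at h2
  exact absurd (e1.trans e2).rank_eq (h1.trans h2).ne

/-- Functionals on the contragredient. -/
theorem IsTwistedModule.exists_eq_ev (hM : IsTwistedModule 𝒱 g M)
    (hfin : ∀ n, FiniteDimensional ℂ (M.gr n)) (φ : (M.contragredient 𝒱).Dual) :
    ∃ w : M.carrier, φ.1 = M.ev 𝒱 w := by
  obtain ⟨w, hw⟩ := exists_eval_of_gradedDual hM.internal (φ : gradedDual (gradedDualGr M.gr))
  exact ⟨w, LinearMap.ext hw⟩

/-- The projections of the contragredient are adjoint to those of the module. -/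
theorem IsTwistedModule.ev_gradedProj (hM : IsTwistedModule 𝒱 g M)
    (h' : IsTwistedModule 𝒱 g' (M.contragredient 𝒱)) (n : ℂ) (w : M.carrier)
    (x : (M.contragredient 𝒱).carrier) :
    M.ev 𝒱 w (gradedProj (M.contragredient 𝒱).gr n x) = M.ev 𝒱 (gradedProj M.gr n w) x := by
  refine graded_induction h'.internal (p := fun x =>
    M.ev 𝒱 w (gradedProj (M.contragredient 𝒱).gr n x) = M.ev 𝒱 (gradedProj M.gr n w) x)
    (fun x y hx hy => by simp only [map_add, hx, hy]) (fun m x hx => ?_) (by simp) x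
  by_cases hmn : m = n
  · subst hmn
    rw [gradedProj_of_mem h'.internal hx]
    have h1 := dualProj_of_mem hM.internal (n := m) (φ := (x : M.Dual)) hx
    conv_lhs => rw [ModuleData.ev_apply, ← h1]
    rfl
  · rw [gradedProj_of_mem_ne _ hmn hx, map_zero]
    exact (hx n (Ne.symm hmn) _ (gradedProj_mem _ _ _)).symm

end Contragredient

/-! ### Laurent series and circle integrals -/

theorem summable_norm_laurent {c : ℤ → ℂ} {z : ℂ} {r : ℝ} (hr : ‖z‖ = r)
    (h : Summable fun m : ℤ => c m * z ^ m) : Summable fun m : ℤ => ‖c m‖ * r ^ m := by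
  refine h.norm.congr fun m => ?_
  rw [norm_mul, norm_zpow, hr]

theorem zpow_le_zpow_add_zpow {x r R : ℝ} (hr : 0 < r) (hrx : r ≤ x) (hxR : x ≤ R) (m : ℤ) :
    x ^ m ≤ r ^ m + R ^ m := by
  have hx : 0 < x := hr.trans_le hrx
  have hR : 0 < R := hx.trans_le hxR
  rcases le_total 0 m with hm | hm
  · exact (zpow_le_zpow_left₀ hm hx.le hxR).trans (le_add_of_nonneg_left (zpow_pos hr m).le)
  · have h := zpow_le_zpow_left₀ (n := -m) (by omega) hr.le hrx
    rw [zpow_neg, zpow_neg, inv_le_inv₀ (zpow_pos hr m) (zpow_pos hx m)] at h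
    exact h.trans (le_add_of_nonneg_right (zpow_pos hR m).le)

/-- A Laurent series converging on an open annulus is analytic there. -/
theorem differentiableAt_laurent {c : ℤ → ℂ} {a : ℂ} {S : Set ℝ} (hS : IsOpen S)
    (hpos : ∀ r ∈ S, 0 < r) (h : ∀ r ∈ S, Summable fun m : ℤ => ‖c m‖ * r ^ m) {z : ℂ}
    (hz : ‖z - a‖ ∈ S) : DifferentiableAt ℂ (fun z => ∑' m : ℤ, c m * (z - a) ^ m) z := by
  obtain ⟨ε, hε, hball⟩ := Metric.isOpen_iff.1 hS _ hz
  set x := ‖z - a‖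
  have hr : x - ε / 2 ∈ S := hball (by
    rw [Metric.mem_ball, Real.dist_eq, abs_lt]; constructor <;> linarith)
  have hR : x + ε / 2 ∈ S := hball (by
    rw [Metric.mem_ball, Real.dist_eq, abs_lt]; constructor <;> linarith)
  set U : Set ℂ := {y | x - ε / 2 < ‖y - a‖ ∧ ‖y - a‖ < x + ε / 2}
  have hU : IsOpen U := isOpen_Ioo.preimage (f := fun y : ℂ => ‖y - a‖)
    (continuous_norm.comp (continuous_id.sub continuous_const))
  have hne : ∀ y ∈ U, y - a ≠ 0 := fun y hy h0 => by
    have := hpos _ hr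
    have h1 := hy.1
    rw [h0, norm_zero] at h1
    linarith
  refine (Complex.differentiableOn_tsum_of_summable_norm
    (u := fun m => ‖c m‖ * (x - ε / 2) ^ m + ‖c m‖ * (x + ε / 2) ^ m) ((h _ hr).add (h _ hR))
    (U := U) (fun m y hy => ?_) hU fun m y hy => ?_).differentiableAt (hU.mem_nhds ?_)
  · exact (((differentiableAt_id.sub_const a).zpow (Or.inl (hne y hy))).const_mul
      (c m)).differentiableWithinAt
  · rw [norm_mul, norm_zpow, ← mul_add]
    exact mul_le_mul_of_nonneg_left
      (zpow_le_zpow_add_zpow (hpos _ hr) hy.1.le hy.2.le m) (norm_nonneg _)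
  · constructor <;> linarith

theorem differentiableAt_powerSeries {c : ℤ → ℂ} (hc : ∀ m < 0, c m = 0) {a : ℂ} {R : ℝ}
    (h : ∀ r, 0 < r → r < R → Summable fun m : ℤ => ‖c m‖ * r ^ m) {z : ℂ}
    (hz : ‖z - a‖ < R) : DifferentiableAt ℂ (fun z => ∑' m : ℤ, c m * (z - a) ^ m) z := by
  obtain ⟨r, hzr, hrR⟩ := exists_between hz
  have hr0 : 0 < r := (norm_nonneg _).trans_lt hzr
  have hU : IsOpen {y : ℂ | ‖y - a‖ < r} :=
    isOpen_lt (continuous_norm.comp (continuous_id.sub continuous_const)) continuous_const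
  refine (Complex.differentiableOn_tsum_of_summable_norm (h r hr0 hrR)
    (U := {y | ‖y - a‖ < r}) (fun m y hy => ?_) hU fun m y hy => ?_).differentiableAt
      (hU.mem_nhds hzr)
  · by_cases hm : m < 0
    · simp only [hc m hm, zero_mul]
      exact differentiableWithinAt_const 0
    · exact (((differentiableAt_id.sub_const a).zpow (Or.inr (not_lt.1 hm))).const_mul
        (c m)).differentiableWithinAt
  · by_cases hm : m < 0
    · simp [hc m hm]
    · rw [norm_mul, norm_zpow]
      exact mul_le_mul_of_nonneg_left
        (zpow_le_zpow_left₀ (not_lt.1 hm) (norm_nonneg _) (le_of_lt hy)) (norm_nonneg _)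

/-- Termwise integration of a Laurent series. -/
theorem circleIntegral_laurent {c : ℤ → ℂ} {R : ℝ} (hR : 0 < R)
    (h : Summable fun m : ℤ => ‖c m‖ * R ^ m) :
    ∮ z in C(0, R), z * ∑' m : ℤ, c m * z ^ m = 2 * Real.pi * Complex.I * c (-2) := by
  have hz : ∀ θ : ℝ, circleMap 0 R θ ≠ 0 := fun θ => circleMap_ne_center hR.ne'
  have hnorm : ∀ θ : ℝ, ‖circleMap 0 R θ‖ = R := fun θ => by
    simp [abs_of_pos hR]
  have hsum : ∀ θ : ℝ, Summable fun m : ℤ => c m * circleMap 0 R θ ^ m := fun θ => by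
    refine Summable.of_norm (h.congr fun m => ?_)
    rw [norm_mul, norm_zpow, hnorm]
  have key : HasSum (fun m : ℤ => ∮ z in C(0, R), c m * z ^ (m + 1))
      (∮ z in C(0, R), z * ∑' m : ℤ, c m * z ^ m) := by
    unfold circleIntegral
    refine intervalIntegral.hasSum_integral_of_dominated_convergence
      (fun m _ => R * R * (‖c m‖ * R ^ m)) (fun m => ?_) (fun m => ?_) ?_ ?_ ?_
    · refine Continuous.aestronglyMeasurable ?_
      simp only [deriv_circleMap]
      refine Continuous.smul ((continuous_circleMap 0 R).mul continuous_const)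
        (continuous_const.mul ?_)
      exact (continuous_circleMap 0 R).zpow₀ (m + 1) fun θ => Or.inl (hz θ)
    · refine Filter.Eventually.of_forall fun θ _ => ?_
      rw [norm_smul, deriv_circleMap, norm_mul, Complex.norm_I, mul_one, hnorm, norm_mul, norm_zpow,
        hnorm, zpow_add_one₀ hR.ne']
      apply le_of_eq; ring
    · exact Filter.Eventually.of_forall fun θ _ => h.mul_left _
    · exact intervalIntegrable_const
    · refine Filter.Eventually.of_forall fun θ _ => ?_
      refine (HasSum.mul_left (circleMap 0 R θ) (hsum θ).hasSum).const_smul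
        (deriv (circleMap 0 R) θ) |>.congr_fun ?_
      intro m
      beta_reduce
      rw [zpow_add_one₀ (hz θ)]
      simp only [smul_eq_mul]; ring
  rw [← key.tsum_eq, tsum_eq_single (-2)]
  · rw [circleIntegral.integral_const_mul]
    have := circleIntegral.integral_sub_center_inv 0 hR.ne'
    simp only [sub_zero] at this
    norm_num [zpow_neg_one, this]
    ring
  · intro m hm
    rw [circleIntegral.integral_const_mul]
    have := circleIntegral.integral_sub_zpow_of_ne (n := m + 1) (by omega) 0 0 R
    simp only [sub_zero] at this
    rw [this, mul_zero]

theorem mul_sub_zpow {z w : ℂ} (h : z ≠ w) (m : ℤ) :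
    z * (z - w) ^ m = (z - w) ^ (m + 1) + w * (z - w) ^ m := by
  rw [zpow_add_one₀ (sub_ne_zero.2 h)]; ring

theorem circleIntegrable_sub_zpow {w : ℂ} {R : ℝ} (hR : 0 < R) (h : ‖w‖ ≠ R) (m : ℤ) :
    CircleIntegrable (fun z => (z - w) ^ m) 0 R :=
  circleIntegrable_sub_zpow_iff.2 (Or.inr (Or.inr (by simpa [abs_of_pos hR] using h)))

theorem circleIntegral_mul_zpow_of_lt {w : ℂ} {R : ℝ} (h : ‖w‖ < R) (m : ℤ) :
    ∮ z in C(0, R), z * (z - w) ^ m =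
      2 * Real.pi * Complex.I * (if m = -2 then 1 else if m = -1 then w else 0) := by
  have hR : 0 < R := (norm_nonneg w).trans_lt h
  have hinv := circleIntegral.integral_sub_inv_of_mem_ball (c := 0) (w := w) (R := R) (by simpa using h)
  rw [circleIntegral.integral_congr (g := fun z => (z - w) ^ (m + 1) + w * (z - w) ^ m) hR.le,
    circleIntegral.integral_add (g := fun z => w * (z - w) ^ m)
      (circleIntegrable_sub_zpow hR h.ne _)
      ((circleIntegrable_sub_zpow hR h.ne m).const_smul (a := w)),
    circleIntegral.integral_const_mul]
  · by_cases h2 : m = -2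
    · subst h2
      rw [circleIntegral.integral_sub_zpow_of_ne (n := -2) (by norm_num)]
      norm_num [zpow_neg_one, hinv]
    · rw [circleIntegral.integral_sub_zpow_of_ne (n := m + 1) (by omega)]
      by_cases h1 : m = -1
      · subst h1
        norm_num [zpow_neg_one, hinv]
        ring
      · rw [circleIntegral.integral_sub_zpow_of_ne h1]
        simp [h1, h2]
  · intro z hz
    refine mul_sub_zpow (fun hzw => ?_) m
    rw [mem_sphere_zero_iff_norm, hzw] at hz
    exact h.ne hz

theorem circleIntegral_mul_zpow_of_gt {w : ℂ} {R : ℝ} (hR : 0 < R) (h : R < ‖w‖) (m : ℤ) :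
    ∮ z in C(0, R), z * (z - w) ^ m = 0 := by
  have hne : ∀ z ∈ Metric.closedBall (0 : ℂ) R, z - w ≠ 0 := by
    intro z hz h0
    rw [mem_closedBall_zero_iff, sub_eq_zero.1 h0] at hz
    exact absurd hz (not_le.2 h)
  have hd : ∀ z ∈ Metric.closedBall (0 : ℂ) R, DifferentiableAt ℂ (fun z => z * (z - w) ^ m) z :=
    fun z hz => differentiableAt_id.mul
      ((differentiableAt_id.sub_const w).zpow (Or.inl (hne z hz)))
  exact Complex.circleIntegral_eq_zero_of_differentiable_on_off_countable hR.le
    Set.countable_empty (fun z hz => (hd z hz).continuousAt.continuousWithinAt)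
    fun z hz => hd z (Metric.ball_subset_closedBall hz.1)

/-! ### The argument with values in `[0, 2π)` -/

theorem argZ_nonneg (z : ℂ) : 0 ≤ argZ z := by
  unfold argZ
  split_ifs with h
  · exact h
  · linarith [Complex.neg_pi_lt_arg z, Real.pi_pos]

theorem argZ_lt (z : ℂ) : argZ z < 2 * Real.pi := by
  unfold argZ
  split_ifs with h
  · linarith [Complex.arg_le_pi z, Real.pi_pos]
  · linarith

theorem cos_argZ {z : ℂ} (hz : z ≠ 0) : Real.cos (argZ z) = z.re / ‖z‖ := by
  unfold argZ
  split_ifs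
  · exact Complex.cos_arg hz
  · rw [Real.cos_add_two_pi, Complex.cos_arg hz]

theorem sin_argZ (z : ℂ) : Real.sin (argZ z) = z.im / ‖z‖ := by
  unfold argZ
  split_ifs
  · exact Complex.sin_arg z
  · rw [Real.sin_add_two_pi, Complex.sin_arg z]

theorem cos_argZ_sub {a b : ℂ} (ha : a ≠ 0) (hb : b ≠ 0) :
    Real.cos (argZ a - argZ b) = (a.re * b.re + a.im * b.im) / (‖a‖ * ‖b‖) := by
  rw [Real.cos_sub, cos_argZ ha, cos_argZ hb, sin_argZ, sin_argZ, div_mul_div_comm,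
    div_mul_div_comm, ← add_div]

theorem argZ_of_im_nonneg {z : ℂ} (h : 0 ≤ z.im) : argZ z ≤ Real.pi := by
  unfold argZ
  rw [if_pos (Complex.arg_nonneg_iff.2 h)]
  exact Complex.arg_le_pi z

theorem argZ_of_im_neg {z : ℂ} (h : z.im < 0) : Real.pi < argZ z := by
  unfold argZ
  rw [if_neg (by rw [Complex.arg_nonneg_iff]; exact not_le.2 h)]
  linarith [Complex.neg_pi_lt_arg z]

theorem argZ_of_re_neg {z : ℂ} (h : z.re < 0) :
    Real.pi / 2 < argZ z ∧ argZ z < 3 * Real.pi / 2 := by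
  have hz : z ≠ 0 := fun h0 => by simp [h0] at h
  have hcos : Real.cos (argZ z) < 0 := by
    rw [cos_argZ hz]; exact div_neg_of_neg_of_pos h (norm_pos_iff.2 hz)
  have h0 := argZ_nonneg z
  have h1 := argZ_lt z
  constructor
  · by_contra hc
    exact absurd (Real.cos_nonneg_of_neg_pi_div_two_le_of_le (by linarith [Real.pi_pos])
      (not_lt.1 hc)) (not_le.2 hcos)
  · by_contra hc
    rw [not_lt] at hc
    refine absurd (Real.cos_nonneg_of_neg_pi_div_two_le_of_le (x := argZ z - 2 * Real.pi)
      (by linarith [Real.pi_pos]) (by linarith [Real.pi_pos])) ?_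
    rw [Real.cos_sub_two_pi]
    exact not_le.2 hcos

/-- If the angle between `a` and `b` is acute, then so is the difference of their arguments, provided
that the latter does not wrap around. -/
theorem abs_argZ_sub_lt {a b : ℂ} (h : 0 < a.re * b.re + a.im * b.im)
    (hd : |argZ a - argZ b| < 3 * Real.pi / 2) : |argZ a - argZ b| < Real.pi / 2 := by
  have ha : a ≠ 0 := fun h0 => by simp [h0] at h
  have hb : b ≠ 0 := fun h0 => by simp [h0] at h
  have hcos : 0 < Real.cos |argZ a - argZ b| := by
    rw [Real.cos_abs, cos_argZ_sub ha hb]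
    exact div_pos h (mul_pos (norm_pos_iff.2 ha) (norm_pos_iff.2 hb))
  by_contra hc
  exact absurd (Real.cos_nonpos_of_pi_div_two_le_of_le (not_lt.1 hc) (by linarith))
    (not_le.2 hcos)

theorem argZ_sub_mem {a b : ℂ} (hb : 0 < b.re) (hb' : b.im < 0) (ha : a ≠ 0)
    (h : a.re * b.re + a.im * b.im < 0) :
    -(3 * Real.pi / 2) < argZ a - argZ b ∧ argZ a - argZ b < -(Real.pi / 2) := by
  have hb0 : b ≠ 0 := fun h0 => by simp [h0] at hb
  have hcos : Real.cos (argZ a - argZ b) < 0 := by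
    rw [cos_argZ_sub ha hb0]
    exact div_neg_of_neg_of_pos h (mul_pos (norm_pos_iff.2 ha) (norm_pos_iff.2 hb0))
  have hb1 : 3 * Real.pi / 2 ≤ argZ b := by
    by_contra hc
    have h1 := Real.cos_nonpos_of_pi_div_two_le_of_le (x := argZ b)
      (by linarith [argZ_of_im_neg hb', Real.pi_pos]) (by linarith)
    rw [cos_argZ hb0] at h1
    exact absurd (div_pos hb (norm_pos_iff.2 hb0)) (not_lt.2 h1)
  have := argZ_nonneg a
  have := argZ_lt a
  have := argZ_lt b
  have hpi := Real.pi_pos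
  have h2 : argZ a - argZ b < -(Real.pi / 2) := by
    by_contra hc
    exact absurd (Real.cos_nonneg_of_neg_pi_div_two_le_of_le (not_lt.1 hc) (by linarith))
      (not_le.2 hcos)
  refine ⟨?_, h2⟩
  by_contra hc
  rw [not_lt] at hc
  refine absurd (Real.cos_nonneg_of_neg_pi_div_two_le_of_le
    (x := argZ a - argZ b + 2 * Real.pi) (by linarith) (by linarith)) ?_
  rw [Real.cos_add_two_pi]
  exact not_le.2 hcos

theorem continuousAt_argZ {z : ℂ} (hz : -z ∈ Complex.slitPlane) : ContinuousAt argZ z := by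
  have heq : ∀ y : ℂ, -y ∈ Complex.slitPlane → argZ y = Complex.arg (-y) + Real.pi := by
    intro y hy
    unfold argZ
    rcases lt_trichotomy y.im 0 with h | h | h
    · rw [if_neg (by rw [Complex.arg_nonneg_iff]; exact not_le.2 h),
        Complex.arg_neg_eq_arg_add_pi_of_im_neg h]
      ring
    · have hre : y.re < 0 := by
        rcases hy with h1 | h1
        · simpa using h1
        · exact absurd h (by simpa using h1)
      have h1 : Complex.arg y = Real.pi := Complex.arg_eq_pi_iff.2 ⟨hre, h⟩
      have h2 : Complex.arg (-y) = 0 := by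
        rw [Complex.arg_eq_zero_iff]
        simp [h, hre.le]
      rw [h1, h2, if_pos Real.pi_pos.le, zero_add]
    · rw [if_pos (Complex.arg_nonneg_iff.2 h.le), Complex.arg_neg_eq_arg_sub_pi_of_im_pos h]
      ring
  have h1 : ContinuousAt (fun y : ℂ => Complex.arg (-y) + Real.pi) z :=
    ((Complex.continuousAt_arg hz).comp (f := fun y : ℂ => -y) continuous_neg.continuousAt).add
      continuousAt_const
  refine h1.congr ?_
  have : ∀ᶠ y in 𝓝 z, -y ∈ Complex.slitPlane :=
    continuous_neg.continuousAt.eventually (Complex.isOpen_slitPlane.mem_nhds hz)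
  filter_upwards [this] with y hy
  exact (heq y hy).symm

theorem eventually_abs_argZ_sub_lt {z : ℂ} (hz : -z ∈ Complex.slitPlane) :
    ∀ᶠ y in 𝓝 z, |argZ y - argZ z| < Real.pi := by
  have := (continuousAt_argZ hz).eventually (Metric.ball_mem_nhds _ Real.pi_pos)
  filter_upwards [this] with y hy
  rwa [← Real.dist_eq]

/-! ### Comparison of three Laurent expansions -/

theorem Complex.norm_lt_norm_iff {a b : ℂ} :
    ‖a‖ < ‖b‖ ↔ a.re * a.re + a.im * a.im < b.re * b.re + b.im * b.im := by
  rw [← sq_lt_sq₀ (norm_nonneg _) (norm_nonneg _), Complex.sq_norm, Complex.sq_norm,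
    Complex.normSq_apply, Complex.normSq_apply]

/-- The sum of a Laurent series. -/
noncomputable def laurent (c : ℤ → ℂ) (z : ℂ) : ℂ := ∑' m : ℤ, c m * z ^ m

/-- Three Laurent series, at infinity, at zero and at `w`, converging in the respective largest
possible regions, and a function `h`, analytic away from the cuts along `[0, ∞)` and `w + [0, ∞)`,
that is equal to the series where the arguments satisfy the inequalities in the duality property of
twisted intertwining operators. -/
structure LaurentGluing (w : ℂ) (h : ℂ → ℂ) (c₁ c₂ c₃ : ℤ → ℂ) : Prop where
  re_pos : 0 < w.re
  im_neg : w.im < 0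
  im_lt : -w.im < w.re
  differentiableAt : ∀ z, -z ∈ Complex.slitPlane → -(z - w) ∈ Complex.slitPlane →
    DifferentiableAt ℂ h z
  infinity : ∀ z, ‖w‖ < ‖z‖ → (Summable fun m : ℤ => c₁ m * z ^ m) ∧
    (|argZ (z - w) - argZ z| < Real.pi / 2 → HasSum (fun m : ℤ => c₁ m * z ^ m) (h z))
  zero : ∀ z, ‖z‖ < ‖w‖ → z ≠ 0 → (Summable fun m : ℤ => c₂ m * z ^ m) ∧
    (-(3 * Real.pi / 2) < argZ (z - w) - argZ w → argZ (z - w) - argZ w < -(Real.pi / 2) →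
      HasSum (fun m : ℤ => c₂ m * z ^ m) (h z))
  center : ∀ z, ‖z - w‖ < ‖w‖ → z ≠ w → (Summable fun m : ℤ => c₃ m * (z - w) ^ m) ∧
    (|argZ z - argZ w| < Real.pi / 2 → HasSum (fun m : ℤ => c₃ m * (z - w) ^ m) (h z))
  finite : {m : ℤ | m < 0 ∧ c₃ m ≠ 0}.Finite

namespace LaurentGluing

variable {w : ℂ} {h : ℂ → ℂ} {c₁ c₂ c₃ : ℤ → ℂ} (H : LaurentGluing w h c₁ c₂ c₃)
include H

theorem w_ne_zero : w ≠ 0 := fun h0 => by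
  have := H.re_pos
  simp [h0] at this

theorem norm_pos : 0 < ‖w‖ := norm_pos_iff.2 H.w_ne_zero

theorem summable_infinity {r : ℝ} (hr : ‖w‖ < r) : Summable fun m : ℤ => ‖c₁ m‖ * r ^ m := by
  have hr' : ‖(r : ℂ)‖ = r := by simp [abs_of_pos (H.norm_pos.trans hr)]
  exact summable_norm_laurent hr' (H.infinity r (by rwa [hr'])).1

theorem summable_zero {r : ℝ} (hr0 : 0 < r) (hr : r < ‖w‖) :
    Summable fun m : ℤ => ‖c₂ m‖ * r ^ m := by
  have hr' : ‖(r : ℂ)‖ = r := by simp [abs_of_pos hr0]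
  exact summable_norm_laurent hr' (H.zero r (by rwa [hr']) (by simpa using hr0.ne')).1

theorem summable_center {r : ℝ} (hr0 : 0 < r) (hr : r < ‖w‖) :
    Summable fun m : ℤ => ‖c₃ m‖ * r ^ m := by
  have hr' : ‖(r : ℂ)‖ = r := by simp [abs_of_pos hr0]
  have := (H.center (w + r) (by rwa [add_sub_cancel_left, hr']) (by simpa using hr0.ne')).1
  simp only [add_sub_cancel_left] at this
  exact summable_norm_laurent hr' this

theorem differentiableAt_infinity {z : ℂ} (hz : ‖w‖ < ‖z‖) :
    DifferentiableAt ℂ (laurent c₁) z := by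
  simpa using! differentiableAt_laurent (a := 0) (S := Set.Ioi ‖w‖) isOpen_Ioi
    (fun _ hr => H.norm_pos.trans hr) (fun _ hr => H.summable_infinity hr) (by simpa using hz)

theorem differentiableAt_zero {z : ℂ} (hz : ‖z‖ < ‖w‖) (hz0 : z ≠ 0) :
    DifferentiableAt ℂ (laurent c₂) z := by
  simpa using! differentiableAt_laurent (a := 0) (S := Set.Ioo 0 ‖w‖) isOpen_Ioo
    (fun _ hr => hr.1) (fun _ hr => H.summable_zero hr.1 hr.2) (z := z) (by simpa using ⟨hz0, hz⟩)

theorem differentiableAt_center {z : ℂ} (hz : ‖z - w‖ < ‖w‖) (hzw : z ≠ w) :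
    DifferentiableAt ℂ (fun z => laurent c₃ (z - w)) z :=
  differentiableAt_laurent (a := w) (S := Set.Ioo 0 ‖w‖) isOpen_Ioo
    (fun _ hr => hr.1) (fun _ hr => H.summable_center hr.1 hr.2)
    ⟨norm_pos_iff.2 (sub_ne_zero.2 hzw), hz⟩

/-- The disjunction on `z` keeps `z` and `z - w` on the same side of the cuts, so that their arguments
do not differ by a full turn. -/
theorem infinity_eq {z : ℂ} (hz : 0 < z.im ∨ z.im < w.im ∨ z.re < 0) (hzw : ‖w‖ < ‖z‖) :
    laurent c₁ z = h z := by
  refine ((H.infinity z hzw).2 (abs_argZ_sub_lt ?_ ?_)).tsum_eq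
  · rw [Complex.norm_lt_norm_iff] at hzw
    simp only [Complex.sub_re, Complex.sub_im]
    nlinarith [sq_nonneg (z.re - w.re), sq_nonneg (z.im - w.im)]
  · have hpi := Real.pi_pos
    have him := H.im_neg
    have hre := H.re_pos
    have n1 := argZ_nonneg z
    have n2 := argZ_nonneg (z - w)
    have l1 := argZ_lt z
    have l2 := argZ_lt (z - w)
    rw [abs_lt]
    rcases hz with hz | hz | hz
    · have a1 := argZ_of_im_nonneg hz.le
      have a2 := argZ_of_im_nonneg (z := z - w) (by rw [Complex.sub_im]; linarith)
      constructor <;> linarith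
    · have a1 := argZ_of_im_neg (z := z) (by linarith)
      have a2 := argZ_of_im_neg (z := z - w) (by rw [Complex.sub_im]; linarith)
      constructor <;> linarith
    · have a1 := argZ_of_re_neg hz
      have a2 := argZ_of_re_neg (z := z - w) (by rw [Complex.sub_re]; linarith)
      constructor <;> linarith

/-- Since `w` lies just below the cut, the inequalities for the arguments hold in the whole disk. -/
theorem zero_eq {z : ℂ} (hz : ‖z‖ < ‖w‖) (hz0 : z ≠ 0) : laurent c₂ z = h z := by
  have hlt : (z - w).re * w.re + (z - w).im * w.im < 0 := by
    rw [Complex.norm_lt_norm_iff] at hz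
    simp only [Complex.sub_re, Complex.sub_im]
    nlinarith [sq_nonneg (z.re - w.re), sq_nonneg (z.im - w.im)]
  have hne : z - w ≠ 0 := fun h0 => by
    rw [sub_eq_zero.1 h0] at hz
    exact lt_irrefl _ hz
  obtain ⟨ha, hb⟩ := argZ_sub_mem H.re_pos H.im_neg hne hlt
  exact ((H.zero z hz hz0).2 ha hb).tsum_eq

theorem center_eq {z : ℂ} (hz : ‖z - w‖ < ‖w‖) (hzw : z ≠ w) (hz0 : z.im < 0) :
    laurent c₃ (z - w) = h z := by
  refine ((H.center z hz hzw).2 (abs_argZ_sub_lt ?_ ?_)).tsum_eq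
  · rw [Complex.norm_lt_norm_iff] at hz
    simp only [Complex.sub_re, Complex.sub_im] at hz
    nlinarith [sq_nonneg z.re, sq_nonneg z.im]
  · have hpi := Real.pi_pos
    have a1 := argZ_of_im_neg hz0
    have a2 := argZ_of_im_neg H.im_neg
    have l1 := argZ_lt z
    have l2 := argZ_lt w
    rw [abs_lt]
    constructor <;> linarith

omit H in
theorem ne_zero_of_norm_sub_lt {w z : ℂ} (hz : ‖z - w‖ < ‖w‖) : z ≠ 0 := fun h0 => by
  rw [h0, zero_sub, norm_neg] at hz
  exact lt_irrefl _ hz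

/-- The expansions at zero and at `w` agree in the lens where both converge. -/
theorem zero_eq_center {z : ℂ} (hz : ‖z‖ < ‖w‖) (hzw : ‖z - w‖ < ‖w‖) :
    laurent c₂ z = laurent c₃ (z - w) := by
  set U : Set ℂ := Metric.ball 0 ‖w‖ ∩ Metric.ball w ‖w‖ with hU
  have hmem : ∀ y, y ∈ U ↔ ‖y‖ < ‖w‖ ∧ ‖y - w‖ < ‖w‖ := fun y => by
    rw [hU, Set.mem_inter_iff, mem_ball_zero_iff, mem_ball_iff_norm]
  have hopen : IsOpen U := Metric.isOpen_ball.inter Metric.isOpen_ball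
  have hne : ∀ y ∈ U, y ≠ w := fun y hy h0 => by
    have := ((hmem y).1 hy).1
    rw [h0] at this
    exact lt_irrefl _ this
  have hconv : IsPreconnected U :=
    ((convex_ball _ _).inter (convex_ball _ _)).isPreconnected
  have h2 : AnalyticOnNhd ℂ (laurent c₂) U := DifferentiableOn.analyticOnNhd (fun y hy =>
    (H.differentiableAt_zero ((hmem y).1 hy).1
      (ne_zero_of_norm_sub_lt ((hmem y).1 hy).2)).differentiableWithinAt) hopen
  have h3 : AnalyticOnNhd ℂ (fun z => laurent c₃ (z - w)) U :=
    DifferentiableOn.analyticOnNhd (fun y hy =>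
      (H.differentiableAt_center ((hmem y).1 hy).2 (hne y hy)).differentiableWithinAt) hopen
  have hp : w / 2 ∈ U := by
    have h1 : w / 2 - w = -(w / 2) := by ring
    have := H.norm_pos
    rw [hmem, h1, norm_neg, norm_div, Complex.norm_ofNat]
    constructor <;> linarith
  have him : ∀ᶠ y in 𝓝 (w / 2), y.im < 0 := by
    refine Complex.continuous_im.continuousAt.eventually (gt_mem_nhds ?_)
    have := H.im_neg
    simp only [Complex.div_ofNat_im]; linarith
  refine h2.eqOn_of_preconnected_of_eventuallyEq h3 hconv hp ?_ ((hmem z).2 ⟨hz, hzw⟩)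
  filter_upwards [him, hopen.mem_nhds hp] with y hy hyU
  rw [H.zero_eq ((hmem y).1 hyU).1 (ne_zero_of_norm_sub_lt ((hmem y).1 hyU).2),
    H.center_eq ((hmem y).1 hyU).2 (hne y hyU) hy]

/-- The expansions at infinity and at `w` agree in the lune where both converge.  The lune is the
image of a convex set under an inversion. -/
theorem infinity_eq_center {z : ℂ} (hz : ‖w‖ < ‖z‖) (hzw : ‖z - w‖ < ‖w‖) :
    laurent c₁ z = laurent c₃ (z - w) := by
  set U : Set ℂ := {y | ‖w‖ < ‖y‖} ∩ Metric.ball w ‖w‖ with hU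
  have hw := H.w_ne_zero
  have hmem : ∀ y, y ∈ U ↔ ‖w‖ < ‖y‖ ∧ ‖y - w‖ < ‖w‖ := fun y => by
    rw [hU, Set.mem_inter_iff, mem_ball_iff_norm]; rfl
  have hopen : IsOpen U := (isOpen_lt continuous_const continuous_norm).inter Metric.isOpen_ball
  have hne : ∀ y ∈ U, y ≠ w := fun y hy h0 => by
    have := ((hmem y).1 hy).1
    rw [h0] at this
    exact lt_irrefl _ this
  have hconv : IsPreconnected U := by
    have hset : U = (fun y : ℂ => w * y⁻¹) '' (Metric.ball 0 1 ∩ {y | 1 / 2 < y.re}) := by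
      have haux : ∀ y : ℂ, y ≠ 0 → (‖1 - y‖ < ‖y‖ ↔ 1 / 2 < y.re) := fun y _ => by
        rw [Complex.norm_lt_norm_iff]
        simp only [Complex.sub_re, Complex.one_re, Complex.sub_im, Complex.one_im]
        constructor <;> intro hh <;> nlinarith
      have hkey : ∀ y : ℂ, y ≠ 0 → (w * y⁻¹ ∈ U ↔ ‖y‖ < 1 ∧ 1 / 2 < y.re) := fun y hy => by
        have e1 : w * y⁻¹ - w = w * ((1 - y) * y⁻¹) := by field_simp
        have hyp := norm_pos_iff.2 hy
        rw [hmem, e1, norm_mul, norm_mul, norm_mul, norm_inv, ← haux y hy,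
          lt_mul_iff_one_lt_right H.norm_pos, mul_lt_iff_lt_one_right H.norm_pos,
          ← div_eq_mul_inv, div_lt_one hyp, one_lt_inv₀ hyp]
      ext y
      constructor
      · intro hy
        have hy0 : y ≠ 0 := ne_zero_of_norm_sub_lt ((hmem y).1 hy).2
        have e2 : w * (w / y)⁻¹ = y := by field_simp
        have h1 := (hkey (w / y) (div_ne_zero hw hy0)).1 (by rwa [e2])
        exact ⟨w / y, ⟨by simpa using h1.1, h1.2⟩, e2⟩
      · rintro ⟨v, ⟨hv1, hv2⟩, rfl⟩
        have hv0 : v ≠ 0 := fun h0 => by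
          simp only [Set.mem_ofPred_eq, h0, Complex.zero_re] at hv2
          norm_num at hv2
        exact (hkey v hv0).2 ⟨by simpa using hv1, hv2⟩
    rw [hset]
    refine IsPreconnected.image ?_ _ ?_
    · exact ((convex_ball _ _).inter (convex_halfSpace_re_gt _)).isPreconnected
    · refine continuousOn_const.mul (continuousOn_inv₀.mono ?_)
      rintro v ⟨-, hv⟩ h0
      simp only [Set.mem_ofPred_eq] at hv
      rw [Set.mem_singleton_iff.1 h0] at hv
      norm_num at hv
  have h1 : AnalyticOnNhd ℂ (laurent c₁) U := DifferentiableOn.analyticOnNhd (fun y hy =>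
    (H.differentiableAt_infinity ((hmem y).1 hy).1).differentiableWithinAt) hopen
  have h3 : AnalyticOnNhd ℂ (fun z => laurent c₃ (z - w)) U :=
    DifferentiableOn.analyticOnNhd (fun y hy =>
      (H.differentiableAt_center ((hmem y).1 hy).2 (hne y hy)).differentiableWithinAt) hopen
  have hp : 3 / 2 * w ∈ U := by
    have h1 : 3 / 2 * w - w = 1 / 2 * w := by ring
    have := H.norm_pos
    rw [hmem, h1, norm_mul, norm_mul]
    norm_num
    constructor <;> linarith
  have him : ∀ᶠ y in 𝓝 (3 / 2 * w), y.im < w.im := by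
    refine Complex.continuous_im.continuousAt.eventually (gt_mem_nhds ?_)
    have := H.im_neg
    have h2 : (3 / 2 * w).im = 3 / 2 * w.im := by simp [Complex.mul_im]
    rw [h2]; linarith
  refine h1.eqOn_of_preconnected_of_eventuallyEq h3 hconv hp ?_ ((hmem z).2 ⟨hz, hzw⟩)
  filter_upwards [him, hopen.mem_nhds hp] with y hy hyU
  rw [H.infinity_eq (Or.inr (Or.inl hy)) ((hmem y).1 hyU).1,
    H.center_eq ((hmem y).1 hyU).2 (hne y hyU) (hy.trans H.im_neg)]

/-- A point of the circle through `w` not covered by the expansion at `w` lies off the cuts of `h`; this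
is where `w` has to be close to the real axis. -/
theorem good_of_sphere {z : ℂ} (hz : ‖z‖ = ‖w‖) (hzw : ‖w‖ ≤ ‖z - w‖) :
    0 < z.im ∨ z.im < w.im ∨ z.re < 0 := by
  by_contra hc
  simp only [not_or, not_lt] at hc
  obtain ⟨h1, h2, h3⟩ := hc
  have hre := H.re_pos
  have him := H.im_neg
  have hlt := H.im_lt
  rw [← not_lt, Complex.norm_lt_norm_iff, not_lt] at hzw
  have e1 : z.re * z.re + z.im * z.im = w.re * w.re + w.im * w.im := by
    rw [← Complex.normSq_apply, ← Complex.normSq_apply, ← Complex.sq_norm, ← Complex.sq_norm, hz]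
  simp only [Complex.sub_re, Complex.sub_im] at hzw
  have h4 : w.re ≤ z.re := by
    by_contra hc
    rw [not_le] at hc
    nlinarith
  nlinarith

theorem differentiableAt_of_good {z : ℂ} (hz : 0 < z.im ∨ z.im < w.im ∨ z.re < 0) :
    DifferentiableAt ℂ h z := by
  have hre := H.re_pos
  have him := H.im_neg
  refine H.differentiableAt z ?_ ?_
  · rw [Complex.mem_slitPlane_iff, Complex.neg_re, Complex.neg_im]
    rcases hz with hz | hz | hz
    · right; linarith
    · right; linarith
    · left; linarith
  · rw [Complex.mem_slitPlane_iff, Complex.neg_re, Complex.neg_im, Complex.sub_re, Complex.sub_im]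
    rcases hz with hz | hz | hz
    · right; linarith
    · right; linarith
    · left; linarith

omit H in
theorem isOpen_good (w : ℂ) : IsOpen {z : ℂ | 0 < z.im ∨ z.im < w.im ∨ z.re < 0} :=
  (isOpen_lt continuous_const Complex.continuous_im).union
    ((isOpen_lt Complex.continuous_im continuous_const).union
      (isOpen_lt Complex.continuous_re continuous_const))

/-- On the circle through `w`, the expansion at `w` is equal to `h` by continuity. -/
theorem sphere_eq {z : ℂ} (hz : ‖z‖ = ‖w‖) (hzw : ‖z - w‖ < ‖w‖) (hne : z ≠ w)
    (hgood : 0 < z.im ∨ z.im < w.im ∨ z.re < 0) : laurent c₃ (z - w) = h z := by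
  have hcl : z ∈ closure (Metric.ball (0 : ℂ) ‖w‖) := by
    rw [closure_ball _ H.norm_pos.ne', mem_closedBall_zero_iff]
    exact hz.le
  have := mem_closure_iff_nhdsWithin_neBot.1 hcl
  refine tendsto_nhds_unique_of_eventuallyEq (l := 𝓝[Metric.ball (0 : ℂ) ‖w‖] z)
    ((H.differentiableAt_center hzw hne).continuousAt.continuousWithinAt)
    ((H.differentiableAt_of_good hgood).continuousAt.continuousWithinAt) ?_
  have hnear : ∀ᶠ y in 𝓝 z, ‖y - w‖ < ‖w‖ :=
    (continuous_norm.comp (continuous_id.sub continuous_const)).continuousAt.eventually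
      (gt_mem_nhds hzw)
  filter_upwards [self_mem_nhdsWithin, mem_nhdsWithin_of_mem_nhds hnear] with y hy hyw
  rw [mem_ball_zero_iff] at hy
  rw [← H.zero_eq_center hy hyw, H.zero_eq hy (ne_zero_of_norm_sub_lt hyw)]

omit H in
/-- The coefficients of the regular part at `w`. -/
theorem laurent_sub_principal (hfin : {m : ℤ | m < 0 ∧ c₃ m ≠ 0}.Finite) {y : ℂ}
    (hs : Summable fun m : ℤ => c₃ m * y ^ m) :
    laurent c₃ y - ∑ m ∈ hfin.toFinset, c₃ m * y ^ m =
      laurent (fun m => if m < 0 then 0 else c₃ m) y := by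
  have h1 : HasSum (fun m : ℤ => if m ∈ hfin.toFinset then c₃ m * y ^ m else 0)
      (∑ m ∈ hfin.toFinset, c₃ m * y ^ m) := by
    have : HasSum (fun m : ℤ => if m ∈ hfin.toFinset then c₃ m * y ^ m else 0)
        (∑ m ∈ hfin.toFinset, if m ∈ hfin.toFinset then c₃ m * y ^ m else 0) :=
      hasSum_sum_of_ne_finset_zero fun b hb => if_neg hb
    rwa [Finset.sum_congr rfl fun m hm => if_pos hm] at this
  rw [laurent, laurent, ← (hs.hasSum.sub h1).tsum_eq]
  refine tsum_congr fun m => ?_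
  simp only [Set.Finite.mem_toFinset, Set.mem_ofPred_eq]
  by_cases hm : m < 0
  · by_cases hc : c₃ m = 0
    · simp [hc]
    · simp [hm, hc]
  · simp [hm]

/-- The residue relation: the coefficients of `z⁻²` at infinity and at zero differ by the residue at
`w` of `z` times the expansion at `w`. -/
theorem coeff_relation : c₁ (-2) - c₂ (-2) = c₃ (-2) + w * c₃ (-1) := by
  have hw := H.w_ne_zero
  have hρ := H.norm_pos
  set P : ℂ → ℂ := fun z => ∑ m ∈ H.finite.toFinset, c₃ m * (z - w) ^ m with hP
  set F : ℂ → ℂ := fun z => laurent (fun m => if m < 0 then 0 else c₃ m) (z - w) with hF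
  have hPd : ∀ z, z ≠ w → DifferentiableAt ℂ P z := by
    intro z hz
    refine DifferentiableAt.fun_sum fun m _ => ?_
    exact ((differentiableAt_id.sub_const w).zpow (Or.inl (sub_ne_zero.2 hz))).const_mul _
  have hFd : ∀ z, ‖z - w‖ < ‖w‖ → DifferentiableAt ℂ F z := by
    intro z hz
    refine differentiableAt_powerSeries (fun m hm => if_pos hm) (R := ‖w‖) (fun r hr hr' => ?_) hz
    refine (H.summable_center hr hr').of_nonneg_of_le (fun m => by positivity) fun m => ?_
    refine mul_le_mul_of_nonneg_right ?_ (by positivity)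
    split_ifs <;> simp
  have hFP : ∀ z, ‖z - w‖ < ‖w‖ → z ≠ w → F z = laurent c₃ (z - w) - P z := fun z hz hne =>
    (laurent_sub_principal H.finite (H.center z hz hne).1).symm
  -- the common analytic continuation of the expansions, minus the principal part at `w`
  set K : ℂ → ℂ := fun z =>
    if ‖z‖ < ‖w‖ then h z - P z
    else if ‖w‖ < ‖z‖ then laurent c₁ z - P z
    else if ‖z - w‖ < ‖w‖ then F z else h z - P z with hK
  have hKin : ∀ z, ‖z‖ < ‖w‖ → z ≠ 0 → K z = laurent c₂ z - P z := fun z hz hz0 => by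
    rw [hK]; simp only [if_pos hz, H.zero_eq hz hz0]
  have hKout : ∀ z, ‖w‖ < ‖z‖ → K z = laurent c₁ z - P z := fun z hz => by
    rw [hK]; simp only [if_neg hz.not_gt, if_pos hz]
  have hKd : ∀ z, z ≠ 0 → DifferentiableAt ℂ K z := by
    intro z hz0
    rcases lt_trichotomy ‖z‖ ‖w‖ with hz | hz | hz
    · have hne : z ≠ w := fun h0 => by rw [h0] at hz; exact lt_irrefl _ hz
      refine ((H.differentiableAt_zero hz hz0).sub (hPd z hne)).congr_of_eventuallyEq ?_
      filter_upwards [(isOpen_lt continuous_norm continuous_const).mem_nhds hz,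
        isOpen_ne.mem_nhds hz0] with y hy hy0
      exact hKin y hy hy0
    · by_cases hzw : ‖z - w‖ < ‖w‖
      · refine (hFd z hzw).congr_of_eventuallyEq ?_
        have hnear : ∀ᶠ y in 𝓝 z, ‖y - w‖ < ‖w‖ :=
          (continuous_norm.comp (continuous_id.sub continuous_const)).continuousAt.eventually
            (gt_mem_nhds hzw)
        filter_upwards [hnear] with y hy
        rcases lt_trichotomy ‖y‖ ‖w‖ with hyw | hyw | hyw
        · have hne : y ≠ w := fun h0 => by rw [h0] at hyw; exact lt_irrefl _ hyw
          rw [hKin y hyw (ne_zero_of_norm_sub_lt hy), hFP y hy hne, H.zero_eq_center hyw hy]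
        · rw [hK]
          simp only [hyw, lt_irrefl, if_false, if_pos hy]
        · have hne : y ≠ w := fun h0 => by rw [h0] at hyw; exact lt_irrefl _ hyw
          rw [hKout y hyw, hFP y hy hne, H.infinity_eq_center hyw hy]
      · have hgood := H.good_of_sphere hz (not_lt.1 hzw)
        have hne : z ≠ w := fun h0 => by
          rw [h0, sub_self, norm_zero] at hzw
          exact hzw hρ
        refine ((H.differentiableAt_of_good hgood).sub (hPd z hne)).congr_of_eventuallyEq ?_
        filter_upwards [(isOpen_good w).mem_nhds hgood, isOpen_ne.mem_nhds hne] with y hyg hyne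
        rcases lt_trichotomy ‖y‖ ‖w‖ with hyw | hyw | hyw
        · rw [hK]; simp only [if_pos hyw]; rfl
        · rw [hK]
          simp only [hyw, lt_irrefl, if_false]
          split_ifs with hy
          · rw [hFP y hy hyne, H.sphere_eq hyw hy hyne hyg]; rfl
          · rfl
        · rw [hKout y hyw, H.infinity_eq hyg hyw]; rfl
    · have hne : z ≠ w := fun h0 => by rw [h0] at hz; exact lt_irrefl _ hz
      refine ((H.differentiableAt_infinity hz).sub (hPd z hne)).congr_of_eventuallyEq ?_
      filter_upwards [(isOpen_lt continuous_const continuous_norm).mem_nhds hz] with y hy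
      exact hKout y hy
  have hr : 0 < ‖w‖ / 2 := by linarith
  have hrw : ‖w‖ / 2 < ‖w‖ := by linarith
  have hwR : ‖w‖ < 2 * ‖w‖ := by linarith
  have hR : 0 < 2 * ‖w‖ := by linarith
  have hzK : ∀ z, z ≠ 0 → DifferentiableAt ℂ (fun z => z * K z) z := fun z hz =>
    differentiableAt_id.mul (hKd z hz)
  have hint := Complex.circleIntegral_eq_of_differentiable_on_annulus_off_countable
    (c := (0 : ℂ)) (f := fun z => z * K z) hr (hrw.trans hwR).le Set.countable_empty
    (fun z hz => (hzK z fun h0 => hz.2 (by simp [h0, hρ])).continuousAt.continuousWithinAt)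
    (fun z hz => hzK z fun h0 => hz.1.2 (by simpa [h0] using hr.le))
  have hPint : ∀ R : ℝ, 0 < R → ‖w‖ ≠ R → ∮ z in C(0, R), z * P z =
      ∑ m ∈ H.finite.toFinset, c₃ m * ∮ z in C(0, R), z * (z - w) ^ m := by
    intro R hR hwR
    simp only [hP, Finset.mul_sum]
    rw [circleIntegral.integral_fun_sum]
    · refine Finset.sum_congr rfl fun m _ => ?_
      rw [← circleIntegral.integral_const_mul]
      congr 1; ext z; ring
    · intro m _
      refine ContinuousOn.circleIntegrable hR.le fun z hz => ?_
      have hne : z ≠ w := fun h0 => by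
        rw [mem_sphere_zero_iff_norm, h0] at hz
        exact hwR hz
      exact (differentiableAt_id.mul (((differentiableAt_id.sub_const w).zpow
        (Or.inl (sub_ne_zero.2 hne))).const_mul _)).continuousAt.continuousWithinAt
  have hsplit : ∀ (R : ℝ) (c : ℤ → ℂ), 0 < R → ‖w‖ ≠ R → (∀ z, ‖z‖ = R → K z = laurent c z - P z) →
      (∀ z, ‖z‖ = R → DifferentiableAt ℂ (laurent c) z) →
      ∮ z in C(0, R), z * K z = (∮ z in C(0, R), z * laurent c z) - ∮ z in C(0, R), z * P z := by
    intro R c hR hwR hc hd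
    have hcont : ∀ (f : ℂ → ℂ), (∀ z, ‖z‖ = R → DifferentiableAt ℂ f z) →
        CircleIntegrable (fun z => z * f z) 0 R := fun f hf =>
      ContinuousOn.circleIntegrable hR.le fun z hz => (differentiableAt_id.mul
        (hf z (by simpa using hz))).continuousAt.continuousWithinAt
    rw [← circleIntegral.integral_sub (hcont _ hd)
      (hcont P fun z hz => hPd z fun h0 => hwR (by rw [← h0, hz]))]
    refine circleIntegral.integral_congr hR.le fun z hz => ?_
    simp only [hc z (by simpa using hz)]
    ring
  rw [hsplit (2 * ‖w‖) c₁ hR hwR.ne (fun z hz => hKout z (by rw [hz]; exact hwR))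
      (fun z hz => H.differentiableAt_infinity (by rw [hz]; exact hwR)),
    hsplit (‖w‖ / 2) c₂ hr hrw.ne'
      (fun z hz => hKin z (by rw [hz]; exact hrw) (norm_pos_iff.1 (by rw [hz]; exact hr)))
      (fun z hz => H.differentiableAt_zero (by rw [hz]; exact hrw)
        (norm_pos_iff.1 (by rw [hz]; exact hr))),
    hPint _ hR hwR.ne, hPint _ hr hrw.ne'] at hint
  simp only [laurent, circleIntegral_laurent hR (H.summable_infinity hwR),
    circleIntegral_laurent hr (H.summable_zero hr hrw), circleIntegral_mul_zpow_of_lt hwR,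
    circleIntegral_mul_zpow_of_gt hr hrw] at hint
  have hres : ∑ m ∈ H.finite.toFinset, c₃ m * (2 * Real.pi * Complex.I *
      (if m = -2 then 1 else if m = -1 then w else 0)) =
      2 * Real.pi * Complex.I * (c₃ (-2) + w * c₃ (-1)) := by
    have hsub : ∑ m ∈ H.finite.toFinset, c₃ m * (2 * Real.pi * Complex.I *
      (if m = -2 then 1 else if m = -1 then w else 0)) =
      ∑ m ∈ H.finite.toFinset ∪ {-2, -1}, c₃ m * (2 * Real.pi * Complex.I *
      (if m = -2 then 1 else if m = -1 then w else 0)) := by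
      refine Finset.sum_subset Finset.subset_union_left fun m hm hm' => ?_
      have hmlt : m < 0 := by
        rcases Finset.mem_union.1 hm with hm | hm
        · exact absurd hm hm'
        · simp only [Finset.mem_insert, Finset.mem_singleton] at hm
          omega
      have : c₃ m = 0 := by
        by_contra hc
        exact hm' (by simp [hmlt, hc])
      rw [this, zero_mul]
    rw [hsub, ← Finset.sum_subset (Finset.subset_union_right :
      ({-2, -1} : Finset ℤ) ⊆ H.finite.toFinset ∪ {-2, -1})]
    · rw [Finset.sum_pair (by norm_num)]
      norm_num
      ring
    · intro m _ hm
      simp only [Finset.mem_insert, Finset.mem_singleton, not_or] at hm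
      rw [if_neg hm.1, if_neg hm.2, mul_zero, mul_zero]
  rw [hres] at hint
  simp only [mul_zero, Finset.sum_const_zero, sub_zero] at hint
  have h2 : 2 * (Real.pi : ℂ) * Complex.I *
      (c₁ (-2) - c₂ (-2) - (c₃ (-2) + w * c₃ (-1))) = 0 := by linear_combination hint
  exact sub_eq_zero.1 ((mul_eq_zero.1 h2).resolve_left Complex.two_pi_I_ne_zero)

end LaurentGluing

/-! ### Linear independence of exponential polynomials -/

theorem Polynomial.eq_zero_of_derivative_add_smul {P : Polynomial ℂ} {a : ℂ} (ha : a ≠ 0)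
    (h : Polynomial.derivative P + Polynomial.C a * P = 0) : P = 0 := by
  by_contra hP
  have h1 := congrArg (fun Q => Polynomial.coeff Q P.natDegree) h
  simp only [Polynomial.coeff_add, Polynomial.coeff_C_mul, Polynomial.coeff_derivative,
    Polynomial.coeff_zero] at h1
  rw [Polynomial.coeff_eq_zero_of_natDegree_lt (Nat.lt_succ_self _), zero_mul, zero_add] at h1
  exact hP (Polynomial.leadingCoeff_eq_zero.1 ((mul_eq_zero.1 h1).resolve_left ha))

theorem Polynomial.eq_zero_of_eval_add_ofReal {P : Polynomial ℂ} {θ : ℂ}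
    (h : ∀ t : ℝ, P.eval (θ + t) = 0) : P = 0 := by
  refine Polynomial.eq_zero_of_infinite_isRoot P
    ((Set.infinite_range_of_injective (f := fun t : ℝ => θ + t) fun s t hst => ?_).mono ?_)
  · simpa using hst
  · rintro _ ⟨t, rfl⟩
    exact h t

/-- An exponential polynomial without constant exponent that is equal to a polynomial vanishes. -/
theorem exp_polynomial_eq_zero_aux (θ : ℂ) (n : ℕ) : ∀ (A : Finset ℂ), A.card = n → (0 : ℂ) ∉ A →
    ∀ (d : ℕ) (P : ℂ → Polynomial ℂ) (R : Polynomial ℂ), R.natDegree < d →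
    (∀ t : ℝ, ∑ a ∈ A, Complex.exp (a * (θ + t)) * (P a).eval (θ + t) + R.eval (θ + t) = 0) →
    ∀ a ∈ A, P a = 0 := by
  induction n with
  | zero =>
    intro A hA _ d P R _ _ a ha
    rw [Finset.card_eq_zero.1 hA] at ha
    simp at ha
  | succ n ihn =>
    intro A hA h0 d
    -- the case of a vanishing polynomial, by division by one of the exponentials
    have hzero : ∀ P : ℂ → Polynomial ℂ,
        (∀ t : ℝ, ∑ a ∈ A, Complex.exp (a * (θ + t)) * (P a).eval (θ + t) = 0) →
        ∀ a ∈ A, P a = 0 := by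
      intro P hP
      obtain ⟨b, hb⟩ : A.Nonempty := Finset.card_pos.1 (by omega)
      have hinj : Set.InjOn (fun a : ℂ => a - b) (A.erase b : Finset ℂ) :=
        fun x _ y _ hxy => sub_left_injective hxy
      have key : ∀ t : ℝ, ∑ c ∈ (A.erase b).image (fun a => a - b),
          Complex.exp (c * (θ + t)) * (P (c + b)).eval (θ + t) + (P b).eval (θ + t) = 0 := by
        intro t
        rw [Finset.sum_image hinj]
        have h1 := hP t
        rw [← Finset.sum_erase_add A _ hb] at h1
        have h2 := congrArg (fun y => Complex.exp (-(b * (θ + t))) * y) h1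
        simp only [mul_zero, mul_add, Finset.mul_sum] at h2
        rw [← h2, ← mul_assoc, ← Complex.exp_add, neg_add_cancel, Complex.exp_zero, one_mul]
        congr 1
        refine Finset.sum_congr rfl fun a _ => ?_
        rw [← mul_assoc, ← Complex.exp_add, sub_add_cancel]
        congr 2
        ring
      have hrest := ihn _ (by rw [Finset.card_image_of_injOn hinj, Finset.card_erase_of_mem hb, hA]; rfl)
        (by simp [sub_eq_zero]) _ (fun c => P (c + b)) (P b) (Nat.lt_succ_self _) key
      have hrest' : ∀ a ∈ A.erase b, P a = 0 := fun a ha => by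
        have := hrest (a - b) (Finset.mem_image_of_mem _ ha)
        rwa [sub_add_cancel] at this
      intro a ha
      by_cases hab : a = b
      · subst hab
        refine Polynomial.eq_zero_of_eval_add_ofReal (θ := θ) fun t => ?_
        have h1 := hP t
        rw [← Finset.sum_erase_add A _ ha, Finset.sum_eq_zero, zero_add] at h1
        · exact (mul_eq_zero.1 h1).resolve_left (Complex.exp_ne_zero _)
        · intro c hc
          rw [hrest' c hc, Polynomial.eval_zero, mul_zero]
      · exact hrest' a (Finset.mem_erase.2 ⟨hab, ha⟩)
    induction d with
    | zero => intro P R hR; omega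
    | succ d ihd =>
      intro P R hR hP
      have hder : ∀ t : ℝ, ∑ a ∈ A, Complex.exp (a * (θ + t)) *
          (Polynomial.derivative (P a) + Polynomial.C a * P a).eval (θ + t) +
          (Polynomial.derivative R).eval (θ + t) = 0 := by
        intro t
        have h1 : HasDerivAt (fun s : ℂ => ∑ a ∈ A, Complex.exp (a * (θ + s)) *
            (P a).eval (θ + s) + R.eval (θ + s))
            (∑ a ∈ A, Complex.exp (a * (θ + t)) *
            (Polynomial.derivative (P a) + Polynomial.C a * P a).eval (θ + t) +
            (Polynomial.derivative R).eval (θ + t)) (t : ℂ) := by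
          refine HasDerivAt.add (HasDerivAt.fun_sum fun a _ => ?_)
            ((R.hasDerivAt (θ + t)).comp_const_add θ (t : ℂ))
          have e1 : HasDerivAt (fun s : ℂ => Complex.exp (a * (θ + s)))
              (Complex.exp (a * (θ + t)) * (a * 1)) (t : ℂ) :=
            (((hasDerivAt_id (t : ℂ)).const_add θ).const_mul a).cexp
          refine (e1.mul (((P a).hasDerivAt (θ + t)).comp_const_add θ (t : ℂ))).congr_deriv ?_
          rw [Polynomial.eval_add, Polynomial.eval_mul, Polynomial.eval_C]
          ring
        have h2 := h1.comp_ofReal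
        have h3 : (fun s : ℝ => ∑ a ∈ A, Complex.exp (a * (θ + s)) *
            (P a).eval (θ + s) + R.eval (θ + (s : ℂ))) = fun _ => 0 := funext hP
        rw [h3] at h2
        exact h2.unique (hasDerivAt_const t (0 : ℂ))
      intro a ha
      refine Polynomial.eq_zero_of_derivative_add_smul (a := a) (fun h => h0 (h ▸ ha)) ?_
      by_cases hR0 : R.natDegree = 0
      · rw [Polynomial.derivative_of_natDegree_zero hR0] at hder
        exact hzero (fun a => Polynomial.derivative (P a) + Polynomial.C a * P a)
          (by simpa using hder) a ha
      · refine ihd (fun a => Polynomial.derivative (P a) + Polynomial.C a * P a)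
          (Polynomial.derivative R) ?_ hder a ha
        have := Polynomial.natDegree_derivative_lt hR0
        omega

/-- Exponential polynomials with different exponents are linearly independent on a horizontal line. -/
theorem exp_polynomial_eq_zero {θ : ℂ} {A : Finset ℂ} {P : ℂ → Polynomial ℂ}
    (h : ∀ t : ℝ, ∑ a ∈ A, Complex.exp (a * (θ + t)) * (P a).eval (θ + t) = 0) :
    ∀ a ∈ A, P a = 0 := by
  have h0 : ∀ a ∈ A.erase 0, P a = 0 := by
    refine exp_polynomial_eq_zero_aux θ _ (A.erase 0) rfl (by simp) _ P
      (if (0 : ℂ) ∈ A then P 0 else 0) (Nat.lt_succ_self _) fun t => ?_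
    refine Eq.trans ?_ (h t)
    split_ifs with hA
    · rw [← Finset.sum_erase_add A _ hA]
      simp
    · rw [Finset.erase_eq_of_notMem hA]
      simp
  intro a ha
  by_cases ha0 : a = 0
  · subst ha0
    refine Polynomial.eq_zero_of_eval_add_ofReal (θ := θ) fun t => ?_
    have h1 := h t
    rw [← Finset.sum_erase_add A _ ha, Finset.sum_eq_zero, zero_add] at h1
    · simpa using h1
    · intro c hc
      rw [h0 c hc, Polynomial.eval_zero, mul_zero]
  · exact h0 a (Finset.mem_erase.2 ⟨ha0, ha⟩)

theorem logBranch_ofReal_mul {x : ℝ} (hx : 0 < x) {z : ℂ} (hz : z ≠ 0) (p : ℤ) :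
    logBranch p (x * z) = logBranch p z + Real.log x := by
  have h1 : argZ (x * z) = argZ z := by
    unfold argZ; rw [Complex.arg_real_mul z hx]
  rw [logBranch, logBranch, h1, norm_mul, Complex.norm_real, Real.norm_of_nonneg hx.le,
    Real.log_mul hx.ne' (norm_ne_zero_iff.2 hz)]
  push_cast; ring

/-- A series is determined by its values on a ray. -/
theorem gradedProj_eq_zero_of_evalComp {M : Type u} [AddCommGroup M] [Module ℂ M]
    {gr : ℂ → Submodule ℂ M} {s : LogSeries M} (hs : s ∈ evaluableSeries gr) {n w : ℂ}
    (hw : w ≠ 0) (h : ∀ x : ℝ, 0 < x → evalComp gr s 0 (x * w) n = 0) (a : ℂ) (k : ℕ) :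
    gradedProj gr n (s a k) = 0 := by
  classical
  rw [← Module.forall_dual_apply_eq_zero_iff ℂ]
  intro ψ
  set T := (hs n).toFinset with hT
  have hmem : ∀ c, gradedProj gr n (s c.1 c.2) ≠ 0 → c ∈ T := fun c hc => by
    rw [hT, Set.Finite.mem_toFinset]; exact hc
  set A := T.image Prod.fst
  set B := T.image Prod.snd
  set P : ℂ → Polynomial ℂ := fun b =>
    ∑ k ∈ B, Polynomial.monomial k (ψ (gradedProj gr n (s b k))) with hP
  by_cases hak : gradedProj gr n (s a k) = 0
  · rw [hak, map_zero]
  have hA : a ∈ A := Finset.mem_image.2 ⟨(a, k), hmem _ hak, rfl⟩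
  have hB : k ∈ B := Finset.mem_image.2 ⟨(a, k), hmem _ hak, rfl⟩
  have h1 := exp_polynomial_eq_zero (θ := logBranch 0 w) (A := A) (P := P) (fun t => by
    have h2 := congrArg ψ (h (Real.exp t) (Real.exp_pos t))
    rw [map_zero, map_evalComp ψ hs, logBranch_ofReal_mul (Real.exp_pos t) hw, Real.log_exp,
      finsum_eq_sum_of_support_subset (s := A ×ˢ B), Finset.sum_product] at h2
    · rw [← h2]
      refine Finset.sum_congr rfl fun b _ => ?_
      rw [hP, Polynomial.eval_finsetSum, Finset.mul_sum]
      refine Finset.sum_congr rfl fun l _ => ?_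
      rw [Polynomial.eval_monomial, smul_eq_mul]
      ring
    · intro c hc
      have : c ∈ T := hmem c fun h0 => hc (by simp only [h0, map_zero, smul_zero])
      rw [Finset.coe_product]
      exact ⟨Finset.mem_image_of_mem _ this, Finset.mem_image_of_mem _ this⟩) a hA
  have h2 := congrArg (fun Q => Polynomial.coeff Q k) h1
  simp only [hP, Polynomial.finsetSum_coeff, Polynomial.coeff_monomial, Polynomial.coeff_zero] at h2
  rwa [Finset.sum_ite_eq' B k, if_pos hB] at h2

/-- Multiplication of a series by `x`. -/
def shiftSeries {M : Type u} (s : LogSeries M) : LogSeries M := fun a k => s (a - 1) k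

theorem shiftSeries_mem {M : Type u} [AddCommGroup M] [Module ℂ M] {gr : ℂ → Submodule ℂ M}
    {s : LogSeries M} (hs : s ∈ evaluableSeries gr) : shiftSeries s ∈ evaluableSeries gr := by
  intro n
  refine ((hs n).image fun c : ℂ × ℕ => (c.1 + 1, c.2)).subset ?_
  rintro ⟨a, k⟩ h
  exact ⟨(a - 1, k), h, by simp⟩

theorem evalComp_shiftSeries {M : Type u} [AddCommGroup M] [Module ℂ M] {gr : ℂ → Submodule ℂ M}
    (s : LogSeries M) (p : ℤ) {z : ℂ} (hz : z ≠ 0) (n : ℂ) :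
    evalComp gr (shiftSeries s) p z n = z • evalComp gr s p z n := by
  unfold evalComp
  rw [smul_finsum]
  refine (finsum_comp_equiv ((Equiv.addRight (1 : ℂ)).prodCongr (Equiv.refl ℕ))).symm.trans
    (finsum_congr fun c => ?_)
  simp only [Equiv.prodCongr_apply, Prod.map, Equiv.coe_addRight, Equiv.refl_apply, shiftSeries,
    add_sub_cancel_right, smul_smul]
  rw [add_mul, one_mul, Complex.exp_add, exp_logBranch p hz]
  congr 1
  ring

/-! ### The commutator formula for `L(0)` -/

section Commutator

variable {V : Type v} [AddCommGroup V] [Module ℂ V] {𝒱 : VOA V} {k₁ k₂ k₃ : 𝒱.Aut}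
  {M₁ M₂ M₃ : ModuleData.{u} V}

/-- Away from the cuts, a preferred branch is analytic in the first variable. -/
theorem IsPreferredBranch.differentiableAt {f : (Fin 2 → ℂ) → ℂ} (hf : IsPreferredBranch f)
    {z w : ℂ} (hw : w ≠ 0) (hz : -z ∈ Complex.slitPlane) (hzw : -(z - w) ∈ Complex.slitPlane) :
    DifferentiableAt ℂ (fun y => f ![y, w]) z := by
  have hz0 : z ≠ 0 := fun h => Complex.slitPlane_ne_zero hz (by rw [h, neg_zero])
  have hne : z ≠ w := fun h => Complex.slitPlane_ne_zero hzw (by rw [h, sub_self, neg_zero])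
  have hp : ![z, w] ∈ confRegion 2 := by
    refine ⟨fun i => ?_, fun i j hij => ?_⟩
    · fin_cases i <;> simp [hz0, hw]
    · fin_cases i <;> fin_cases j <;> simp_all
      exact fun h => hne h.symm
  obtain ⟨φ, hφ, heq, -⟩ := hf _ hp
  have hd : DifferentiableAt ℂ (fun y : ℂ => (![y, w] : Fin 2 → ℂ)) z := by
    rw [differentiableAt_pi]
    intro i
    fin_cases i
    · exact differentiableAt_id
    · exact differentiableAt_const w
  have h1 : DifferentiableAt ℂ (fun y => φ ![y, w]) z :=
    DifferentiableAt.comp z (f := fun y : ℂ => (![y, w] : Fin 2 → ℂ)) hφ.differentiableAt hd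
  refine h1.congr_of_eventuallyEq ?_
  have h2 : ContinuousAt (fun y : ℂ => y - w) z := continuousAt_id.sub continuousAt_const
  filter_upwards [hd.continuousAt.eventually heq, eventually_abs_argZ_sub_lt hz,
    h2.eventually (eventually_abs_argZ_sub_lt hzw)] with y hy hy1 hy2
  refine hy (fun i => ?_) hy2
  fin_cases i
  · exact hy1
  · simpa using Real.pi_pos

variable {B : M₁.carrier →ₗ[ℂ] M₂.carrier →ₗ[ℂ] LogSeries M₃.carrier}

theorem IntertwiningAxioms.mem_evaluableSeries {𝒴 : M₁.carrier → M₂.carrier → LogSeries M₃.carrier}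
    (hB : IntertwiningAxioms 𝒱 𝒴) (w₁ : M₁.carrier) (w₂ : M₂.carrier) :
    𝒴 w₁ w₂ ∈ evaluableSeries M₃.gr := hB.evaluable w₁ w₂

/-- The commutator formula for `L(0)`, for the values of an intertwining operator at points slightly
below the positive real axis.  There the duality property for the conformal vector identifies the
products in both orders and the iterate with the expansions of a single function, to which the
residue relation applies. -/
theorem commutator_value (h₁ : IsTwistedModule 𝒱 k₁ M₁) (h₂ : IsTwistedModule 𝒱 k₂ M₂)
    (h₃ : IsTwistedModule 𝒱 k₃ M₃)
    (hB : IntertwiningAxioms 𝒱 (W₁ := M₁) (W₂ := M₂) (W₃ := M₃) fun w₁ w₂ => B w₁ w₂)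
    {n₁ n₂ s : ℂ} {w₁ : M₁.carrier} {w₂ : M₂.carrier} {φ : M₃.Dual} (hw₁ : w₁ ∈ M₁.gr n₁)
    (hw₂ : w₂ ∈ M₂.gr n₂) (hφ : φ ∈ gradedDualGr M₃.gr s) {w : ℂ} (hre : 0 < w.re)
    (him : w.im < 0) (hlt : -w.im < w.re) :
    φ.1 (M₃.L 𝒱 0 (evalComp M₃.gr (B w₁ w₂) 0 w s)) - pairEval φ (B w₁ (M₂.L 𝒱 0 w₂)) 0 w =
      pairEval φ (B (M₁.L 𝒱 0 w₁) w₂) 0 w + w * pairEval φ (B (M₁.L 𝒱 (-1) w₁) w₂) 0 w := by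
  obtain ⟨f, hf, hfd⟩ := hB.duality 𝒱.conf w₁ w₂ φ
  have hw0 : w ≠ 0 := fun h => by simp [h] at hre
  have inj₁ : Function.Injective fun m : ℤ => s - m - 2 := fun a b hab => by simpa using hab
  have inj₂ : ∀ n : ℂ, Function.Injective fun m : ℤ => n + m + 2 := fun n a b hab => by
    simpa using hab
  have e₁ : ∀ (z : ℂ), z ≠ 0 → ∀ m : ℤ, pairEval φ (M₃.Y 𝒱.conf
      (evalComp M₃.gr (B w₁ w₂) 0 w (s - m - 2))) 0 z =
      φ.1 (M₃.L 𝒱 (-m - 2) (evalComp M₃.gr (B w₁ w₂) 0 w (s - m - 2))) * z ^ m := by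
    intro z hz m
    rw [pairEval_of_mem hφ, h₃.evalComp_conf (evalComp_mem _ _ _ _) s 0 (-m - 2)
      (by push_cast; ring) hz, map_smul, smul_eq_mul, mul_comm]
    congr 2; ring
  have s₁ : ∀ (z : ℂ), ∀ r, r ∉ Set.range (fun m : ℤ => s - (m : ℂ) - 2) →
      pairEval φ (M₃.Y 𝒱.conf (evalComp M₃.gr (B w₁ w₂) 0 w r)) 0 z = 0 := by
    intro z r hr
    rw [pairEval_of_mem hφ, h₃.evalComp_conf_eq_zero (evalComp_mem _ _ _ _), map_zero]
    intro m hm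
    refine hr ⟨-m - 2, ?_⟩
    rw [hm]; push_cast; ring
  have e₂ : ∀ (z : ℂ), z ≠ 0 → ∀ m : ℤ, pairEval φ (B w₁ (evalComp M₂.gr
      (M₂.Y 𝒱.conf w₂) 0 z (n₂ + m + 2))) 0 w =
      pairEval φ (B w₁ (M₂.L 𝒱 (-m - 2) w₂)) 0 w * z ^ m := by
    intro z hz m
    rw [h₂.evalComp_conf hw₂ _ 0 (-m - 2) (by push_cast; ring) hz, map_smul, pairEval_smul_right,
      mul_comm]
    congr 2; ring
  have s₂ : ∀ (z : ℂ), ∀ r, r ∉ Set.range (fun m : ℤ => n₂ + (m : ℂ) + 2) →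
      pairEval φ (B w₁ (evalComp M₂.gr (M₂.Y 𝒱.conf w₂) 0 z r)) 0 w = 0 := by
    intro z r hr
    rw [h₂.evalComp_conf_eq_zero hw₂, map_zero, pairEval_zero_right]
    intro m hm
    refine hr ⟨-m - 2, ?_⟩
    rw [hm]; push_cast; ring
  have e₃ : ∀ (z : ℂ), z ≠ 0 → ∀ m : ℤ, pairEval φ (B (evalComp M₁.gr
      (M₁.Y 𝒱.conf w₁) 0 z (n₁ + m + 2)) w₂) 0 w =
      pairEval φ (B (M₁.L 𝒱 (-m - 2) w₁) w₂) 0 w * z ^ m := by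
    intro z hz m
    rw [h₁.evalComp_conf hw₁ _ 0 (-m - 2) (by push_cast; ring) hz, map_smul, LinearMap.smul_apply,
      pairEval_smul_right, mul_comm]
    congr 2; ring
  have s₃ : ∀ (z : ℂ), ∀ r, r ∉ Set.range (fun m : ℤ => n₁ + (m : ℂ) + 2) →
      pairEval φ (B (evalComp M₁.gr (M₁.Y 𝒱.conf w₁) 0 z r) w₂) 0 w = 0 := by
    intro z r hr
    rw [h₁.evalComp_conf_eq_zero hw₁, map_zero, LinearMap.zero_apply, pairEval_zero_right]
    intro m hm
    refine hr ⟨-m - 2, ?_⟩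
    rw [hm]; push_cast; ring
  have key : LaurentGluing w (fun z => f ![z, w])
      (fun m => φ.1 (M₃.L 𝒱 (-m - 2) (evalComp M₃.gr (B w₁ w₂) 0 w (s - m - 2))))
      (fun m => pairEval φ (B w₁ (M₂.L 𝒱 (-m - 2) w₂)) 0 w)
      (fun m => pairEval φ (B (M₁.L 𝒱 (-m - 2) w₁) w₂) 0 w) := by
    refine ⟨hre, him, hlt, fun z => hf.differentiableAt hw0, fun z hz => ?_, fun z hz hz0 => ?_,
      fun z hz hzw => ?_, ?_⟩
    · have hz0 : z ≠ 0 := norm_pos_iff.1 ((norm_nonneg w).trans_lt hz)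
      obtain ⟨a, b⟩ := (hfd z w).1 hz hw0
      have hcomp := funext (e₁ z hz0)
      constructor
      · rw [← inj₁.summable_iff (s₁ z)] at a
        exact hcomp ▸ a
      · intro harg
        have c := b harg
        rw [← inj₁.hasSum_iff (s₁ z)] at c
        exact hcomp ▸ c
    · obtain ⟨a, b⟩ := (hfd z w).2.1 hz hz0
      have hcomp := funext (e₂ z hz0)
      constructor
      · rw [← (inj₂ n₂).summable_iff (s₂ z)] at a
        exact hcomp ▸ a
      · intro harg harg'
        have c := b harg harg'
        rw [← (inj₂ n₂).hasSum_iff (s₂ z)] at c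
        exact hcomp ▸ c
    · obtain ⟨a, b⟩ := (hfd z w).2.2 hz hzw
      have hcomp := funext (e₃ (z - w) (sub_ne_zero.2 hzw))
      constructor
      · rw [← (inj₂ n₁).summable_iff (s₃ (z - w))] at a
        exact hcomp ▸ a
      · intro harg
        have c := b harg
        rw [← (inj₂ n₁).hasSum_iff (s₃ (z - w))] at c
        exact hcomp ▸ c
    · refine (h₁.finite_lower (n₁ + 2) 0).subset fun m hm => ⟨hm.1.le, fun hbot => hm.2 ?_⟩
      have h1 := h₁.L_mem (-m - 2) hw₁
      have h2 : n₁ - ((-m - 2 : ℤ) : ℂ) = n₁ + 2 + m := by push_cast; ring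
      rw [h2, hbot, Submodule.mem_bot] at h1
      rw [h1, map_zero, LinearMap.zero_apply, pairEval_zero_right]
  have := key.coeff_relation
  norm_num at this
  exact this

/-- The commutator formula `[L(0), 𝒴(w₁, x)] w₂ = 𝒴(L(0) w₁, x) w₂ + x 𝒴(L(-1) w₁, x) w₂`. -/
theorem commutator_series (h₁ : IsTwistedModule 𝒱 k₁ M₁) (h₂ : IsTwistedModule 𝒱 k₂ M₂)
    (h₃ : IsTwistedModule 𝒱 k₃ M₃)
    (hB : IntertwiningAxioms 𝒱 (W₁ := M₁) (W₂ := M₂) (W₃ := M₃) fun w₁ w₂ => B w₁ w₂)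
    {n₁ n₂ : ℂ} {w₁ : M₁.carrier} {w₂ : M₂.carrier} (hw₁ : w₁ ∈ M₁.gr n₁)
    (hw₂ : w₂ ∈ M₂.gr n₂) (a : ℂ) (k : ℕ) :
    M₃.L 𝒱 0 (B w₁ w₂ a k) - B w₁ (M₂.L 𝒱 0 w₂) a k =
      B (M₁.L 𝒱 0 w₁) w₂ a k + B (M₁.L 𝒱 (-1) w₁) w₂ (a - 1) k := by
  have hL : ∀ n, ∀ x ∈ M₃.gr n, M₃.L 𝒱 0 x ∈ M₃.gr n := fun n x hx => h₃.L_zero_mem hx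
  have ev : ∀ v₁ v₂, B v₁ v₂ ∈ evaluableSeries M₃.gr := fun v₁ v₂ => hB.mem_evaluableSeries v₁ v₂
  have hLev : (fun a k => M₃.L 𝒱 0 (B w₁ w₂ a k)) ∈ evaluableSeries M₃.gr := by
    intro n
    refine (ev w₁ w₂ n).subset fun c hc h0 => hc ?_
    rw [gradedProj_map h₃.internal h₃.internal _ hL, h0, map_zero]
  set S : LogSeries M₃.carrier := (fun a k => M₃.L 𝒱 0 (B w₁ w₂ a k)) +
    ((-1 : ℂ) • B w₁ (M₂.L 𝒱 0 w₂) + ((-1 : ℂ) • B (M₁.L 𝒱 0 w₁) w₂ +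
      (-1 : ℂ) • shiftSeries (B (M₁.L 𝒱 (-1) w₁) w₂))) with hS
  have m1 := (evaluableSeries M₃.gr).smul_mem (-1) (ev w₁ (M₂.L 𝒱 0 w₂))
  have m2 := (evaluableSeries M₃.gr).smul_mem (-1) (ev (M₁.L 𝒱 0 w₁) w₂)
  have m3 := (evaluableSeries M₃.gr).smul_mem (-1) (shiftSeries_mem (ev (M₁.L 𝒱 (-1) w₁) w₂))
  have hSev : S ∈ evaluableSeries M₃.gr := add_mem hLev (add_mem m1 (add_mem m2 m3))
  have hS0 : S a k = 0 := by
    refine eq_of_gradedProj_eq h₃.internal fun n => ?_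
    rw [map_zero]
    -- the ray through `2 - i` lies in the region where the commutator formula holds for values
    have hne : (2 - Complex.I : ℂ) ≠ 0 := fun h => by simpa using congrArg Complex.re h
    refine gradedProj_eq_zero_of_evalComp hSev hne (fun x hx => ?_) a k
    have hxne : (x : ℂ) * (2 - Complex.I) ≠ 0 := mul_ne_zero (by simpa using hx.ne') hne
    rw [← Module.forall_dual_apply_eq_zero_iff ℂ]
    intro ψ
    have key := commutator_value h₁ h₂ h₃ hB hw₁ hw₂ (dualProj_mem n ψ)
      (w := (x : ℂ) * (2 - Complex.I)) (by simp [hx]) (by simp [hx]) (by simp; linarith)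
    rw [pairEval_dualProj h₃.internal, pairEval_dualProj h₃.internal, pairEval_dualProj h₃.internal,
      dualProj_apply, gradedProj_of_mem h₃.internal (hL _ _ (evalComp_mem _ _ _ _))] at key
    rw [hS, evalComp_add hLev (add_mem m1 (add_mem m2 m3)), evalComp_add m1 (add_mem m2 m3),
      evalComp_add m2 m3, evalComp_smul, evalComp_smul, evalComp_smul,
      evalComp_map h₃.internal hL (ev w₁ w₂), evalComp_shiftSeries _ _ hxne]
    simp only [map_add, map_smul, smul_eq_mul]
    linear_combination key
  have h1 : M₃.L 𝒱 0 (B w₁ w₂ a k) + ((-1 : ℂ) • B w₁ (M₂.L 𝒱 0 w₂) a k +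
      ((-1 : ℂ) • B (M₁.L 𝒱 0 w₁) w₂ a k + (-1 : ℂ) • B (M₁.L 𝒱 (-1) w₁) w₂ (a - 1) k)) = 0 := hS0
  simp only [neg_smul, one_smul] at h1
  rw [← sub_eq_zero, ← h1]
  abel

/-- The recursion for the coefficients of the powers of `log x`. -/
theorem log_recursion (h₁ : IsTwistedModule 𝒱 k₁ M₁) (h₂ : IsTwistedModule 𝒱 k₂ M₂)
    (h₃ : IsTwistedModule 𝒱 k₃ M₃)
    (hB : IntertwiningAxioms 𝒱 (W₁ := M₁) (W₂ := M₂) (W₃ := M₃) fun w₁ w₂ => B w₁ w₂)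
    {n₁ n₂ : ℂ} {w₁ : M₁.carrier} {w₂ : M₂.carrier} (hw₁ : w₁ ∈ M₁.gr n₁)
    (hw₂ : w₂ ∈ M₂.gr n₂) (a : ℂ) (k : ℕ) :
    ((k : ℂ) + 1) • B w₁ w₂ a (k + 1) = (M₃.L 𝒱 0 - (a + n₁ + n₂) • 1) (B w₁ w₂ a k) -
      B ((M₁.L 𝒱 0 - n₁ • 1) w₁) w₂ a k - B w₁ ((M₂.L 𝒱 0 - n₂ • 1) w₂) a k := by
  have h1 := commutator_series h₁ h₂ h₃ hB hw₁ hw₂ a k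
  have h2 := congrFun (congrFun (hB.Lneg1_derivative w₁ w₂) (a - 1)) k
  simp only [derivSeries, sub_add_cancel] at h2
  rw [← h2] at h1
  simp only [LinearMap.sub_apply, LinearMap.smul_apply, Module.End.one_apply, map_sub, map_smul,
    Pi.sub_apply, Pi.smul_apply]
  rw [sub_eq_iff_eq_add] at h1
  rw [h1]
  module

end Commutator

/-! ### Solving the recursion in the powers of the logarithm -/

theorem sum_range_antidiagonal {E : Type*} [AddCommMonoid E] {N : ℕ} {F : ℕ × ℕ → E}
    (hF : ∀ p, N ≤ p.1 + p.2 → F p = 0) :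
    ∑ m ∈ Finset.range N, ∑ p ∈ Finset.HasAntidiagonal.antidiagonal m, F p =
      ∑ i ∈ Finset.range N, ∑ j ∈ Finset.range N, F (i, j) := by
  have h1 : ∀ i ∈ Finset.range N, ∑ j ∈ Finset.range N, F (i, j) =
      ∑ j ∈ Finset.range (N - i), F (i, j) := fun i _ =>
    (Finset.sum_subset (Finset.range_mono (Nat.sub_le N i)) fun j _ hj =>
      hF (i, j) (by simp at hj; simp only; omega)).symm
  rw [Finset.sum_congr rfl h1, ← Finset.sum_range_diag_flip N fun i j => F (i, j)]
  exact Finset.sum_congr rfl fun m _ =>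
    Finset.Nat.sum_antidiagonal_eq_sum_range_succ (fun i j => F (i, j)) m

/-- The divided power `x ^ n / n!`. -/
noncomputable def dividedPow {R : Type*} [Ring R] [Algebra ℂ R] (x : R) (n : ℕ) : R :=
  ((n.factorial : ℂ)⁻¹) • x ^ n

theorem dividedPow_add {R : Type*} [Ring R] [Algebra ℂ R] {x y : R} (h : Commute x y) (n : ℕ) :
    dividedPow (x + y) n =
      ∑ p ∈ Finset.HasAntidiagonal.antidiagonal n, dividedPow x p.1 * dividedPow y p.2 := by
  rw [dividedPow, h.add_pow', Finset.smul_sum]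
  refine Finset.sum_congr rfl fun p hp => ?_
  obtain rfl := Finset.HasAntidiagonal.mem_antidiagonal.1 hp
  rw [dividedPow, dividedPow, smul_mul_smul_comm, ← Nat.cast_smul_eq_nsmul ℂ, smul_smul,
    Nat.cast_add_choose]
  congr 1
  have h1 := Nat.factorial_ne_zero p.1
  have h2 := Nat.factorial_ne_zero p.2
  have h3 := Nat.factorial_ne_zero (p.1 + p.2)
  field_simp

section Taylor

variable {E : Type*} [AddCommGroup E] [Module ℂ E]

theorem dividedPow_recursion {X : Module.End ℂ E} {y : ℕ → E}
    (hrec : ∀ k : ℕ, ((k : ℂ) + 1) • y (k + 1) = X (y k)) (m l : ℕ) :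
    dividedPow X m (y l) = ((m + l).choose m : ℂ) • y (m + l) := by
  have h1 : ∀ m, (X ^ m) (y l) = (((m + l).factorial : ℂ) / l.factorial) • y (m + l) := by
    intro m
    induction m with
    | zero =>
      have := Nat.factorial_ne_zero l
      rw [zero_add, div_self (by exact_mod_cast this)]
      simp
    | succ m ih =>
      rw [pow_succ', Module.End.mul_apply, ih, map_smul, ← hrec, smul_smul,
        show m + 1 + l = m + l + 1 by ring, Nat.factorial_succ]
      congr 1
      push_cast; ring
  rw [dividedPow, LinearMap.smul_apply, h1, smul_smul, Nat.cast_add_choose]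
  congr 1
  have h1 := Nat.factorial_ne_zero m
  have h2 := Nat.factorial_ne_zero l
  field_simp

/-- A polynomial solution of `∂_t y = X y` is determined by its value at any point, by Taylor's
formula. -/
theorem taylor_of_recursion {X : Module.End ℂ E} {y : ℕ → E} {N : ℕ}
    (hrec : ∀ k : ℕ, ((k : ℂ) + 1) • y (k + 1) = X (y k)) (hN : ∀ k, N ≤ k → y k = 0) (t : ℂ) (k : ℕ) :
    y k = ∑ m ∈ Finset.range N, ((Polynomial.X - Polynomial.C t) ^ m).coeff k •
      dividedPow X m (∑ l ∈ Finset.range N, t ^ l • y l) := by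
  have h1 : ∀ m ∈ Finset.range N, ((Polynomial.X - Polynomial.C t) ^ m).coeff k •
      dividedPow X m (∑ l ∈ Finset.range N, t ^ l • y l) = ∑ l ∈ Finset.range N,
      (((Polynomial.X - Polynomial.C t) ^ m).coeff k * t ^ l * ((m + l).choose m : ℂ)) •
        y (m + l) := by
    intro m _
    rw [map_sum, Finset.smul_sum]
    refine Finset.sum_congr rfl fun l _ => ?_
    rw [map_smul, dividedPow_recursion hrec, smul_smul, smul_smul]
  rw [Finset.sum_congr rfl h1]
  have hflip := sum_range_antidiagonal (N := N) (F := fun p =>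
    (((Polynomial.X - Polynomial.C t) ^ p.1).coeff k * t ^ p.2 *
      ((p.1 + p.2).choose p.1 : ℂ)) • y (p.1 + p.2)) fun p hp => by rw [hN _ hp, smul_zero]
  simp only at hflip
  rw [← hflip]
  have h2 : ∀ s ∈ Finset.range N, ∑ p ∈ Finset.HasAntidiagonal.antidiagonal s,
      (((Polynomial.X - Polynomial.C t) ^ p.1).coeff k * t ^ p.2 *
        ((p.1 + p.2).choose p.1 : ℂ)) • y (p.1 + p.2) = if k = s then y s else 0 := by
    intro s _
    have h3 := congrArg (fun Q => Polynomial.coeff Q k) ((Commute.all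
      (Polynomial.X - Polynomial.C t) (Polynomial.C t)).add_pow' s)
    simp only [sub_add_cancel, Polynomial.coeff_X_pow, Polynomial.finsetSum_coeff,
      Polynomial.coeff_smul, ← Polynomial.C_pow, Polynomial.coeff_mul_C] at h3
    have h4 : (if k = s then y s else 0) = (if k = s then (1 : ℂ) else 0) • y s := by
      split_ifs <;> simp
    rw [h4, h3, Finset.sum_smul]
    refine Finset.sum_congr rfl fun p hp => ?_
    obtain rfl := Finset.HasAntidiagonal.mem_antidiagonal.1 hp
    rw [nsmul_eq_mul]
    congr 1
    ring
  rw [Finset.sum_congr rfl h2, Finset.sum_ite_eq]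
  split_ifs with hk
  · rfl
  · exact hN k (by simpa using hk)

/-- The operator on doubly indexed families induced by an operator on the terms. -/
def familyMap (T : Module.End ℂ E) : Module.End ℂ (ℕ → ℕ → E) where
  toFun e := fun p q => T (e p q)
  map_add' e f := by ext p q; simp
  map_smul' c e := by ext p q; simp

/-- The shift of the first index of a doubly indexed family, with a sign. -/
def negShiftFst : Module.End ℂ (ℕ → ℕ → E) where
  toFun e := fun p q => -e (p + 1) q
  map_add' e f := by ext p q; simp [add_comm]
  map_smul' c e := by ext p q; simp

/-- The shift of the second index of a doubly indexed family, with a sign. -/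
def negShiftSnd : Module.End ℂ (ℕ → ℕ → E) where
  toFun e := fun p q => -e p (q + 1)
  map_add' e f := by ext p q; simp [add_comm]
  map_smul' c e := by ext p q; simp

theorem familyMap_pow (T : Module.End ℂ E) (i : ℕ) (e : ℕ → ℕ → E) (p q : ℕ) :
    (familyMap T ^ i) e p q = (T ^ i) (e p q) := by
  induction i with
  | zero => rfl
  | succ i ih => rw [pow_succ', pow_succ', Module.End.mul_apply, Module.End.mul_apply, ← ih]; rfl

theorem negShiftFst_pow (i : ℕ) (e : ℕ → ℕ → E) (p q : ℕ) :
    (negShiftFst ^ i) e p q = (-1 : ℂ) ^ i • e (p + i) q := by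
  induction i generalizing p with
  | zero => simp
  | succ i ih =>
    rw [pow_succ', Module.End.mul_apply]
    change -(negShiftFst ^ i) e (p + 1) q = _
    rw [ih, pow_succ, mul_neg_one, neg_smul, show p + 1 + i = p + (i + 1) by ring]

theorem negShiftSnd_pow (i : ℕ) (e : ℕ → ℕ → E) (p q : ℕ) :
    (negShiftSnd ^ i) e p q = (-1 : ℂ) ^ i • e p (q + i) := by
  induction i generalizing q with
  | zero => simp
  | succ i ih =>
    rw [pow_succ', Module.End.mul_apply]
    change -(negShiftSnd ^ i) e p (q + 1) = _
    rw [ih, pow_succ, mul_neg_one, neg_smul, show q + 1 + i = q + (i + 1) by ring]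

/-- The solution of the recursion for the powers of the logarithm, where the operator on the right-hand
side is the sum of three commuting nilpotent ones. -/
theorem taylor_of_family_recursion {T : Module.End ℂ E} {y : ℕ → ℕ → ℕ → E} {N : ℕ}
    (hrec : ∀ k p q : ℕ, ((k : ℂ) + 1) • y (k + 1) p q = T (y k p q) - y k (p + 1) q - y k p (q + 1))
    (hk : ∀ k p q, N ≤ k → y k p q = 0) (hp : ∀ k p q, N ≤ p → y k p q = 0)
    (hq : ∀ k p q, N ≤ q → y k p q = 0) (hT : ∀ i k p q, N ≤ i → (T ^ i) (y k p q) = 0)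
    (t : ℂ) (k : ℕ) {J : ℕ} (hJ : 3 * N ≤ J) :
    y k 0 0 = ∑ i ∈ Finset.range J, ∑ j ∈ Finset.range J, ∑ l ∈ Finset.range J,
      ((-1) ^ (j + l) / ((i.factorial : ℂ) * j.factorial * l.factorial) *
        ((Polynomial.X - Polynomial.C t) ^ (i + j + l)).coeff k) •
        (T ^ i) (∑ m ∈ Finset.range J, t ^ m • y m j l) := by
  set Y : ℕ → ℕ → E := ∑ m ∈ Finset.range J, t ^ m • y m with hY
  have hYapp : ∀ p q, Y p q = ∑ m ∈ Finset.range J, t ^ m • y m p q := by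
    intro p q
    simp [hY, Finset.sum_apply]
  have hYp : ∀ p q, N ≤ p → Y p q = 0 := fun p q h => by
    rw [hYapp]; exact Finset.sum_eq_zero fun m _ => by rw [hp _ _ _ h, smul_zero]
  have hYq : ∀ p q, N ≤ q → Y p q = 0 := fun p q h => by
    rw [hYapp]; exact Finset.sum_eq_zero fun m _ => by rw [hq _ _ _ h, smul_zero]
  have hYT : ∀ i p q, N ≤ i → (T ^ i) (Y p q) = 0 := fun i p q h => by
    rw [hYapp, map_sum]
    exact Finset.sum_eq_zero fun m _ => by rw [map_smul, hT _ _ _ _ h, smul_zero]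
  have c1 : Commute (familyMap T) (negShiftFst + negShiftSnd) := by
    refine LinearMap.ext fun e => ?_
    ext p q
    change T (-e (p + 1) q + -e p (q + 1)) = -T (e (p + 1) q) + -T (e p (q + 1))
    rw [map_add, map_neg, map_neg]
  have c2 : Commute (negShiftFst : Module.End ℂ (ℕ → ℕ → E)) negShiftSnd := rfl
  have h1 := taylor_of_recursion (X := familyMap T + (negShiftFst + negShiftSnd)) (y := y) (N := J)
    (fun k => by
      ext p q
      refine (hrec k p q).trans ?_
      change _ = T (y k p q) + (-y k (p + 1) q + -y k p (q + 1))
      abel)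
    (fun k hkJ => by ext p q; exact hk k p q (by omega)) t k
  have h2 := congrFun (congrFun h1 0) 0
  rw [h2, ← hY]
  have hterm : ∀ i j l, (dividedPow (familyMap T) i * (dividedPow negShiftFst j *
      dividedPow negShiftSnd l) : Module.End ℂ (ℕ → ℕ → E)) Y 0 0 =
      ((-1) ^ (j + l) / ((i.factorial : ℂ) * j.factorial * l.factorial)) • (T ^ i) (Y j l) := by
    intro i j l
    simp only [dividedPow, Module.End.mul_apply, LinearMap.smul_apply, Pi.smul_apply,
      familyMap_pow, map_smul, negShiftFst_pow, negShiftSnd_pow, zero_add, smul_smul]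
    congr 1
    rw [pow_add]
    field_simp
  have hvan : ∀ i j l, J ≤ i + j + l → (T ^ i) (Y j l) = 0 := by
    intro i j l h
    by_cases hi : N ≤ i
    · exact hYT _ _ _ hi
    · by_cases hj : N ≤ j
      · rw [hYp _ _ hj, map_zero]
      · rw [hYq _ _ (by omega), map_zero]
  have h3 : ∀ m ∈ Finset.range J, ((Polynomial.X - Polynomial.C t) ^ m).coeff k •
      (dividedPow (familyMap T + (negShiftFst + negShiftSnd)) m :
        Module.End ℂ (ℕ → ℕ → E)) Y 0 0 =
      ∑ p ∈ Finset.HasAntidiagonal.antidiagonal m, ((Polynomial.X - Polynomial.C t) ^ (p.1 + p.2)).coeff k •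
        ∑ s ∈ Finset.HasAntidiagonal.antidiagonal p.2, ((-1) ^ (s.1 + s.2) /
          ((p.1.factorial : ℂ) * s.1.factorial * s.2.factorial)) • (T ^ p.1) (Y s.1 s.2) := by
    intro m _
    rw [dividedPow_add c1, LinearMap.sum_apply, Finset.sum_apply, Finset.sum_apply,
      Finset.smul_sum]
    refine Finset.sum_congr rfl fun p hp => ?_
    rw [Finset.HasAntidiagonal.mem_antidiagonal.1 hp, dividedPow_add c2, Finset.mul_sum, LinearMap.sum_apply,
      Finset.sum_apply, Finset.sum_apply]
    congr 1
    exact Finset.sum_congr rfl fun s _ => hterm _ _ _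
  simp only [Finset.sum_apply, Pi.smul_apply]
  rw [Finset.sum_congr rfl h3]
  rw [sum_range_antidiagonal]
  · refine Finset.sum_congr rfl fun i _ => ?_
    have h4 : ∀ r ∈ Finset.range J, ((Polynomial.X - Polynomial.C t) ^ (i + r)).coeff k •
        ∑ s ∈ Finset.HasAntidiagonal.antidiagonal r, ((-1) ^ (s.1 + s.2) /
          ((i.factorial : ℂ) * s.1.factorial * s.2.factorial)) • (T ^ i) (Y s.1 s.2) =
        ∑ s ∈ Finset.HasAntidiagonal.antidiagonal r, ((-1) ^ (s.1 + s.2) /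
          ((i.factorial : ℂ) * s.1.factorial * s.2.factorial) *
          ((Polynomial.X - Polynomial.C t) ^ (i + s.1 + s.2)).coeff k) • (T ^ i) (Y s.1 s.2) := by
      intro r _
      rw [Finset.smul_sum]
      refine Finset.sum_congr rfl fun s hs => ?_
      rw [smul_smul, mul_comm, add_assoc, Finset.HasAntidiagonal.mem_antidiagonal.1 hs]
    rw [Finset.sum_congr rfl h4, sum_range_antidiagonal]
    · simp only [hYapp]
    · intro p hp
      rw [hvan i p.1 p.2 (by omega), smul_zero]
  · intro p hp
    rw [Finset.sum_eq_zero, smul_zero]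
    intro s hs
    rw [hvan p.1 s.1 s.2 (by have := Finset.HasAntidiagonal.mem_antidiagonal.1 hs; omega),
      smul_zero]

end Taylor

/-! ### Intertwining operators and their values at a point -/

section LogExpansion

variable {V : Type v} [AddCommGroup V] [Module ℂ V] {𝒱 : VOA V} {k₁ k₂ k₃ : 𝒱.Aut}
  {M₁ M₂ M₃ : ModuleData.{u} V}
  {B : M₁.carrier →ₗ[ℂ] M₂.carrier →ₗ[ℂ] LogSeries M₃.carrier}

/-- The coefficients obtained from two homogeneous vectors by the nilpotent parts of `L(0)`. -/
def nilpotentFamily (𝒱 : VOA V) (B : M₁.carrier →ₗ[ℂ] M₂.carrier →ₗ[ℂ] LogSeries M₃.carrier)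
    (n₁ n₂ : ℂ) (w₁ : M₁.carrier) (w₂ : M₂.carrier) (a : ℂ) (k p q : ℕ) : M₃.carrier :=
  B (((M₁.L 𝒱 0 - n₁ • 1) ^ p) w₁) (((M₂.L 𝒱 0 - n₂ • 1) ^ q) w₂) a k

theorem nilpotentFamily_recursion (h₁ : IsTwistedModule 𝒱 k₁ M₁) (h₂ : IsTwistedModule 𝒱 k₂ M₂)
    (h₃ : IsTwistedModule 𝒱 k₃ M₃)
    (hB : IntertwiningAxioms 𝒱 (W₁ := M₁) (W₂ := M₂) (W₃ := M₃) fun w₁ w₂ => B w₁ w₂)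
    {n₁ n₂ : ℂ} {w₁ : M₁.carrier} {w₂ : M₂.carrier} (hw₁ : w₁ ∈ M₁.gr n₁)
    (hw₂ : w₂ ∈ M₂.gr n₂) (a : ℂ) (k p q : ℕ) :
    ((k : ℂ) + 1) • nilpotentFamily 𝒱 B n₁ n₂ w₁ w₂ a (k + 1) p q =
      (M₃.L 𝒱 0 - (a + n₁ + n₂) • 1) (nilpotentFamily 𝒱 B n₁ n₂ w₁ w₂ a k p q) -
      nilpotentFamily 𝒱 B n₁ n₂ w₁ w₂ a k (p + 1) q -
      nilpotentFamily 𝒱 B n₁ n₂ w₁ w₂ a k p (q + 1) := by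
  have h := log_recursion h₁ h₂ h₃ hB (h₁.L_zero_sub_pow_mem n₁ p hw₁)
    (h₂.L_zero_sub_pow_mem n₂ q hw₂) a k
  rw [← Module.End.mul_apply, ← Module.End.mul_apply, ← pow_succ', ← pow_succ'] at h
  exact h

theorem exists_bound_nilpotentFamily (h₁ : IsTwistedModule 𝒱 k₁ M₁)
    (h₂ : IsTwistedModule 𝒱 k₂ M₂) (hlog : ∀ w₁ w₂, LogBounded (B w₁ w₂))
    {n₁ n₂ : ℂ} {w₁ : M₁.carrier} {w₂ : M₂.carrier} (hw₁ : w₁ ∈ M₁.gr n₁)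
    (hw₂ : w₂ ∈ M₂.gr n₂) : ∃ N : ℕ, ∀ (a : ℂ) (k p q : ℕ), N ≤ k ∨ N ≤ p ∨ N ≤ q →
      nilpotentFamily 𝒱 B n₁ n₂ w₁ w₂ a k p q = 0 := by
  obtain ⟨K₁, hK₁⟩ := h₁.exists_pow_eq_zero w₁
  obtain ⟨K₂, hK₂⟩ := h₂.exists_pow_eq_zero w₂
  have e₁ : M₁.π n₁ w₁ = w₁ := gradedProj_of_mem h₁.internal hw₁
  have e₂ : M₂.π n₂ w₂ = w₂ := gradedProj_of_mem h₂.internal hw₂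
  have z₁ : ∀ (a : ℂ) (k p q : ℕ), K₁ ≤ p → nilpotentFamily 𝒱 B n₁ n₂ w₁ w₂ a k p q = 0 := by
    intro a k p q hp
    have := hK₁ n₁ p hp
    rw [e₁] at this
    rw [nilpotentFamily, this, map_zero]; rfl
  have z₂ : ∀ (a : ℂ) (k p q : ℕ), K₂ ≤ q → nilpotentFamily 𝒱 B n₁ n₂ w₁ w₂ a k p q = 0 := by
    intro a k p q hp
    have := hK₂ n₂ q hp
    rw [e₂] at this
    rw [nilpotentFamily, this, map_zero]; rfl
  choose K hK using hlog
  set S := (Finset.range K₁ ×ˢ Finset.range K₂).sup fun pq =>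
    K (((M₁.L 𝒱 0 - n₁ • 1) ^ pq.1) w₁) (((M₂.L 𝒱 0 - n₂ • 1) ^ pq.2) w₂) with hS
  refine ⟨max (S + 1) (max K₁ K₂), fun a k p q h => ?_⟩
  by_cases hp : K₁ ≤ p
  · exact z₁ a k p q hp
  by_cases hq : K₂ ≤ q
  · exact z₂ a k p q hq
  refine hK _ _ a k ?_
  have h1 : K (((M₁.L 𝒱 0 - n₁ • 1) ^ p) w₁) (((M₂.L 𝒱 0 - n₂ • 1) ^ q) w₂) ≤ S :=
    Finset.le_sup (f := fun pq : ℕ × ℕ =>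
      K (((M₁.L 𝒱 0 - n₁ • 1) ^ pq.1) w₁) (((M₂.L 𝒱 0 - n₂ • 1) ^ pq.2) w₂)) (b := (p, q))
      (by simpa using ⟨not_le.1 hp, not_le.1 hq⟩)
  omega

/-- The coefficients of an intertwining operator are homogeneous, `x` having weight `-1`. -/
theorem nilpotentFamily_mem (h₁ : IsTwistedModule 𝒱 k₁ M₁) (h₂ : IsTwistedModule 𝒱 k₂ M₂)
    (h₃ : IsTwistedModule 𝒱 k₃ M₃)
    (hB : IntertwiningAxioms 𝒱 (W₁ := M₁) (W₂ := M₂) (W₃ := M₃) fun w₁ w₂ => B w₁ w₂)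
    (hlog : ∀ w₁ w₂, LogBounded (B w₁ w₂))
    {n₁ n₂ : ℂ} {w₁ : M₁.carrier} {w₂ : M₂.carrier} (hw₁ : w₁ ∈ M₁.gr n₁)
    (hw₂ : w₂ ∈ M₂.gr n₂) (a : ℂ) (k p q : ℕ) :
    nilpotentFamily 𝒱 B n₁ n₂ w₁ w₂ a k p q ∈ M₃.gr (a + n₁ + n₂) := by
  obtain ⟨N, hN⟩ := exists_bound_nilpotentFamily h₁ h₂ hlog hw₁ hw₂
  have key : ∀ d k p q : ℕ, 3 * N ≤ k + p + q + d →
      nilpotentFamily 𝒱 B n₁ n₂ w₁ w₂ a k p q ∈ M₃.gr (a + n₁ + n₂) := by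
    intro d
    induction d with
    | zero =>
      intro k p q h
      rw [hN a k p q (by omega)]
      exact zero_mem _
    | succ d ih =>
      intro k p q h
      have hrec := nilpotentFamily_recursion h₁ h₂ h₃ hB hw₁ hw₂ a k p q
      rw [sub_sub, eq_sub_iff_add_eq] at hrec
      have hT : (M₃.L 𝒱 0 - (a + n₁ + n₂) • 1) (nilpotentFamily 𝒱 B n₁ n₂ w₁ w₂ a k p q) ∈
          M₃.gr (a + n₁ + n₂) := by
        rw [← hrec]
        exact add_mem (Submodule.smul_mem _ _ (ih _ _ _ (by omega)))
          (add_mem (ih _ _ _ (by omega)) (ih _ _ _ (by omega)))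
      rw [h₃.gr_eq_maxGenEigenspace, Module.End.mem_maxGenEigenspace] at hT ⊢
      obtain ⟨j, hj⟩ := hT
      refine ⟨j + 1, ?_⟩
      rw [pow_succ, Module.End.mul_apply]
      exact hj
  exact key (3 * N) k p q (by omega)

/-- An intertwining operator is determined by its value at `z` through conjugation with powers of `x`:
`𝒴(w₁, x) w₂ = x ^ L(0) e ^ (-(log z) L(0)) 𝒴(x ^ (-L(0)) e ^ ((log z) L(0)) w₁, z)
x ^ (-L(0)) e ^ ((log z) L(0)) w₂`, in components. -/
theorem intertwining_coeff_eq (h₁ : IsTwistedModule 𝒱 k₁ M₁) (h₂ : IsTwistedModule 𝒱 k₂ M₂)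
    (h₃ : IsTwistedModule 𝒱 k₃ M₃)
    (hB : IntertwiningAxioms 𝒱 (W₁ := M₁) (W₂ := M₂) (W₃ := M₃) fun w₁ w₂ => B w₁ w₂)
    (hlog : ∀ w₁ w₂, LogBounded (B w₁ w₂))
    {n₁ n₂ : ℂ} {w₁ : M₁.carrier} {w₂ : M₂.carrier} (hw₁ : w₁ ∈ M₁.gr n₁)
    (hw₂ : w₂ ∈ M₂.gr n₂) (z a : ℂ) (k : ℕ) : ∃ J₀ : ℕ, ∀ J, J₀ ≤ J →
    B w₁ w₂ a k = ∑ i ∈ Finset.range J, ∑ j ∈ Finset.range J, ∑ l ∈ Finset.range J,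
      (Complex.exp (-a * logBranch 0 z) * (-1) ^ (j + l) /
        ((i.factorial : ℂ) * j.factorial * l.factorial) *
        ((Polynomial.X - Polynomial.C (logBranch 0 z)) ^ (i + j + l)).coeff k) •
      ((M₃.L 𝒱 0 - (a + n₁ + n₂) • 1) ^ i) (evalComp M₃.gr
        (B (((M₁.L 𝒱 0 - n₁ • 1) ^ j) w₁) (((M₂.L 𝒱 0 - n₂ • 1) ^ l) w₂)) 0 z (a + n₁ + n₂)) := by
  obtain ⟨N, hN⟩ := exists_bound_nilpotentFamily h₁ h₂ hlog hw₁ hw₂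
  have hmem := nilpotentFamily_mem h₁ h₂ h₃ hB hlog hw₁ hw₂
  -- a uniform bound for the nilpotency of `L(0)` on the finitely many nonzero coefficients
  have hT : ∀ k p q, ∃ K : ℕ, ((M₃.L 𝒱 0 - (a + n₁ + n₂) • 1) ^ K)
      (nilpotentFamily 𝒱 B n₁ n₂ w₁ w₂ a k p q) = 0 := fun k p q => by
    obtain ⟨K, -, hK⟩ := h₃.L0_grading _ _ (hmem a k p q)
    exact ⟨K, hK⟩
  choose K hK using hT
  set S := (Finset.range N ×ˢ Finset.range N ×ˢ Finset.range N).sup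
    fun c => K c.1 c.2.1 c.2.2 with hS
  have hT' : ∀ i k p q, max N S ≤ i → ((M₃.L 𝒱 0 - (a + n₁ + n₂) • 1) ^ i)
      (nilpotentFamily 𝒱 B n₁ n₂ w₁ w₂ a k p q) = 0 := by
    intro i k p q hi
    by_cases h : N ≤ k ∨ N ≤ p ∨ N ≤ q
    · rw [hN a k p q h, map_zero]
    · have h1 : K k p q ≤ S := Finset.le_sup (f := fun c : ℕ × ℕ × ℕ => K c.1 c.2.1 c.2.2)
        (b := (k, p, q)) (by simp; omega)
      obtain ⟨j, rfl⟩ := Nat.exists_eq_add_of_le (h1.trans ((le_max_right N S).trans hi))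
      rw [add_comm (K k p q) j, pow_add, Module.End.mul_apply, hK, map_zero]
  refine ⟨3 * max N S, fun J hJ => ?_⟩
  have key := taylor_of_family_recursion (y := nilpotentFamily 𝒱 B n₁ n₂ w₁ w₂ a) (N := max N S)
    (nilpotentFamily_recursion h₁ h₂ h₃ hB hw₁ hw₂ a)
    (fun k p q h => hN a k p q (Or.inl ((le_max_left N S).trans h)))
    (fun k p q h => hN a k p q (Or.inr (Or.inl ((le_max_left N S).trans h))))
    (fun k p q h => hN a k p q (Or.inr (Or.inr ((le_max_left N S).trans h)))) hT'
    (logBranch 0 z) k hJ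
  have hval : ∀ j l, evalComp M₃.gr
      (B (((M₁.L 𝒱 0 - n₁ • 1) ^ j) w₁) (((M₂.L 𝒱 0 - n₂ • 1) ^ l) w₂)) 0 z (a + n₁ + n₂) =
      Complex.exp (a * logBranch 0 z) • ∑ m ∈ Finset.range J, logBranch 0 z ^ m •
        nilpotentFamily 𝒱 B n₁ n₂ w₁ w₂ a m j l := by
    intro j l
    rw [evalComp_of_single (a := a), finsum_eq_sum_of_support_subset (s := Finset.range J)]
    · congr 1
      refine Finset.sum_congr rfl fun m _ => ?_
      congr 1
      exact gradedProj_of_mem h₃.internal (hmem a m j l)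
    · intro m hm
      by_contra hm'
      refine hm ?_
      have h1 : N ≤ m := by
        have := le_max_left N S
        simp only [Finset.coe_range, Set.mem_Iio, not_lt] at hm'
        omega
      have h2 : B (((M₁.L 𝒱 0 - n₁ • 1) ^ j) w₁) (((M₂.L 𝒱 0 - n₂ • 1) ^ l) w₂) a m = 0 :=
        hN a m j l (Or.inl h1)
      simp only [h2, map_zero, smul_zero]
    · intro b m hb
      exact gradedProj_of_mem_ne _ (fun h => hb (by linear_combination h)) (hmem b m j l)
  have hzero : B w₁ w₂ a k = nilpotentFamily 𝒱 B n₁ n₂ w₁ w₂ a k 0 0 := rfl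
  rw [hzero, key]
  refine Finset.sum_congr rfl fun i _ => Finset.sum_congr rfl fun j _ =>
    Finset.sum_congr rfl fun l _ => ?_
  rw [hval, map_smul, smul_smul]
  congr 1
  have hexp : Complex.exp (-a * logBranch 0 z) * Complex.exp (a * logBranch 0 z) = 1 := by
    rw [← Complex.exp_add, neg_mul, neg_add_cancel, Complex.exp_zero]
  linear_combination (-((-1) ^ (j + l) / ((i.factorial : ℂ) * j.factorial * l.factorial) *
        ((Polynomial.X - Polynomial.C (logBranch 0 z)) ^ (i + j + l)).coeff k)) * hexp

end LogExpansion

/-! ### Sums of multivalued analytic functions -/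

section Continuation

variable {k : ℕ} {p q : Fin k → ℂ} {Ω : Set (Fin k → ℂ)} {φ φ' ψ ψ' : (Fin k → ℂ) → ℂ}

/-- An analytic germ vanishes at all points near its base point or at none of them. -/
theorem AnalyticAt.eventually_eventuallyEq_zero_iff (h : AnalyticAt ℂ φ p) :
    ∀ᶠ x in 𝓝 p, (φ =ᶠ[𝓝 x] 0 ↔ φ =ᶠ[𝓝 p] 0) := by
  obtain ⟨r, hr, hball⟩ := Metric.eventually_nhds_iff_ball.1 h.eventually_analyticAt
  have hpre : IsPreconnected (Metric.ball p r) := (convex_ball p r).isPreconnected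
  have key : ∀ x ∈ Metric.ball p r, ∀ y ∈ Metric.ball p r, φ =ᶠ[𝓝 x] 0 → φ =ᶠ[𝓝 y] 0 := by
    intro x hx y hy h0
    have h1 := AnalyticOnNhd.eqOn_zero_of_preconnected_of_eventuallyEq_zero hball hpre hx h0
    filter_upwards [Metric.isOpen_ball.mem_nhds hy] with w hw using h1 hw
  filter_upwards [Metric.ball_mem_nhds p hr] with x hx
  exact ⟨key x hx p (Metric.mem_ball_self hr), key p (Metric.mem_ball_self hr) x hx⟩

/-- Analytic continuation along a path is unique. -/
theorem ContinuesAlong.unique {γ : Path p q} (h : ContinuesAlong γ φ ψ)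
    (h' : ContinuesAlong γ φ' ψ') (hφ : φ =ᶠ[𝓝 p] φ') : ψ =ᶠ[𝓝 q] ψ' := by
  obtain ⟨Φ, hΦ, hΦ0, hΦ1, hΦt⟩ := h
  obtain ⟨Ψ, hΨ, hΨ0, hΨ1, hΨt⟩ := h'
  have hloc : IsLocallyConstant fun t => Φ t - Ψ t =ᶠ[𝓝 (γ t)] 0 := by
    rw [IsLocallyConstant.iff_eventually_eq]
    intro t
    filter_upwards [hΦt t, hΨt t, γ.continuous.continuousAt.eventually
      ((hΦ t).sub (hΨ t)).eventually_eventuallyEq_zero_iff] with s h1 h2 h3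
    rw [eq_iff_iff, ← h3]
    constructor
    · exact fun h => ((h1.sub h2).symm.trans h)
    · exact fun h => ((h1.sub h2).trans h)
  have h01 : (Φ 0 - Ψ 0 =ᶠ[𝓝 (γ 0)] 0) = (Φ 1 - Ψ 1 =ᶠ[𝓝 (γ 1)] 0) :=
    hloc.apply_eq_of_isPreconnected isPreconnected_univ (Set.mem_univ _) (Set.mem_univ _)
  rw [γ.source, γ.target] at h01
  have h0 : Φ 0 - Ψ 0 =ᶠ[𝓝 p] 0 := by
    filter_upwards [hΦ0, hΨ0, hφ] with x h1 h2 h3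
    simp [h1, h2, h3]
  rw [h01] at h0
  filter_upwards [h0, hΦ1, hΨ1] with x h1 h2 h3
  rw [← h2, ← h3]
  exact sub_eq_zero.1 h1

theorem ContinuesAlong.add {γ : Path p q} (h : ContinuesAlong γ φ ψ)
    (h' : ContinuesAlong γ φ' ψ') : ContinuesAlong γ (φ + φ') (ψ + ψ') := by
  obtain ⟨Φ, hΦ, hΦ0, hΦ1, hΦt⟩ := h
  obtain ⟨Ψ, hΨ, hΨ0, hΨ1, hΨt⟩ := h'
  refine ⟨Φ + Ψ, fun t => (hΦ t).add (hΨ t), hΦ0.add hΨ0, hΦ1.add hΨ1, fun t => ?_⟩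
  filter_upwards [hΦt t, hΨt t] with s h1 h2 using h1.add h2

theorem continuesAlong_zero (γ : Path p q) : ContinuesAlong γ 0 0 :=
  ⟨0, fun _ => analyticAt_const, Filter.EventuallyEq.rfl, Filter.EventuallyEq.rfl,
    fun _ => Filter.Eventually.of_forall fun _ => Filter.EventuallyEq.rfl⟩

theorem ExtendsOn.add (h : ExtendsOn Ω p φ) (h' : ExtendsOn Ω p φ') :
    ExtendsOn Ω p (φ + φ') := fun q γ hγ => by
  obtain ⟨ψ, hψ⟩ := h q γ hγ
  obtain ⟨ψ', hψ'⟩ := h' q γ hγ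
  exact ⟨ψ + ψ', hψ.add hψ'⟩

theorem extendsOn_zero : ExtendsOn Ω p 0 := fun _ γ _ => ⟨0, continuesAlong_zero γ⟩

theorem IsPreferredBranch.add {f f' : (Fin 2 → ℂ) → ℂ} (h : IsPreferredBranch f)
    (h' : IsPreferredBranch f') : IsPreferredBranch (f + f') := fun p hp => by
  obtain ⟨φ, hφ, hf, hext⟩ := h p hp
  obtain ⟨φ', hφ', hf', hext'⟩ := h' p hp
  refine ⟨φ + φ', hφ.add hφ', ?_, hext.add hext'⟩
  filter_upwards [hf, hf'] with q h1 h2 h3 h4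
  rw [Pi.add_apply, Pi.add_apply, h1 h3 h4, h2 h3 h4]

theorem isPreferredBranch_zero : IsPreferredBranch 0 := fun _ _ =>
  ⟨0, analyticAt_const, Filter.Eventually.of_forall fun _ _ _ => rfl, extendsOn_zero⟩

theorem IsPreferredBranch.sum {ι : Type*} (s : Finset ι) {f : ι → (Fin 2 → ℂ) → ℂ}
    (h : ∀ i, IsPreferredBranch (f i)) : IsPreferredBranch (∑ i ∈ s, f i) :=
  Finset.sum_induction f IsPreferredBranch (fun _ _ => IsPreferredBranch.add)
    isPreferredBranch_zero fun i _ => h i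

theorem isOpen_polyPunctured (δ : Fin k → Bool) (r : Fin k → ℝ) :
    IsOpen (polyPunctured δ r) := by
  rw [show polyPunctured δ r = ⋂ i, {ζ : Fin k → ℂ | if δ i then r i < ‖ζ i‖ else
    0 < ‖ζ i‖ ∧ ‖ζ i‖ < r i} by ext; simp [polyPunctured]]
  refine isOpen_iInter_of_finite fun i => ?_
  have hc : Continuous fun ζ : Fin k → ℂ => ‖ζ i‖ := by fun_prop
  by_cases hi : δ i
  · simpa [hi] using isOpen_lt continuous_const hc
  · simp only [hi, Bool.false_eq_true, if_false]
    exact (isOpen_lt continuous_const hc).inter (isOpen_lt hc continuous_const)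

/-- The sum of two multivalued functions with regular singularities has regular singularities: by
uniqueness of continuation, every branch of the sum is the sum of two branches. -/
theorem HasRegularSingularities.add (hext : ExtendsOn Ω p φ) (hext' : ExtendsOn Ω p φ')
    (h : HasRegularSingularities Ω p φ) (h' : HasRegularSingularities Ω p φ') :
    HasRegularSingularities Ω p (φ + φ') := by
  classical
  intro A β δ zOf hiso
  obtain ⟨r₁, hr₁, hΩ₁, K₁, R₁, H₁⟩ := h A β δ hiso
  obtain ⟨r₂, hr₂, hΩ₂, K₂, R₂, H₂⟩ := h' A β δ hiso
  have hsub₁ : polyPunctured δ (fun i => if δ i then max (r₁ i) (r₂ i) else min (r₁ i) (r₂ i)) ⊆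
      polyPunctured δ r₁ := by
    intro ζ hζ i
    have h1 := hζ i
    by_cases hi : δ i
    · simp only [hi, if_true, max_lt_iff] at h1 ⊢
      exact h1.1
    · simp only [hi, Bool.false_eq_true, if_false, lt_min_iff] at h1 ⊢
      exact ⟨h1.1, h1.2.1⟩
  have hsub₂ : polyPunctured δ (fun i => if δ i then max (r₁ i) (r₂ i) else min (r₁ i) (r₂ i)) ⊆
      polyPunctured δ r₂ := by
    intro ζ hζ i
    have h1 := hζ i
    by_cases hi : δ i
    · simp only [hi, if_true, max_lt_iff] at h1 ⊢
      exact h1.2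
    · simp only [hi, Bool.false_eq_true, if_false, lt_min_iff] at h1 ⊢
      exact ⟨h1.1, h1.2.2⟩
  refine ⟨fun i => if δ i then max (r₁ i) (r₂ i) else min (r₁ i) (r₂ i), fun i => ?_,
    fun ζ hζ => hΩ₁ ζ (hsub₁ hζ), max K₁ K₂, fun i => R₁ i ∪ R₂ i, ?_⟩
  · dsimp only
    split_ifs
    · exact (hr₁ i).trans_le (le_max_left _ _)
    · exact lt_min (hr₁ i) (hr₂ i)
  intro ζ₀ hζ₀ γ ψ hγ hψ
  obtain ⟨ψ₁, hψ₁⟩ := hext _ γ hγ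
  obtain ⟨ψ₂, hψ₂⟩ := hext' _ γ hγ
  obtain ⟨α₁, hα₁, hs₁, he₁⟩ := H₁ ζ₀ (hsub₁ hζ₀) γ ψ₁ hγ hψ₁
  obtain ⟨α₂, hα₂, hs₂, he₂⟩ := H₂ ζ₀ (hsub₂ hζ₀) γ ψ₂ hγ hψ₂
  have hψ₁₂ := hψ.unique (hψ₁.add hψ₂) Filter.EventuallyEq.rfl
  have hzOf : Continuous zOf := by
    refine continuous_pi fun i => ?_
    simp only [zOf, Matrix.vecMul, dotProduct]
    fun_prop
  refine ⟨α₁ + α₂, fun a j hne i => ?_, fun ζ hζ => ?_, ?_⟩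
  · by_cases h1 : α₁ a j = 0
    · have h2 : α₂ a j ≠ 0 := fun h2 => hne (by simp [h1, h2])
      obtain ⟨hj, b, hb, m, hm⟩ := hα₂ a j h2 i
      exact ⟨hj.trans (le_max_right _ _), b, Finset.mem_union_right _ hb, m, hm⟩
    · obtain ⟨hj, b, hb, m, hm⟩ := hα₁ a j h1 i
      exact ⟨hj.trans (le_max_left _ _), b, Finset.mem_union_left _ hb, m, hm⟩
  · simp only [Pi.add_apply, add_mul]
    exact (hs₁ ζ (hsub₁ hζ)).add (hs₂ ζ (hsub₂ hζ))
  · filter_upwards [he₁, he₂, hzOf.continuousAt.eventually hψ₁₂,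
      (isOpen_polyPunctured δ _).mem_nhds hζ₀] with ζ h1 h2 h3 h4 hsheet
    simp only [Pi.add_apply, add_mul]
    rw [(hs₁ ζ (hsub₁ h4)).tsum_add (hs₂ ζ (hsub₂ h4)), ← h1 hsheet, ← h2 hsheet]
    exact h3

theorem hasRegularSingularities_zero : HasRegularSingularities Ω p 0 := by
  intro A β δ zOf hiso
  obtain ⟨r, hr, hΩ⟩ := hiso
  refine ⟨r, hr, hΩ, 0, fun _ => ∅, fun ζ₀ hζ₀ γ ψ hγ hψ =>
    ⟨0, fun a j h => absurd rfl h, fun ζ _ => by simp, ?_⟩⟩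
  have hzOf : Continuous zOf := by
    refine continuous_pi fun i => ?_
    simp only [zOf, Matrix.vecMul, dotProduct]
    fun_prop
  filter_upwards [hzOf.continuousAt.eventually
    (hψ.unique (continuesAlong_zero γ) Filter.EventuallyEq.rfl)] with ζ h1 _
  simpa using h1

/-- The germ of `φ` at `p` generates a multivalued analytic function on `Ω` with regular
singularities. -/
structure IsRegularGerm (Ω : Set (Fin k → ℂ)) (p : Fin k → ℂ) (φ : (Fin k → ℂ) → ℂ) : Prop where
  analyticAt : AnalyticAt ℂ φ p
  extendsOn : ExtendsOn Ω p φ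
  regular : HasRegularSingularities Ω p φ

theorem IsRegularGerm.sum {ι : Type*} (s : Finset ι) {f : ι → (Fin k → ℂ) → ℂ}
    (h : ∀ i, IsRegularGerm Ω p (f i)) : IsRegularGerm Ω p (∑ i ∈ s, f i) :=
  Finset.sum_induction f (IsRegularGerm Ω p)
    (fun _ _ h h' => ⟨h.1.add h'.1, h.2.add h'.2, h.3.add h.2 h'.2 h'.3⟩)
    ⟨analyticAt_const, extendsOn_zero, hasRegularSingularities_zero⟩ fun i _ => h i

end Continuation

/-! ### Functionals attached to intertwining operators -/

section Families

variable {V : Type v} [AddCommGroup V] [Module ℂ V] {𝒱 : VOA V} {k k' g g' : 𝒱.Aut}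
  {Obj : ModuleData.{u} V → Prop} {z : ℂ} {W₁ W₂ : ModuleData.{u} V}

/-- The functional `λ_{I, φ}` exists for every `φ`. -/
theorem exists_isProductFunctional {M : ModuleData.{u} V}
    {B : W₁.carrier →ₗ[ℂ] W₂.carrier →ₗ[ℂ] LogSeries M.carrier}
    (hB : ∀ w₁ w₂, B w₁ w₂ ∈ evaluableSeries M.gr) (z : ℂ) (φ : M.Dual) :
    ∃ μ, IsProductFunctional z (fun w₁ w₂ => B w₁ w₂) φ μ := by
  refine ⟨TensorProduct.lift (LinearMap.mk₂ ℂ (fun w₁ w₂ => pairEval φ (B w₁ w₂) 0 z)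
    (fun a b c => ?_) (fun r a b => ?_) (fun a b c => ?_) fun r a b => ?_), fun w₁ w₂ => ?_⟩
  · rw [map_add, LinearMap.add_apply, pairEval_add_right φ (hB _ _) (hB _ _)]
  · rw [map_smul, LinearMap.smul_apply, pairEval_smul_right, smul_eq_mul]
  · rw [map_add, pairEval_add_right φ (hB _ _) (hB _ _)]
  · rw [map_smul, pairEval_smul_right, smul_eq_mul]
  · rw [TensorProduct.lift.tmul, LinearMap.mk₂_apply]

theorem IsProductFunctional.mem_boxSpace {M : ModuleData.{u} V} (hM : Obj M)
    {𝒴 : W₁.carrier → W₂.carrier → LogSeries M.carrier}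
    (h𝒴 : IsTwistedIntertwiningOperator 𝒱 𝒴) {φ : M.Dual}
    {μ : Module.Dual ℂ (W₁.carrier ⊗[ℂ] W₂.carrier)} (hμ : IsProductFunctional z 𝒴 φ μ) :
    μ ∈ boxSpace 𝒱 Obj z W₁ W₂ :=
  Submodule.subset_span ⟨M, hM, 𝒴, h𝒴, φ, hμ⟩

theorem IsTwistedIntertwiningOperator.exists_boxSpace {M : ModuleData.{u} V} (hM : Obj M)
    {B : W₁.carrier →ₗ[ℂ] W₂.carrier →ₗ[ℂ] LogSeries M.carrier}
    (hB : IsTwistedIntertwiningOperator 𝒱 (W₁ := W₁) (W₂ := W₂) (W₃ := M) fun w₁ w₂ => B w₁ w₂)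
    (z : ℂ) (φ : M.Dual) : ∃ μ : boxSpace 𝒱 Obj z W₁ W₂,
      IsProductFunctional z (fun w₁ w₂ => B w₁ w₂) φ μ.1 := by
  obtain ⟨μ, hμ⟩ := exists_isProductFunctional (B := B)
    (fun w₁ w₂ => hB.axioms.mem_evaluableSeries w₁ w₂) z φ
  exact ⟨⟨μ, hμ.mem_boxSpace hM hB⟩, hμ⟩

/-- The vertex operator map of `W₁ ⊠̃ W₂` satisfies its defining formula.  If no map did, the space
would carry the zero map, and by the identity property it would be zero. -/
theorem isBoxMap_boxModule (hbox : IsTwistedModule 𝒱 k' (boxModule 𝒱 Obj z W₁ W₂)) :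
    IsBoxMap 𝒱 Obj z W₁ W₂ (boxModule 𝒱 Obj z W₁ W₂).Y := by
  classical
  by_cases h : ∃ Y, IsBoxMap 𝒱 Obj z W₁ W₂ Y
  · have : (boxModule 𝒱 Obj z W₁ W₂).Y = h.choose := by
      unfold boxModule
      simp only [dif_pos h]
    rw [this]
    exact h.choose_spec
  · have hY : (boxModule 𝒱 Obj z W₁ W₂).Y = 0 := by
      unfold boxModule
      simp only [dif_neg h]
    have h0 : ∀ x : (boxModule 𝒱 Obj z W₁ W₂).carrier, x = 0 := by
      intro x
      have h1 := hbox.identity x 0 0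
      rw [hY, if_pos (And.intro rfl rfl)] at h1
      exact h1.symm
    refine absurd ⟨0, fun M hM 𝒴 h𝒴 φ μ hμ v a k => ?_⟩ h
    obtain ⟨B, hB⟩ := h𝒴.axioms.linear
    obtain rfl : 𝒴 = fun w₁ w₂ => B w₁ w₂ := funext fun w₁ => funext fun w₂ => hB w₁ w₂
    obtain ⟨ν, hν⟩ := h𝒴.exists_boxSpace hM z ((M.contragredient 𝒱).Y v φ a k)
    rw [show ν = 0 from h0 ν] at hν
    exact hν

/-- A finite family of intertwining operators out of `W₁ ⊗ W₂`. -/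
structure ProductFamily (𝒱 : VOA V) (Obj : ModuleData.{u} V → Prop) (W₁ W₂ : ModuleData.{u} V) where
  ι : Type
  [fintype : Fintype ι]
  M : ι → ModuleData.{u} V
  obj : ∀ i, Obj (M i)
  B : ∀ i, W₁.carrier →ₗ[ℂ] W₂.carrier →ₗ[ℂ] LogSeries (M i).carrier
  intertwining : ∀ i, IsTwistedIntertwiningOperator 𝒱 (W₁ := W₁) (W₂ := W₂) (W₃ := M i)
    fun w₁ w₂ => B i w₁ w₂

namespace ProductFamily

attribute [instance] ProductFamily.fintype

/-- The functional `μ` is the sum of the functionals given by the intertwining operators of the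
family and the elements `φ i` of the graded duals. -/
def Represents (F : ProductFamily 𝒱 Obj W₁ W₂) (z : ℂ)
    (μ : Module.Dual ℂ (W₁.carrier ⊗[ℂ] W₂.carrier))
    (φ : ∀ i, ((F.M i).contragredient 𝒱).carrier) : Prop :=
  ∀ w₁ w₂, μ (w₁ ⊗ₜ[ℂ] w₂) = ∑ i, pairEval (φ i : (F.M i).Dual) (F.B i w₁ w₂) 0 z

variable {F : ProductFamily 𝒱 Obj W₁ W₂}
  {μ ν : Module.Dual ℂ (W₁.carrier ⊗[ℂ] W₂.carrier)}
  {φ ψ : ∀ i, ((F.M i).contragredient 𝒱).carrier}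

theorem mem_evaluableSeries (F : ProductFamily 𝒱 Obj W₁ W₂) (i : F.ι) (w₁ : W₁.carrier)
    (w₂ : W₂.carrier) : F.B i w₁ w₂ ∈ evaluableSeries (F.M i).gr :=
  (F.intertwining i).axioms.mem_evaluableSeries w₁ w₂

theorem Represents.add (h : F.Represents z μ φ) (h' : F.Represents z ν ψ) :
    F.Represents z (μ + ν) (fun i => φ i + ψ i) := by
  intro w₁ w₂
  rw [LinearMap.add_apply, h, h', ← Finset.sum_add_distrib]
  exact Finset.sum_congr rfl fun i _ => (pairEval_add_left (gr := (F.M i).gr) _ _ _ _ _).symm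

theorem Represents.smul (r : ℂ) (h : F.Represents z μ φ) :
    F.Represents z (r • μ) (fun i => r • φ i) := by
  intro w₁ w₂
  rw [LinearMap.smul_apply, h, smul_eq_mul, Finset.mul_sum]
  exact Finset.sum_congr rfl fun i _ => (pairEval_smul_left (gr := (F.M i).gr) _ _ _ _ _).symm

theorem represents_zero (F : ProductFamily 𝒱 Obj W₁ W₂) (z : ℂ) :
    F.Represents z 0 (fun _ => 0) := by
  intro w₁ w₂
  rw [LinearMap.zero_apply]
  exact (Finset.sum_eq_zero fun i _ =>
    (pairEvalₗ (gr := (F.M i).gr) (F.B i w₁ w₂) 0 z).map_zero).symm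

theorem Represents.sum {α : Type*} (s : Finset α)
    {μ : α → Module.Dual ℂ (W₁.carrier ⊗[ℂ] W₂.carrier)}
    {φ : α → ∀ i, ((F.M i).contragredient 𝒱).carrier} (h : ∀ j ∈ s, F.Represents z (μ j) (φ j)) :
    F.Represents z (∑ j ∈ s, μ j) (fun i => ∑ j ∈ s, φ j i) := by
  classical
  induction s using Finset.induction_on with
  | empty => simpa using F.represents_zero z
  | insert a s ha ih =>
    simp only [Finset.sum_insert ha]
    exact (h a (Finset.mem_insert_self _ _)).add (ih fun j hj => h j (Finset.mem_insert_of_mem hj))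

theorem Represents.eq (h : F.Represents z μ φ) (h' : F.Represents z ν φ) : μ = ν :=
  TensorProduct.ext' fun w₁ w₂ => (h w₁ w₂).trans (h' w₁ w₂).symm

theorem Represents.of_forall {ν : F.ι → Module.Dual ℂ (W₁.carrier ⊗[ℂ] W₂.carrier)}
    (h : ∀ i, IsProductFunctional z (fun w₁ w₂ => F.B i w₁ w₂) (φ i : (F.M i).Dual) (ν i)) :
    F.Represents z (∑ i, ν i) φ := by
  intro w₁ w₂
  rw [LinearMap.sum_apply]
  exact Finset.sum_congr rfl fun i _ => h i w₁ w₂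

/-- The disjoint union of two families. -/
def append (F F' : ProductFamily 𝒱 Obj W₁ W₂) : ProductFamily 𝒱 Obj W₁ W₂ where
  ι := F.ι ⊕ F'.ι
  M := Sum.elim F.M F'.M
  obj := Sum.rec F.obj F'.obj
  B := Sum.rec F.B F'.B
  intertwining := Sum.rec F.intertwining F'.intertwining

theorem Represents.append {F' : ProductFamily 𝒱 Obj W₁ W₂}
    {ψ : ∀ i, ((F'.M i).contragredient 𝒱).carrier} (h : F.Represents z μ φ)
    (h' : F'.Represents z ν ψ) :
    (F.append F').Represents z (μ + ν) (fun i => Sum.rec φ ψ i) := by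
  intro w₁ w₂
  rw [LinearMap.add_apply, h, h']
  let χ : ∀ i, (((F.append F').M i).contragredient 𝒱).carrier := fun i => Sum.rec φ ψ i
  exact (Fintype.sum_sum_type fun i : F.ι ⊕ F'.ι =>
    pairEval (χ i : ((F.append F').M i).Dual) ((F.append F').B i w₁ w₂) 0 z).symm

/-- Every element of `W₁ ⊠̃ W₂` is represented by a finite family. -/
theorem exists_represents (hμ : μ ∈ boxSpace 𝒱 Obj z W₁ W₂) :
    ∃ (F : ProductFamily 𝒱 Obj W₁ W₂) (φ : ∀ i, ((F.M i).contragredient 𝒱).carrier),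
      F.Represents z μ φ := by
  induction hμ using Submodule.span_induction with
  | mem μ h =>
    obtain ⟨M, hM, 𝒴, h𝒴, φ, hφ⟩ := h
    obtain ⟨B, hB⟩ := h𝒴.axioms.linear
    obtain rfl : 𝒴 = fun w₁ w₂ => B w₁ w₂ := funext fun w₁ => funext fun w₂ => hB w₁ w₂
    refine ⟨⟨Unit, fun _ => M, fun _ => hM, fun _ => B, fun _ => h𝒴⟩, fun _ => φ,
      fun w₁ w₂ => ?_⟩
    rw [hφ w₁ w₂]
    simp
  | zero =>
    exact ⟨⟨Empty, Empty.elim, Empty.rec, Empty.rec, Empty.rec⟩, _, represents_zero _ z⟩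
  | add μ ν _ _ h h' =>
    obtain ⟨F, φ, h⟩ := h
    obtain ⟨F', ψ, h'⟩ := h'
    exact ⟨F.append F', _, h.append h'⟩
  | smul r μ _ h =>
    obtain ⟨F, φ, h⟩ := h
    exact ⟨F, _, h.smul r⟩

/-- Vertex operators on `W₁ ⊠̃ W₂` act on representations. -/
theorem Represents.boxModule_Y (hbox : IsTwistedModule 𝒱 k' (boxModule 𝒱 Obj z W₁ W₂))
    {μ : boxSpace 𝒱 Obj z W₁ W₂} (h : F.Represents z μ.1 φ) (v : V) (a : ℂ) (k : ℕ) :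
    F.Represents z ((boxModule 𝒱 Obj z W₁ W₂).Y v μ a k : boxSpace 𝒱 Obj z W₁ W₂).1
      (fun i => ((F.M i).contragredient 𝒱).Y v (φ i) a k) := by
  choose ν hν using fun i => (F.intertwining i).exists_boxSpace (F.obj i) z (φ i : (F.M i).Dual)
  have h1 : μ = ∑ i, ν i := by
    refine Subtype.ext (h.eq ?_)
    rw [AddSubmonoidClass.coe_finsetSum]
    exact Represents.of_forall hν
  have h2 : (boxModule 𝒱 Obj z W₁ W₂).coeffY v a k μ =
      ∑ i, (boxModule 𝒱 Obj z W₁ W₂).coeffY v a k (ν i) := by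
    rw [h1]
    exact map_sum ((boxModule 𝒱 Obj z W₁ W₂).coeffY v a k) _ _
  have h3 : ((boxModule 𝒱 Obj z W₁ W₂).coeffY v a k μ : boxSpace 𝒱 Obj z W₁ W₂).1 =
      ∑ i, ((boxModule 𝒱 Obj z W₁ W₂).coeffY v a k (ν i) : boxSpace 𝒱 Obj z W₁ W₂).1 := by
    rw [h2]
    exact map_sum (boxSpace 𝒱 Obj z W₁ W₂).subtype _ _
  suffices h4 : F.Represents z
      ((boxModule 𝒱 Obj z W₁ W₂).coeffY v a k μ : boxSpace 𝒱 Obj z W₁ W₂).1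
      (fun i => ((F.M i).contragredient 𝒱).Y v (φ i) a k) from h4
  rw [h3]
  exact Represents.of_forall fun i =>
    isBoxMap_boxModule hbox _ (F.obj i) _ (F.intertwining i) _ (ν i) (hν i) v a k

/-- Projections of `W₁ ⊠̃ W₂` act on representations. -/
theorem Represents.boxModule_gradedProj (hO : ∀ M, Obj M → IsTwistedModule 𝒱 k M)
    (hbox : IsTwistedModule 𝒱 k' (boxModule 𝒱 Obj z W₁ W₂))
    {μ : boxSpace 𝒱 Obj z W₁ W₂} (h : F.Represents z μ.1 φ) (n : ℂ) :
    F.Represents z (gradedProj (boxGr 𝒱 Obj z W₁ W₂) n μ).1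
      (fun i => (dualProj (F.M i).gr n (φ i : (F.M i).Dual).1 : (F.M i).Dual)) := by
  classical
  choose ν hν using fun i m => (F.intertwining i).exists_boxSpace (F.obj i) z
    (dualProj (F.M i).gr m (φ i : (F.M i).Dual).1)
  have hνmem : ∀ i m, ν i m ∈ boxGr 𝒱 Obj z W₁ W₂ m := fun i m =>
    Submodule.subset_span ⟨F.M i, F.obj i, _, F.intertwining i, _, dualProj_mem m _, hν i m⟩
  choose S hS hS' using fun i => exists_sum_dualProj (hO _ (F.obj i)).internal (φ i : (F.M i).Dual)
  have hsum : ∀ i, ∑ m ∈ Finset.univ.biUnion S, dualProj (F.M i).gr m (φ i : (F.M i).Dual).1 =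
      φ i := fun i => by
    rw [← Finset.sum_subset (Finset.subset_biUnion_of_mem S (Finset.mem_univ i))
      fun m _ hm => hS i m hm]
    exact hS' i
  have hrep : ∀ m, F.Represents z (∑ i, ν i m).1
      (fun i => (dualProj (F.M i).gr m (φ i : (F.M i).Dual).1 : (F.M i).Dual)) := fun m => by
    rw [AddSubmonoidClass.coe_finsetSum]
    exact Represents.of_forall fun i => hν i m
  have hμ : μ = ∑ m ∈ Finset.univ.biUnion S, ∑ i, ν i m := by
    refine Subtype.ext (h.eq ?_)
    rw [AddSubmonoidClass.coe_finsetSum]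
    have := Represents.sum (Finset.univ.biUnion S) fun m _ => hrep m
    convert this using 2 with i
    exact (hsum i).symm
  have hproj : gradedProj (boxGr 𝒱 Obj z W₁ W₂) n μ = ∑ i, ν i n := by
    rw [hμ, map_sum]
    have hm : ∀ m, ∑ i, ν i m ∈ boxGr 𝒱 Obj z W₁ W₂ m := fun m => sum_mem fun i _ => hνmem i m
    rw [Finset.sum_eq_single n]
    · exact gradedProj_of_mem hbox.internal (hm n)
    · exact fun m _ hne => gradedProj_of_mem_ne _ hne (hm m)
    · intro hn
      have h0 : ∑ i, ν i n = 0 := by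
        refine Subtype.ext ((hrep n).eq ?_)
        rw [show (fun i => (dualProj (F.M i).gr n (φ i : (F.M i).Dual).1 : (F.M i).Dual)) =
          fun _ => 0 from funext fun i => hS i n fun hc =>
            hn (Finset.mem_biUnion.2 ⟨i, Finset.mem_univ i, hc⟩)]
        exact F.represents_zero z
      rw [h0, map_zero]
  rw [hproj]
  exact hrep n

end ProductFamily

end Families

/-! ### Comparison of the contragredient with the modules of a family -/

section Comparison

variable {V : Type v} [AddCommGroup V] [Module ℂ V] {𝒱 : VOA V}
  {Obj : ModuleData.{u} V → Prop} {z : ℂ} {W₁ W₂ W : ModuleData.{u} V}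
  {f : W.carrier →ₗ[ℂ] (boxModule 𝒱 Obj z W₁ W₂).carrier}

/-- A map `f : W → W₁ ⊠̃ W₂` of twisted modules, together with the properties of the modules involved
that a category of twisted modules provides. -/
structure IsBoxModuleMap (𝒱 : VOA V) (Obj : ModuleData.{u} V → Prop) (z : ℂ)
    (W₁ W₂ W : ModuleData.{u} V) (f : W.carrier →ₗ[ℂ] (boxModule 𝒱 Obj z W₁ W₂).carrier) :
    Prop where
  left : ∃ g, IsTwistedModule 𝒱 g W₁
  right : ∃ g, IsTwistedModule 𝒱 g W₂
  obj : ∃ g, ∀ M, Obj M → IsTwistedModule 𝒱 g M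
  obj_contragredient : ∃ g, ∀ M, Obj M → IsTwistedModule 𝒱 g (M.contragredient 𝒱)
  box : ∃ g, IsTwistedModule 𝒱 g (boxModule 𝒱 Obj z W₁ W₂)
  source : ∃ g, IsTwistedModule 𝒱 g W
  source_contragredient : ∃ g, IsTwistedModule 𝒱 g (W.contragredient 𝒱)
  finiteDimensional : ∀ n, FiniteDimensional ℂ (W.gr n)
  isModuleMap : ModuleData.IsModuleMap f

theorem IsBoxModuleMap.map_L_zero (hf : IsBoxModuleMap 𝒱 Obj z W₁ W₂ W f) (w : W.carrier) :
    f (W.L 𝒱 0 w) = (boxModule 𝒱 Obj z W₁ W₂).L 𝒱 0 (f w) := by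
  rw [ModuleData.L_apply, ModuleData.L_apply]
  exact hf.isModuleMap _ _ _ _

theorem IsBoxModuleMap.map_gradedProj (hf : IsBoxModuleMap 𝒱 Obj z W₁ W₂ W f) (n : ℂ)
    (w : W.carrier) :
    f (gradedProj W.gr n w) = gradedProj (boxModule 𝒱 Obj z W₁ W₂).gr n (f w) := by
  obtain ⟨g, hW⟩ := hf.source
  obtain ⟨g', hbox⟩ := hf.box
  refine (gradedProj_map hW.internal hbox.internal f (fun n x hx => ?_) n w).symm
  have hpow : ∀ (j : ℕ) w, f (((W.L 𝒱 0 - n • 1) ^ j) w) =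
      (((boxModule 𝒱 Obj z W₁ W₂).L 𝒱 0 - n • 1) ^ j) (f w) := by
    intro j
    induction j with
    | zero => simp
    | succ j ih =>
      intro w
      rw [pow_succ', pow_succ', Module.End.mul_apply, Module.End.mul_apply, ← ih]
      simp [hf.map_L_zero]
  rw [hW.gr_eq_maxGenEigenspace, Module.End.mem_maxGenEigenspace] at hx
  rw [hbox.gr_eq_maxGenEigenspace, Module.End.mem_maxGenEigenspace]
  obtain ⟨j, hj⟩ := hx
  exact ⟨j, by rw [← hpow, hj, map_zero]⟩

namespace ProductFamily

/-- The vector `x` of `W'` and the vectors `y i` of the modules of the family have equal pairings: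
`⟨w, x⟩ = ∑ ⟨φ i, y i⟩` whenever `φ` represents `f w`. -/
def Compatible (F : ProductFamily 𝒱 Obj W₁ W₂)
    (f : W.carrier →ₗ[ℂ] (boxModule 𝒱 Obj z W₁ W₂).carrier)
    (x : (W.contragredient 𝒱).carrier) (y : ∀ i, (F.M i).carrier) : Prop :=
  ∀ (w : W.carrier) (φ : ∀ i, ((F.M i).contragredient 𝒱).carrier),
    F.Represents z (f w : boxSpace 𝒱 Obj z W₁ W₂).1 φ →
      W.ev 𝒱 w x = ∑ i, (F.M i).ev 𝒱 (y i) (φ i)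

variable {F : ProductFamily 𝒱 Obj W₁ W₂} {x x' : (W.contragredient 𝒱).carrier}
  {y y' : ∀ i, (F.M i).carrier}

theorem Compatible.add (h : F.Compatible f x y) (h' : F.Compatible f x' y') :
    F.Compatible f (x + x') (fun i => y i + y' i) := by
  intro w φ hφ
  rw [map_add, h w φ hφ, h' w φ hφ, ← Finset.sum_add_distrib]
  exact Finset.sum_congr rfl fun i _ => (ModuleData.ev_add _ _ _).symm

theorem Compatible.smul (r : ℂ) (h : F.Compatible f x y) :
    F.Compatible f (r • x) (fun i => r • y i) := by
  intro w φ hφ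
  rw [map_smul, h w φ hφ, smul_eq_mul, Finset.mul_sum]
  exact Finset.sum_congr rfl fun i _ => (map_smul (φ i : (F.M i).Dual).1 r (y i)).symm

theorem compatible_zero (F : ProductFamily 𝒱 Obj W₁ W₂)
    (f : W.carrier →ₗ[ℂ] (boxModule 𝒱 Obj z W₁ W₂).carrier) :
    F.Compatible f 0 (fun _ => 0) := by
  intro w φ _
  rw [map_zero]
  exact (Finset.sum_eq_zero fun i _ => ModuleData.ev_zero _).symm

theorem Compatible.sum {α : Type*} (s : Finset α) {x : α → (W.contragredient 𝒱).carrier}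
    {y : α → ∀ i, (F.M i).carrier} (h : ∀ j ∈ s, F.Compatible f (x j) (y j)) :
    F.Compatible f (∑ j ∈ s, x j) (fun i => ∑ j ∈ s, y j i) := by
  classical
  induction s using Finset.induction_on with
  | empty => simpa using F.compatible_zero f
  | insert a s ha ih =>
    simp only [Finset.sum_insert ha]
    exact (h a (Finset.mem_insert_self _ _)).add (ih fun j hj => h j (Finset.mem_insert_of_mem hj))

theorem Compatible.congr_right (h : F.Compatible f x y) (hy : ∀ i, y i = y' i) :
    F.Compatible f x y' := (funext hy : y = y') ▸ h

/-- Twisted vertex operators preserve compatibility: they are transposed to the contragredients, where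
`f` commutes with them, and transposed back. -/
theorem Compatible.coeffY (hf : IsBoxModuleMap 𝒱 Obj z W₁ W₂ W f) (h : F.Compatible f x y)
    (u : V) (b : ℂ) (l : ℕ) :
    F.Compatible f ((W.contragredient 𝒱).Y u x b l) (fun i => (F.M i).Y u (y i) b l) := by
  obtain ⟨g, hW'⟩ := hf.source_contragredient
  obtain ⟨g', hM'⟩ := hf.obj_contragredient
  obtain ⟨g'', hbox⟩ := hf.box
  refine graded_induction 𝒱.internal (p := fun u => F.Compatible f
    ((W.contragredient 𝒱).Y u x b l) (fun i => (F.M i).Y u (y i) b l))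
    (fun u u' hu hu' => ?_) (fun n u hu w φ hφ => ?_) ?_ u
  · simpa only [map_add, LinearMap.add_apply, Pi.add_apply] using hu.add hu'
  · obtain ⟨J, hJ⟩ := 𝒱.exists_L_one_pow_eq_zero u
    rw [hW'.contragredient_formula hu hJ]
    have h1 : ∀ j ∈ Finset.range J, W.ev 𝒱 (W.Y ((𝒱.L 1 ^ j) u) w ((j : ℂ) - 2 * n - b) l) x =
        ∑ i, (F.M i).ev 𝒱 (y i)
          (((F.M i).contragredient 𝒱).Y ((𝒱.L 1 ^ j) u) (φ i) ((j : ℂ) - 2 * n - b) l) := by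
      intro j _
      refine h _ _ ?_
      rw [hf.isModuleMap]
      exact Represents.boxModule_Y hbox hφ _ _ _
    rw [Finset.sum_congr rfl fun j hj => by rw [h1 j hj, Finset.mul_sum], Finset.sum_comm]
    exact Finset.sum_congr rfl fun i _ =>
      (hM' _ (F.obj i)).contragredient_involution hu hJ (φ i) (y i) b l
  · simpa only [map_zero, LinearMap.zero_apply, Pi.zero_apply] using F.compatible_zero f

theorem Compatible.gradedProj (hf : IsBoxModuleMap 𝒱 Obj z W₁ W₂ W f) (h : F.Compatible f x y)
    (n : ℂ) : F.Compatible f (gradedProj (W.contragredient 𝒱).gr n x)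
      (fun i => gradedProj (F.M i).gr n (y i)) := by
  obtain ⟨g, hW⟩ := hf.source
  obtain ⟨g₁, hW'⟩ := hf.source_contragredient
  obtain ⟨g₂, hM⟩ := hf.obj
  obtain ⟨g₃, hbox⟩ := hf.box
  intro w φ hφ
  rw [hW.ev_gradedProj hW']
  refine h _ (fun i => (dualProj (F.M i).gr n (φ i : (F.M i).Dual).1 : (F.M i).Dual)) ?_
  rw [hf.map_gradedProj]
  exact Represents.boxModule_gradedProj hM hbox hφ n

theorem Compatible.L_zero_sub_pow (hf : IsBoxModuleMap 𝒱 Obj z W₁ W₂ W f)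
    (h : F.Compatible f x y) (r : ℂ) (j : ℕ) :
    F.Compatible f ((((W.contragredient 𝒱).L 𝒱 0 - r • 1) ^ j) x)
      (fun i => (((F.M i).L 𝒱 0 - r • 1) ^ j) (y i)) := by
  induction j with
  | zero => simpa using h
  | succ j ih =>
    simp only [pow_succ', Module.End.mul_apply, LinearMap.sub_apply, LinearMap.smul_apply,
      Module.End.one_apply, ModuleData.L_apply]
    simpa only [sub_eq_add_neg, neg_smul] using (ih.coeffY hf _ _ _).add (ih.smul (-r))

theorem Compatible.evalComp (hf : IsBoxModuleMap 𝒱 Obj z W₁ W₂ W f)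
    {s : LogSeries (W.contragredient 𝒱).carrier} {t : ∀ i, LogSeries (F.M i).carrier}
    (hs : s ∈ evaluableSeries (W.contragredient 𝒱).gr)
    (ht : ∀ i, t i ∈ evaluableSeries (F.M i).gr)
    (h : ∀ a k, F.Compatible f (s a k) (fun i => t i a k)) (p : ℤ) (ξ n : ℂ) :
    F.Compatible f (evalComp (W.contragredient 𝒱).gr s p ξ n)
      (fun i => evalComp (F.M i).gr (t i) p ξ n) := by
  intro w φ hφ
  rw [map_evalComp (W.ev 𝒱 w) hs]
  have h1 : ∀ i, (F.M i).ev 𝒱 (_root_.evalComp (F.M i).gr (t i) p ξ n) (φ i) =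
      ∑ᶠ c : ℂ × ℕ, (Complex.exp (c.1 * logBranch p ξ) * logBranch p ξ ^ c.2) •
        (F.M i).ev 𝒱 (_root_.gradedProj (F.M i).gr n (t i c.1 c.2)) (φ i) := fun i =>
    map_evalComp (φ i : (F.M i).Dual).1 (ht i) p ξ n
  simp only [h1]
  rw [← finsum_sum_comm]
  · refine finsum_congr fun c => ?_
    rw [(h c.1 c.2).gradedProj hf n w φ hφ, Finset.smul_sum]
  · intro i _
    refine ((ht i) n).subset fun c hc h0 => hc ?_
    dsimp only
    rw [h0, ModuleData.ev_zero, smul_zero]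

/-- The pairing of `w` with the value of a series is the sum of the pairings for the family. -/
theorem Compatible.finsum_eq (hf : IsBoxModuleMap 𝒱 Obj z W₁ W₂ W f)
    {s : LogSeries (W.contragredient 𝒱).carrier} {t : ∀ i, LogSeries (F.M i).carrier}
    (hs : s ∈ evaluableSeries (W.contragredient 𝒱).gr)
    (ht : ∀ i, t i ∈ evaluableSeries (F.M i).gr)
    (h : ∀ a k, F.Compatible f (s a k) (fun i => t i a k)) {w : W.carrier}
    {φ : ∀ i, ((F.M i).contragredient 𝒱).carrier}
    (hφ : F.Represents z (f w : boxSpace 𝒱 Obj z W₁ W₂).1 φ) (p : ℤ) (ξ : ℂ) :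
    ∑ᶠ n : ℂ, W.ev 𝒱 w (_root_.evalComp (W.contragredient 𝒱).gr s p ξ n) =
      ∑ i, pairEval (φ i : (F.M i).Dual) (t i) p ξ := by
  unfold pairEval
  rw [← finsum_sum_comm _ _ fun i _ => pairEval_support_finite (φ i : (F.M i).Dual) (t i) p ξ]
  exact finsum_congr fun n => Compatible.evalComp hf hs ht h p ξ n w φ hφ

theorem Compatible.chainComp (hf : IsBoxModuleMap 𝒱 Obj z W₁ W₂ W f) :
    ∀ (s : ℕ) (u : Fin s → V) (ξ n : Fin s → ℂ) {x : (W.contragredient 𝒱).carrier}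
      {y : ∀ i, (F.M i).carrier}, F.Compatible f x y →
      F.Compatible f (chainComp (W.contragredient 𝒱) s u ξ n x)
        (fun i => chainComp (F.M i) s u ξ n (y i))
  | 0, _, _, _, _, _, h => h
  | s + 1, u, ξ, n, x, y, h => by
    obtain ⟨g, hW'⟩ := hf.source_contragredient
    obtain ⟨g', hM⟩ := hf.obj
    exact Compatible.evalComp hf (hW'.Y_mem_evaluableSeries _ _)
      (fun i => (hM _ (F.obj i)).Y_mem_evaluableSeries _ _)
      (fun a k => (Compatible.chainComp hf s _ _ _ h).coeffY hf _ a k) _ _ _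

end ProductFamily

end Comparison

/-! ### The series attached to a module map -/

section Series

variable {V : Type v} [AddCommGroup V] [Module ℂ V] {𝒱 : VOA V}
  {W₁ W₂ W : ModuleData.{u} V}

theorem mapComp_zero_left (f : W.carrier →ₗ[ℂ] Module.Dual ℂ (W₁.carrier ⊗[ℂ] W₂.carrier)) (n : ℂ)
    (w₂ : W₂.carrier) : mapComp f n 0 w₂ = 0 :=
  Subtype.ext (LinearMap.ext fun w => by simp [mapComp])

theorem mapComp_zero_right (f : W.carrier →ₗ[ℂ] Module.Dual ℂ (W₁.carrier ⊗[ℂ] W₂.carrier)) (n : ℂ)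
    (w₁ : W₁.carrier) : mapComp f n w₁ 0 = 0 :=
  Subtype.ext (LinearMap.ext fun w => by simp [mapComp])

theorem mapComp_mem (f : W.carrier →ₗ[ℂ] Module.Dual ℂ (W₁.carrier ⊗[ℂ] W₂.carrier)) (n : ℂ)
    (w₁ : W₁.carrier) (w₂ : W₂.carrier) : mapComp f n w₁ w₂ ∈ gradedDualGr W.gr n := by
  intro m hm w hw
  have h : W.π n w = 0 := gradedProj_of_mem_ne W.gr hm hw
  simp [mapComp, h]

theorem mapComp_eq_zero (f : W.carrier →ₗ[ℂ] Module.Dual ℂ (W₁.carrier ⊗[ℂ] W₂.carrier)) {n : ℂ}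
    (hn : W.gr n = ⊥) (w₁ : W₁.carrier) (w₂ : W₂.carrier) : mapComp f n w₁ w₂ = 0 := by
  refine Subtype.ext (LinearMap.ext fun w => ?_)
  have h : W.π n w = 0 := (Submodule.mem_bot ℂ).1 (hn ▸ gradedProj_mem W.gr n w)
  simp [mapComp, h]

/-- The coefficients of `𝒴_f(w₁, x) w₂` are given by finite sums. -/
theorem exists_intOpOfMap_eq_sum {g₁ g₂ g' : 𝒱.Aut} (h₁ : IsTwistedModule 𝒱 g₁ W₁)
    (h₂ : IsTwistedModule 𝒱 g₂ W₂) (h' : IsTwistedModule 𝒱 g' (W.contragredient 𝒱)) (z : ℂ)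
    (f : W.carrier →ₗ[ℂ] Module.Dual ℂ (W₁.carrier ⊗[ℂ] W₂.carrier))
    (w₁ : W₁.carrier) (w₂ : W₂.carrier) {S₁ S₂ : Finset ℂ} (hS₁ : ∀ n, n ∉ S₁ → W₁.π n w₁ = 0)
    (hS₂ : ∀ n, n ∉ S₂ → W₂.π n w₂ = 0) (a : ℂ) : ∃ J₀ : ℕ, ∀ J, J₀ ≤ J → ∀ k,
    intOpOfMap 𝒱 z f w₁ w₂ a k = ∑ n₁ ∈ S₁, ∑ n₂ ∈ S₂,
      ∑ i ∈ Finset.range J, ∑ j ∈ Finset.range J, ∑ l ∈ Finset.range J,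
      (Complex.exp (-a * logBranch 0 z) * (-1) ^ (j + l) /
        ((i.factorial : ℂ) * j.factorial * l.factorial) *
        ((Polynomial.X - Polynomial.C (logBranch 0 z)) ^ (i + j + l)).coeff k) •
      (((W.contragredient 𝒱).L 𝒱 0 - (a + n₁ + n₂) • 1) ^ i)
        (mapComp f (a + n₁ + n₂) (((W₁.L 𝒱 0 - n₁ • 1) ^ j) (W₁.π n₁ w₁))
          (((W₂.L 𝒱 0 - n₂ • 1) ^ l) (W₂.π n₂ w₂)) : W.Dual) := by
  obtain ⟨K₁, hK₁⟩ := h₁.exists_pow_eq_zero w₁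
  obtain ⟨K₂, hK₂⟩ := h₂.exists_pow_eq_zero w₂
  have hK : ∀ (n₁ n₂ : ℂ) (j l : ℕ), ∃ K : ℕ, ∀ i, K ≤ i →
      (((W.contragredient 𝒱).L 𝒱 0 - (a + n₁ + n₂) • 1) ^ i)
        (mapComp f (a + n₁ + n₂) (((W₁.L 𝒱 0 - n₁ • 1) ^ j) (W₁.π n₁ w₁))
          (((W₂.L 𝒱 0 - n₂ • 1) ^ l) (W₂.π n₂ w₂)) : W.Dual) = 0 := by
    intro n₁ n₂ j l
    obtain ⟨K, -, hK⟩ := h'.L0_grading (a + n₁ + n₂)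
      (mapComp f (a + n₁ + n₂) (((W₁.L 𝒱 0 - n₁ • 1) ^ j) (W₁.π n₁ w₁))
          (((W₂.L 𝒱 0 - n₂ • 1) ^ l) (W₂.π n₂ w₂)) : W.Dual) (mapComp_mem f _ _ _)
    exact ⟨K, fun i hi => Module.End.pow_map_zero_of_le hi hK⟩
  choose K hK using hK
  refine ⟨max (max K₁ K₂) ((S₁ ×ˢ S₂ ×ˢ Finset.range K₁ ×ˢ Finset.range K₂).sup
    fun c => K c.1 c.2.1 c.2.2.1 c.2.2.2), fun J hJ k => ?_⟩
  rw [max_le_iff, max_le_iff] at hJ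
  unfold intOpOfMap
  rw [finsum_eq_sum_of_support_subset (s := S₁ ×ˢ S₂), Finset.sum_product]
  · refine Finset.sum_congr rfl fun n₁ hn₁ => Finset.sum_congr rfl fun n₂ hn₂ => ?_
    rw [finsum_eq_sum_of_support_subset
      (s := Finset.range J ×ˢ Finset.range J ×ˢ Finset.range J), Finset.sum_product]
    · exact Finset.sum_congr rfl fun i _ => Finset.sum_product _ _ _
    · rintro ⟨i, j, l⟩ hne
      by_contra hc
      refine hne ?_
      dsimp only
      by_cases hj : K₁ ≤ j
      · rw [hK₁ n₁ j hj, mapComp_zero_left]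
        exact (congrArg _ (map_zero _)).trans (smul_zero _)
      by_cases hl : K₂ ≤ l
      · rw [hK₂ n₂ l hl, mapComp_zero_right]
        exact (congrArg _ (map_zero _)).trans (smul_zero _)
      have hle : K n₁ n₂ j l ≤ J := le_trans (Finset.le_sup
        (f := fun c : ℂ × ℂ × ℕ × ℕ => K c.1 c.2.1 c.2.2.1 c.2.2.2) (b := (n₁, n₂, j, l))
        (by simpa using ⟨hn₁, hn₂, not_le.1 hj, not_le.1 hl⟩)) hJ.2
      refine (congrArg _ (hK n₁ n₂ j l i ?_)).trans (smul_zero _)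
      simp only [Finset.coe_product, Finset.coe_range, Set.mem_prod, Set.mem_Iio] at hc
      omega
  · intro n hne
    by_contra hc
    refine hne ?_
    rw [Finset.mem_coe, Finset.mem_product, not_and_or] at hc
    refine finsum_eq_zero_of_forall_eq_zero fun j => ?_
    rcases hc with hc | hc
    · rw [hS₁ _ hc, map_zero, mapComp_zero_left]
      exact (congrArg _ (map_zero _)).trans (smul_zero _)
    · rw [hS₂ _ hc, map_zero, mapComp_zero_right]
      exact (congrArg _ (map_zero _)).trans (smul_zero _)

variable {Obj : ModuleData.{u} V → Prop} {z : ℂ}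
  {f : W.carrier →ₗ[ℂ] (boxModule 𝒱 Obj z W₁ W₂).carrier}
  {F : ProductFamily 𝒱 Obj W₁ W₂}

/-- The components of `𝒴_f(w₁, z) w₂` and of the values at `z` of the operators of a family. -/
theorem ProductFamily.compatible_mapComp (hf : IsBoxModuleMap 𝒱 Obj z W₁ W₂ W f)
    (F : ProductFamily 𝒱 Obj W₁ W₂) (n : ℂ) (w₁ : W₁.carrier) (w₂ : W₂.carrier) :
    F.Compatible f (mapComp ((boxSpace 𝒱 Obj z W₁ W₂).subtype ∘ₗ f) n w₁ w₂ : W.Dual)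
      (fun i => evalComp (F.M i).gr (F.B i w₁ w₂) 0 z n) := by
  obtain ⟨g, hM⟩ := hf.obj
  obtain ⟨g', hbox⟩ := hf.box
  intro w φ hφ
  have h1 : W.ev 𝒱 w (mapComp ((boxSpace 𝒱 Obj z W₁ W₂).subtype ∘ₗ f) n w₁ w₂ : W.Dual) =
      (f (gradedProj W.gr n w) : boxSpace 𝒱 Obj z W₁ W₂).1 (w₁ ⊗ₜ[ℂ] w₂) := rfl
  rw [h1, hf.map_gradedProj]
  refine (Represents.boxModule_gradedProj hM hbox hφ n w₁ w₂).trans ?_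
  exact Finset.sum_congr rfl fun i _ =>
    pairEval_dualProj (hM _ (F.obj i)).internal n (φ i : (F.M i).Dual).1 _ 0 z

/-- The series `𝒴_f(w₁, x) w₂` has the same pairings as the intertwining operators of a family, since
it is obtained from its value at `z` in the same way as they are. -/
theorem ProductFamily.compatible_intOpOfMap (hf : IsBoxModuleMap 𝒱 Obj z W₁ W₂ W f)
    (F : ProductFamily 𝒱 Obj W₁ W₂) (w₁ : W₁.carrier) (w₂ : W₂.carrier) (a : ℂ) (k : ℕ) :
    F.Compatible f (intOpOfMap 𝒱 z ((boxSpace 𝒱 Obj z W₁ W₂).subtype ∘ₗ f) w₁ w₂ a k)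
      (fun i => F.B i w₁ w₂ a k) := by
  classical
  obtain ⟨g₁, h₁⟩ := hf.left
  obtain ⟨g₂, h₂⟩ := hf.right
  obtain ⟨g', h'⟩ := hf.source_contragredient
  obtain ⟨g, hM⟩ := hf.obj
  obtain ⟨S₁, hS₁, hS₁'⟩ := exists_finset_gradedProj h₁.internal w₁
  obtain ⟨S₂, hS₂, hS₂'⟩ := exists_finset_gradedProj h₂.internal w₂
  obtain ⟨J₀, hJ₀⟩ := exists_intOpOfMap_eq_sum h₁ h₂ h' z
    ((boxSpace 𝒱 Obj z W₁ W₂).subtype ∘ₗ f) w₁ w₂ hS₁ hS₂ a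
  choose J₁ hJ₁ using fun (i : F.ι) (n₁ n₂ : ℂ) => intertwining_coeff_eq h₁ h₂ (hM _ (F.obj i))
    (F.intertwining i).axioms (F.intertwining i).logBounded (gradedProj_mem W₁.gr n₁ w₁)
    (gradedProj_mem W₂.gr n₂ w₂) z a k
  set J := max J₀ ((Finset.univ ×ˢ S₁ ×ˢ S₂).sup fun c => J₁ c.1 c.2.1 c.2.2)
  have hJ : ∀ i, ∀ n₁ ∈ S₁, ∀ n₂ ∈ S₂, J₁ i n₁ n₂ ≤ J := fun i n₁ hn₁ n₂ hn₂ =>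
    le_trans (Finset.le_sup (f := fun c : F.ι × ℂ × ℂ => J₁ c.1 c.2.1 c.2.2) (b := (i, n₁, n₂))
      (by simpa using ⟨hn₁, hn₂⟩)) (le_max_right _ _)
  rw [hJ₀ J (le_max_left _ _)]
  have hB : ∀ i, F.B i w₁ w₂ a k = ∑ n₁ ∈ S₁, ∑ n₂ ∈ S₂,
      F.B i (gradedProj W₁.gr n₁ w₁) (gradedProj W₂.gr n₂ w₂) a k := fun i => by
    conv_lhs => rw [← hS₁', ← hS₂']
    simp only [map_sum, LinearMap.sum_apply, Finset.sum_apply]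
    exact Finset.sum_comm
  refine ProductFamily.Compatible.congr_right (ProductFamily.Compatible.sum S₁ fun n₁ hn₁ =>
    ProductFamily.Compatible.sum S₂ fun n₂ hn₂ => ?_) fun i => (hB i).symm
  refine ProductFamily.Compatible.congr_right (ProductFamily.Compatible.sum _ fun i _ =>
    ProductFamily.Compatible.sum _ fun j _ => ProductFamily.Compatible.sum _ fun l _ =>
      ((F.compatible_mapComp hf _ _ _).L_zero_sub_pow hf (a + n₁ + n₂) i).smul _)
    fun i => (hJ₁ i n₁ n₂ J (hJ i n₁ hn₁ n₂ hn₂)).symm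

end Series

/-! ### The axioms for the intertwining operator attached to a module map -/

section Axioms

variable {V : Type v} [AddCommGroup V] [Module ℂ V] {𝒱 : VOA V}
  {W₁ W₂ W : ModuleData.{u} V} {Obj : ModuleData.{u} V → Prop} {z : ℂ}
  {f : W.carrier →ₗ[ℂ] (boxModule 𝒱 Obj z W₁ W₂).carrier}

open ProductFamily

/-- Vectors of `W'` with the same pairings for all families agree, since every `f w` is represented by
some family. -/
theorem ProductFamily.eq_of_compatible {x x' : (W.contragredient 𝒱).carrier}
    (h : ∀ F : ProductFamily 𝒱 Obj W₁ W₂, ∃ y, F.Compatible f x y ∧ F.Compatible f x' y) :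
    x = x' := by
  refine ModuleData.ev_ext fun w => ?_
  obtain ⟨F, φ, hφ⟩ := exists_represents (f w : boxSpace 𝒱 Obj z W₁ W₂).2
  obtain ⟨y, hy, hy'⟩ := h F
  rw [hy w φ hφ, hy' w φ hφ]

/-- Pairings in the contragredient are sums of pairings in the modules of a family. -/
theorem ProductFamily.Compatible.pairEval_eq (hf : IsBoxModuleMap 𝒱 Obj z W₁ W₂ W f)
    {F : ProductFamily 𝒱 Obj W₁ W₂} {s : LogSeries (W.contragredient 𝒱).carrier}
    {t : ∀ i, LogSeries (F.M i).carrier} (hs : s ∈ evaluableSeries (W.contragredient 𝒱).gr)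
    (ht : ∀ i, t i ∈ evaluableSeries (F.M i).gr)
    (h : ∀ a k, F.Compatible f (s a k) (fun i => t i a k)) {w : W.carrier}
    {φ : ∀ i, ((F.M i).contragredient 𝒱).carrier}
    (hφ : F.Represents z (f w : boxSpace 𝒱 Obj z W₁ W₂).1 φ)
    {φ' : (W.contragredient 𝒱).Dual} (hφ' : φ'.1 = W.ev 𝒱 w) (p : ℤ) (ξ : ℂ) :
    pairEval φ' s p ξ = ∑ i, pairEval (φ i : (F.M i).Dual) (t i) p ξ := by
  rw [← Compatible.finsum_eq hf hs ht h hφ p ξ, ← hφ']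
  rfl

/-- A vector in the contragredient of a module with finite-dimensional weight spaces has only
finitely many coordinates in each weight, so the finiteness of the components of `𝒴_f(w₁, z) w₂`
follows from that for finitely many families. -/
theorem intOpOfMap_mem_evaluableSeries (hf : IsBoxModuleMap 𝒱 Obj z W₁ W₂ W f)
    (w₁ : W₁.carrier) (w₂ : W₂.carrier) :
    intOpOfMap 𝒱 z ((boxSpace 𝒱 Obj z W₁ W₂).subtype ∘ₗ f) w₁ w₂ ∈
      evaluableSeries (W.contragredient 𝒱).gr := by
  intro n
  obtain ⟨g, hW⟩ := hf.source
  obtain ⟨g', hW'⟩ := hf.source_contragredient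
  have := hf.finiteDimensional n
  set b := Module.finBasis ℂ (W.gr n)
  choose F φ hφ using fun i =>
    exists_represents (f (b i : W.carrier) : boxSpace 𝒱 Obj z W₁ W₂).2
  refine (Set.finite_iUnion fun i => Set.finite_iUnion fun j =>
    (F i).mem_evaluableSeries j w₁ w₂ n).subset fun c hc => ?_
  by_contra hcon
  simp only [Set.mem_iUnion, Set.mem_ofPred_eq, not_exists, not_not] at hcon
  refine hc (ModuleData.ev_ext fun w => ?_)
  set x := gradedProj (W.contragredient 𝒱).gr n
    (intOpOfMap 𝒱 z ((boxSpace 𝒱 Obj z W₁ W₂).subtype ∘ₗ f) w₁ w₂ c.1 c.2)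
  have hb : ∀ i, W.ev 𝒱 (b i : W.carrier) x = 0 := fun i => by
    rw [((F i).compatible_intOpOfMap hf w₁ w₂ c.1 c.2).gradedProj hf n _ _ (hφ i)]
    exact Finset.sum_eq_zero fun j _ => by
      dsimp only
      rw [hcon i j, ModuleData.ev_zero]
  have hx : (x : W.Dual).1 ∘ₗ (W.gr n).subtype = 0 := b.ext hb
  have hxx : gradedProj (W.contragredient 𝒱).gr n x = x := gradedProj_gradedProj hW'.internal _ _
  rw [← hxx, hW.ev_gradedProj hW', map_zero]
  exact LinearMap.congr_fun hx ⟨_, gradedProj_mem W.gr n w⟩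

/-- The coefficient of `x ^ a` lies in the sum of the spaces `(W')_[a + n₁ + n₂]` for the finitely many
weights `n₁` of `w₁` and `n₂` of `w₂`, and `W` is bounded below. -/
theorem intOpOfMap_lower_truncation (hf : IsBoxModuleMap 𝒱 Obj z W₁ W₂ W f)
    (w₁ : W₁.carrier) (w₂ : W₂.carrier) (n : ℂ) (k : ℕ) : ∃ N : ℕ, ∀ l : ℕ, N ≤ l →
    intOpOfMap 𝒱 z ((boxSpace 𝒱 Obj z W₁ W₂).subtype ∘ₗ f) w₁ w₂ (-(n + l) - 1) k = 0 := by
  obtain ⟨g₁, h₁⟩ := hf.left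
  obtain ⟨g₂, h₂⟩ := hf.right
  obtain ⟨g, hW⟩ := hf.source
  obtain ⟨S₁, hS₁, -⟩ := exists_finset_gradedProj h₁.internal w₁
  obtain ⟨S₂, hS₂, -⟩ := exists_finset_gradedProj h₂.internal w₂
  choose r hr using fun m : ℂ => hW.lower_bounded m
  refine ⟨(S₁ ×ˢ S₂).sup fun m => ⌈-r (-n - 1 + m.1 + m.2)⌉₊ + 1, fun l hl => ?_⟩
  unfold intOpOfMap
  refine finsum_eq_zero_of_forall_eq_zero fun m => finsum_eq_zero_of_forall_eq_zero fun j => ?_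
  have hzero : mapComp ((boxSpace 𝒱 Obj z W₁ W₂).subtype ∘ₗ f) (-(n + l) - 1 + m.1 + m.2)
      (((W₁.L 𝒱 0 - m.1 • 1) ^ j.2.1) (W₁.π m.1 w₁))
      (((W₂.L 𝒱 0 - m.2 • 1) ^ j.2.2) (W₂.π m.2 w₂)) = 0 := by
    by_cases hm₁ : m.1 ∈ S₁
    · by_cases hm₂ : m.2 ∈ S₂
      · refine mapComp_eq_zero _ ?_ _ _
        have h1 : ⌈-r (-n - 1 + m.1 + m.2)⌉₊ + 1 ≤ l := le_trans (Finset.le_sup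
          (f := fun m : ℂ × ℂ => ⌈-r (-n - 1 + m.1 + m.2)⌉₊ + 1)
          (Finset.mem_product.2 ⟨hm₁, hm₂⟩)) hl
        have h2 : ((⌈-r (-n - 1 + m.1 + m.2)⌉₊ : ℝ)) + 1 ≤ l := by exact_mod_cast h1
        have h3 := Nat.le_ceil (-r (-n - 1 + m.1 + m.2))
        have h4 := hr (-n - 1 + m.1 + m.2) (-l) (by linarith)
        rw [← h4]
        congr 1
        push_cast
        ring
      · rw [show W₂.π m.2 w₂ = 0 from hS₂ _ hm₂, map_zero, mapComp_zero_right]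
    · rw [show W₁.π m.1 w₁ = 0 from hS₁ _ hm₁, map_zero, mapComp_zero_left]
  rw [hzero]
  exact (congrArg _ (map_zero _)).trans (smul_zero _)

theorem intOpOfMap_linear (hf : IsBoxModuleMap 𝒱 Obj z W₁ W₂ W f) :
    ∃ B : W₁.carrier →ₗ[ℂ] W₂.carrier →ₗ[ℂ] LogSeries (W.contragredient 𝒱).carrier,
      ∀ w₁ w₂, intOpOfMap 𝒱 z ((boxSpace 𝒱 Obj z W₁ W₂).subtype ∘ₗ f) w₁ w₂ = B w₁ w₂ := by
  have hc := fun F : ProductFamily 𝒱 Obj W₁ W₂ => F.compatible_intOpOfMap hf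
  refine ⟨LinearMap.mk₂ ℂ (intOpOfMap 𝒱 z ((boxSpace 𝒱 Obj z W₁ W₂).subtype ∘ₗ f))
    (fun w₁ w₁' w₂ => ?_) (fun r w₁ w₂ => ?_) (fun w₁ w₂ w₂' => ?_) (fun r w₁ w₂ => ?_),
    fun _ _ => rfl⟩ <;> refine funext fun a => funext fun k => eq_of_compatible (f := f) fun F => ?_
  · exact ⟨_, hc F _ _ a k, ((hc F w₁ w₂ a k).add (hc F w₁' w₂ a k)).congr_right
      fun i => by simp⟩
  · exact ⟨_, hc F _ _ a k, ((hc F w₁ w₂ a k).smul r).congr_right fun i => by simp⟩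
  · exact ⟨_, hc F _ _ a k, ((hc F w₁ w₂ a k).add (hc F w₁ w₂' a k)).congr_right
      fun i => by simp⟩
  · exact ⟨_, hc F _ _ a k, ((hc F w₁ w₂ a k).smul r).congr_right fun i => by simp⟩

theorem intOpOfMap_Lneg1_derivative (hf : IsBoxModuleMap 𝒱 Obj z W₁ W₂ W f) (w₁ : W₁.carrier)
    (w₂ : W₂.carrier) :
    derivSeries (intOpOfMap 𝒱 z ((boxSpace 𝒱 Obj z W₁ W₂).subtype ∘ₗ f) w₁ w₂) =
      intOpOfMap 𝒱 z ((boxSpace 𝒱 Obj z W₁ W₂).subtype ∘ₗ f) (W₁.L 𝒱 (-1) w₁) w₂ := by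
  have hc := fun F : ProductFamily 𝒱 Obj W₁ W₂ => F.compatible_intOpOfMap hf
  refine funext fun a => funext fun k => eq_of_compatible (f := f) fun F => ⟨_, ?_, hc F _ _ a k⟩
  refine (((hc F w₁ w₂ (a + 1) k).smul (a + 1)).add
    ((hc F w₁ w₂ (a + 1) (k + 1)).smul ((k : ℂ) + 1))).congr_right fun i => ?_
  exact congrFun (congrFun ((F.intertwining i).axioms.Lneg1_derivative w₁ w₂) a) k

/-- An element `φ'` of the double contragredient is the pairing with a vector `w`.  For a family
representing `f w`, each of the three series is the sum of the corresponding series of the family, and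
the preferred branch is the sum of those of the family. -/
theorem intOpOfMap_duality (hf : IsBoxModuleMap 𝒱 Obj z W₁ W₂ W f) (u : V) (w₁ : W₁.carrier)
    (w₂ : W₂.carrier) (φ' : (W.contragredient 𝒱).Dual) :
    let 𝒴 := intOpOfMap 𝒱 z ((boxSpace 𝒱 Obj z W₁ W₂).subtype ∘ₗ f)
    let W₃ := W.contragredient 𝒱
    ∃ f : (Fin 2 → ℂ) → ℂ, IsPreferredBranch f ∧ ∀ z₁ z₂ : ℂ,
      (‖z₂‖ < ‖z₁‖ → z₂ ≠ 0 →
        Summable (fun n : ℂ =>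
          pairEval φ' (W₃.Y u (evalComp W₃.gr (𝒴 w₁ w₂) 0 z₂ n)) 0 z₁) ∧
        (|argZ (z₁ - z₂) - argZ z₁| < Real.pi / 2 →
          HasSum (fun n : ℂ =>
            pairEval φ' (W₃.Y u (evalComp W₃.gr (𝒴 w₁ w₂) 0 z₂ n)) 0 z₁) (f ![z₁, z₂]))) ∧
      (‖z₁‖ < ‖z₂‖ → z₁ ≠ 0 →
        Summable (fun n : ℂ =>
          pairEval φ' (𝒴 w₁ (evalComp W₂.gr (W₂.Y u w₂) 0 z₁ n)) 0 z₂) ∧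
        (-(3 * Real.pi / 2) < argZ (z₁ - z₂) - argZ z₂ →
          argZ (z₁ - z₂) - argZ z₂ < -(Real.pi / 2) →
          HasSum (fun n : ℂ =>
            pairEval φ' (𝒴 w₁ (evalComp W₂.gr (W₂.Y u w₂) 0 z₁ n)) 0 z₂) (f ![z₁, z₂]))) ∧
      (‖z₁ - z₂‖ < ‖z₂‖ → z₁ ≠ z₂ →
        Summable (fun n : ℂ =>
          pairEval φ' (𝒴 (evalComp W₁.gr (W₁.Y u w₁) 0 (z₁ - z₂) n) w₂) 0 z₂) ∧
        (|argZ z₁ - argZ z₂| < Real.pi / 2 →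
          HasSum (fun n : ℂ =>
            pairEval φ' (𝒴 (evalComp W₁.gr (W₁.Y u w₁) 0 (z₁ - z₂) n) w₂) 0 z₂)
            (f ![z₁, z₂]))) := by
  intro 𝒴 W₃
  obtain ⟨g, hW⟩ := hf.source
  obtain ⟨g', hW'⟩ := hf.source_contragredient
  obtain ⟨g'', hM⟩ := hf.obj
  obtain ⟨w, hw⟩ := hW.exists_eq_ev hf.finiteDimensional φ'
  obtain ⟨F, φ, hφ⟩ := exists_represents (f w : boxSpace 𝒱 Obj z W₁ W₂).2
  have hc := F.compatible_intOpOfMap hf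
  choose G hG H using fun i =>
    (F.intertwining i).axioms.duality u w₁ w₂ (φ i : (F.M i).Dual)
  have e₁ : ∀ z₁ z₂ n, pairEval φ' (W₃.Y u (evalComp W₃.gr (𝒴 w₁ w₂) 0 z₂ n)) 0 z₁ =
      ∑ i, pairEval (φ i : (F.M i).Dual)
        ((F.M i).Y u (evalComp (F.M i).gr (F.B i w₁ w₂) 0 z₂ n)) 0 z₁ := fun z₁ z₂ n =>
    Compatible.pairEval_eq hf (hW'.Y_mem_evaluableSeries _ _)
      (fun i => (hM _ (F.obj i)).Y_mem_evaluableSeries _ _)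
      (fun a k => (Compatible.evalComp hf (intOpOfMap_mem_evaluableSeries hf w₁ w₂)
        (fun i => F.mem_evaluableSeries i w₁ w₂) (hc w₁ w₂) 0 z₂ n).coeffY hf u a k) hφ hw 0 z₁
  have e₂ : ∀ w₁ w₂ ξ, pairEval φ' (𝒴 w₁ w₂) 0 ξ =
      ∑ i, pairEval (φ i : (F.M i).Dual) (F.B i w₁ w₂) 0 ξ := fun w₁ w₂ ξ =>
    Compatible.pairEval_eq hf (intOpOfMap_mem_evaluableSeries hf w₁ w₂)
      (fun i => F.mem_evaluableSeries i w₁ w₂) (hc w₁ w₂) hφ hw 0 ξ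
  refine ⟨∑ i, G i, IsPreferredBranch.sum _ hG, fun z₁ z₂ => ?_⟩
  simp only [e₁, e₂, Finset.sum_apply]
  exact ⟨fun h h' => ⟨summable_sum fun i _ => ((H i z₁ z₂).1 h h').1,
      fun h1 => hasSum_sum fun i _ => ((H i z₁ z₂).1 h h').2 h1⟩,
    fun h h' => ⟨summable_sum fun i _ => ((H i z₁ z₂).2.1 h h').1,
      fun h1 h2 => hasSum_sum fun i _ => ((H i z₁ z₂).2.1 h h').2 h1 h2⟩,
    fun h h' => ⟨summable_sum fun i _ => ((H i z₁ z₂).2.2 h h').1,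
      fun h1 => hasSum_sum fun i _ => ((H i z₁ z₂).2.2 h h').2 h1⟩⟩

theorem isOpen_strictAnti_norm (m : ℕ) :
    IsOpen {q : Fin m → ℂ | StrictAnti (fun i => ‖q i‖) ∧ ∀ i, q i ≠ 0} := by
  have h1 : {q : Fin m → ℂ | StrictAnti (fun i => ‖q i‖) ∧ ∀ i, q i ≠ 0} =
      (⋂ i, ⋂ j, {q | i < j → ‖q j‖ < ‖q i‖}) ∩ ⋂ i, {q | q i ≠ 0} := by
    ext q
    simp only [Set.mem_ofPred_eq, Set.mem_inter_iff, Set.mem_iInter]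
    exact Iff.rfl
  rw [h1]
  refine IsOpen.inter (isOpen_iInter_of_finite fun i => isOpen_iInter_of_finite fun j => ?_)
    (isOpen_iInter_of_finite fun i => isOpen_ne_fun (by fun_prop) (by fun_prop))
  by_cases hij : i < j
  · simp only [hij, forall_const]
    exact isOpen_lt (by fun_prop) (by fun_prop)
  · simp [hij]

/-- The products with at least two twisted vertex operators are sums of such products for a family, and
multivalued functions with regular singularities can be added. -/
theorem intOpOfMap_convergence (hf : IsBoxModuleMap 𝒱 Obj z W₁ W₂ W f) (s : ℕ) (hs : 1 ≤ s)
    (u : Fin (s + 1) → V) (w₁ : W₁.carrier) (w₂ : W₂.carrier) (φ' : (W.contragredient 𝒱).Dual)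
    (p : Fin (s + 2) → ℂ) (hp : StrictAnti (fun i => ‖p i‖)) (hp0 : ∀ i, p i ≠ 0) :
    let 𝒴 : W₁.carrier → W₂.carrier → LogSeries (W.contragredient 𝒱).carrier :=
      intOpOfMap 𝒱 z ((boxSpace 𝒱 Obj z W₁ W₂).subtype ∘ₗ f)
    Summable (productTerm (W₃ := W.contragredient 𝒱) 𝒴 s u w₁ w₂ φ' p) ∧
    ∃ F : (Fin (s + 2) → ℂ) → ℂ, AnalyticAt ℂ F p ∧
      (∀ᶠ q in 𝓝 p, SameSheet p q →
        ∑' n, productTerm (W₃ := W.contragredient 𝒱) 𝒴 s u w₁ w₂ φ' q n = F q) ∧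
      ExtendsOn (confRegion (s + 2)) p F ∧
      HasRegularSingularities (confRegion (s + 2)) p F := by
  intro 𝒴
  obtain ⟨g, hW⟩ := hf.source
  obtain ⟨g', hW'⟩ := hf.source_contragredient
  obtain ⟨g'', hM⟩ := hf.obj
  obtain ⟨w, hw⟩ := hW.exists_eq_ev hf.finiteDimensional φ'
  obtain ⟨F, φ, hφ⟩ := exists_represents (f w : boxSpace 𝒱 Obj z W₁ W₂).2
  have e : ∀ q, productTerm (W₃ := W.contragredient 𝒱) 𝒴 s u w₁ w₂ φ' q = fun n =>
      ∑ i, productTerm (W₃ := F.M i) (fun w₁ w₂ => F.B i w₁ w₂) s u w₁ w₂ (φ i : (F.M i).Dual) q n :=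
    fun q => funext fun n =>
      Compatible.pairEval_eq hf (hW'.Y_mem_evaluableSeries _ _)
        (fun i => (hM _ (F.obj i)).Y_mem_evaluableSeries _ _)
        (fun a k => (Compatible.chainComp hf s _ _ _ (Compatible.evalComp hf
          (intOpOfMap_mem_evaluableSeries hf w₁ w₂) (fun i => F.mem_evaluableSeries i w₁ w₂)
          (F.compatible_intOpOfMap hf w₁ w₂) 0 _ _)).coeffY hf (u 0) a k) hφ hw 0 (q 0)
  have H := fun i q hq hq0 =>
    (F.intertwining i).axioms.convergence s hs u w₁ w₂ (φ i : (F.M i).Dual) q hq hq0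
  choose G hG hGeq hGext hGreg using fun i => (H i p hp hp0).2
  have hsum := IsRegularGerm.sum Finset.univ fun i =>
    (⟨hG i, hGext i, hGreg i⟩ : IsRegularGerm (confRegion (s + 2)) p (G i))
  refine ⟨?_, ∑ i, G i, hsum.analyticAt, ?_, hsum.extendsOn, hsum.regular⟩
  · rw [e]
    exact summable_sum fun i _ => (H i p hp hp0).1
  · filter_upwards [Filter.eventually_all.2 hGeq,
      (isOpen_strictAnti_norm (s + 2)).mem_nhds ⟨hp, hp0⟩] with q h1 h2 hsheet
    rw [e, Summable.tsum_finsetSum fun i _ => (H i q h2.1 h2.2).1, Finset.sum_apply]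
    exact Finset.sum_congr rfl fun i _ => h1 i hsheet

theorem intOpOfMap_axioms (hf : IsBoxModuleMap 𝒱 Obj z W₁ W₂ W f) :
    IntertwiningAxioms 𝒱 (W₃ := W.contragredient 𝒱)
      (intOpOfMap 𝒱 z ((boxSpace 𝒱 Obj z W₁ W₂).subtype ∘ₗ f)) where
  linear := intOpOfMap_linear hf
  evaluable := intOpOfMap_mem_evaluableSeries hf
  lower_truncation := intOpOfMap_lower_truncation hf
  duality := intOpOfMap_duality hf
  convergence := intOpOfMap_convergence hf
  Lneg1_derivative := intOpOfMap_Lneg1_derivative hf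

/-- The vectors of `W` represented by families in which the powers of `log x` are at most `K` form a
submodule.  If `W` is finitely generated, it is all of `W` for large `K`. -/
theorem intOpOfMap_logBounded (hf : IsBoxModuleMap 𝒱 Obj z W₁ W₂ W f) (hfg : W.FinitelyGenerated)
    (w₁ : W₁.carrier) (w₂ : W₂.carrier) :
    LogBounded (intOpOfMap 𝒱 z ((boxSpace 𝒱 Obj z W₁ W₂).subtype ∘ₗ f) w₁ w₂) := by
  classical
  obtain ⟨g, hbox⟩ := hf.box
  obtain ⟨S, hS⟩ := hfg
  let N : ℕ → Submodule ℂ W.carrier := fun K =>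
    { carrier := {w | ∃ (F : ProductFamily 𝒱 Obj W₁ W₂)
          (φ : ∀ i, ((F.M i).contragredient 𝒱).carrier),
          F.Represents z (f w : boxSpace 𝒱 Obj z W₁ W₂).1 φ ∧
          ∀ i a k, K < k → F.B i w₁ w₂ a k = 0}
      zero_mem' := by
        refine ⟨⟨Empty, Empty.elim, Empty.rec, Empty.rec, Empty.rec⟩, fun _ => 0, ?_, Empty.rec⟩
        rw [map_zero]
        exact represents_zero _ z
      add_mem' := by
        rintro w w' ⟨F, φ, hφ, hF⟩ ⟨F', φ', hφ', hF'⟩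
        refine ⟨F.append F', (fun i => Sum.rec φ φ' i :
          ∀ i, (((F.append F').M i).contragredient 𝒱).carrier), ?_, Sum.rec hF hF'⟩
        rw [map_add]
        exact hφ.append hφ'
      smul_mem' := by
        rintro r w ⟨F, φ, hφ, hF⟩
        refine ⟨F, fun i => r • φ i, ?_, hF⟩
        rw [map_smul]
        exact hφ.smul r }
  have hmem : ∀ w, ∃ K₀, ∀ K, K₀ ≤ K → w ∈ N K := by
    intro w
    obtain ⟨F, φ, hφ⟩ := exists_represents (f w : boxSpace 𝒱 Obj z W₁ W₂).2
    choose K hK using fun i => (F.intertwining i).logBounded w₁ w₂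
    exact ⟨Finset.univ.sup K, fun K' hK' => ⟨F, φ, hφ, fun i a k hk =>
      hK i a k (((Finset.le_sup (Finset.mem_univ i)).trans hK').trans_lt hk)⟩⟩
  choose K₀ hK₀ using hmem
  have htop := hS (N (S.sup K₀)) (fun w hw => hK₀ w _ (Finset.le_sup hw)) (by
    rintro v w ⟨F, φ, hφ, hF⟩ a k
    refine ⟨F, fun i => ((F.M i).contragredient 𝒱).Y v (φ i) a k, ?_, hF⟩
    rw [hf.isModuleMap]
    exact Represents.boxModule_Y hbox hφ v a k)
  refine ⟨S.sup K₀, fun a k hk => ModuleData.ev_ext fun w => ?_⟩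
  obtain ⟨F, φ, hφ, hF⟩ : w ∈ N (S.sup K₀) := htop ▸ Submodule.mem_top
  rw [F.compatible_intOpOfMap hf w₁ w₂ a k w φ hφ, map_zero]
  exact Finset.sum_eq_zero fun i _ => by
    dsimp only
    rw [hF i a k hk, ModuleData.ev_zero]

theorem IsBoxModuleMap.definesIntertwiningOperator (hf : IsBoxModuleMap 𝒱 Obj z W₁ W₂ W f) :
    DefinesIntertwiningOperator 𝒱 z ((boxSpace 𝒱 Obj z W₁ W₂).subtype ∘ₗ f) where
  value w w₁ w₂ := by
    obtain ⟨F, φ, hφ⟩ := exists_represents (f w : boxSpace 𝒱 Obj z W₁ W₂).2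
    refine Eq.trans ?_ (hφ w₁ w₂).symm
    exact Compatible.finsum_eq hf (intOpOfMap_mem_evaluableSeries hf w₁ w₂)
      (fun i => F.mem_evaluableSeries i w₁ w₂) (F.compatible_intOpOfMap hf w₁ w₂) hφ 0 z
  axioms := intOpOfMap_axioms hf
  logBounded_of_finitelyGenerated := intOpOfMap_logBounded hf
  intertwining h := ⟨h, intOpOfMap_axioms hf⟩

end Axioms

/-- In a category satisfying the standing assumption all hypotheses on a map to `W₁ ⊠̃ W₂` hold; the
equivalence with the double contragredient gives the finite-dimensionality of the weight spaces. -/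
theorem isBoxModuleMap_of_mem {V : Type v} [AddCommGroup V] [Module ℂ V] {𝒱 : VOA V}
    {G : Subgroup 𝒱.Aut} {C : ModuleCategory.{u} 𝒱 G} {z : ℂ} (hC : C.StandingAssumption z)
    {g₁ g₂ : G} {W₁ W₂ W : ModuleData.{u} V} (hW₁ : C.Mem g₁ W₁) (hW₂ : C.Mem g₂ W₂)
    (hW : C.Mem (g₁ * g₂)⁻¹ W) {f : W.carrier →ₗ[ℂ] (C.box z g₁ g₂ W₁ W₂).carrier}
    (hf : ModuleData.IsModuleMap f) :
    IsBoxModuleMap 𝒱 (C.Mem (g₁ * g₂)) z W₁ W₂ W f where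
  left := ⟨_, hW₁.isTwistedModule⟩
  right := ⟨_, hW₂.isTwistedModule⟩
  obj := ⟨_, fun _ hM => hM.isTwistedModule⟩
  obj_contragredient := ⟨_, fun M hM => (hC.contragredient_mem _ M hM).isTwistedModule⟩
  box := ⟨_, (hC.box_mem _ _ _ _ hW₁ hW₂).isTwistedModule⟩
  source := ⟨_, hW.isTwistedModule⟩
  source_contragredient := ⟨_, (hC.contragredient_mem _ _ hW).isTwistedModule⟩
  finiteDimensional := by
    have h' := hC.contragredient_mem _ _ hW
    obtain ⟨e, he⟩ := hC.double_contragredient _ _ hW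
    exact hW.isTwistedModule.finiteDimensional_gr h'.isTwistedModule
      (hC.contragredient_mem _ _ h').isTwistedModule e he
  isModuleMap := hf

theorem mainTheorem7 {V : Type v} [AddCommGroup V] [Module ℂ V] (𝒱 : VOA V)
    (G : Subgroup 𝒱.Aut) (C : ModuleCategory.{u} 𝒱 G) (z : ℂ) (hz : z ≠ 0)
    (hC : C.StandingAssumption z) (g₁ g₂ : G) (W₁ W₂ : ModuleData.{u} V)
    (hW₁ : C.Mem g₁ W₁) (hW₂ : C.Mem g₂ W₂) :
    (∀ W : ModuleData.{u} V, C.Mem (g₁ * g₂)⁻¹ W →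
      ∀ f : W.carrier →ₗ[ℂ] (C.box z g₁ g₂ W₁ W₂).carrier, ModuleData.IsModuleMap f →
        DefinesIntertwiningOperator 𝒱 z
          ((boxSpace 𝒱 (C.Mem (g₁ * g₂)) z W₁ W₂).subtype ∘ₗ f)) ∧
    DefinesIntertwiningOperator 𝒱 z (W := C.box z g₁ g₂ W₁ W₂)
      (boxSpace 𝒱 (C.Mem (g₁ * g₂)) z W₁ W₂).subtype :=
  ⟨fun _ hW _ hf => (isBoxModuleMap_of_mem hC hW₁ hW₂ hW hf).definesIntertwiningOperator,
    (isBoxModuleMap_of_mem hC hW₁ hW₂ (hC.box_mem _ _ _ _ hW₁ hW₂) (f := LinearMap.id)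
      fun _ _ _ _ => rfl).definesIntertwiningOperator⟩
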